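/- **Conventions.** Indices $a,b,\dots\in\{0,\dots,10\}$ are raised and lowered with $\eta=\mathrm{diag}(-1,+1,\dots,+1)$, repeated indices are summed over their full range, and $\epsilon_{0\,1\cdots 10}=+1$. Let $\Gamma_a$ act on $\mathbf{32}=\mathbb{R}^{32}$ with $\Gamma_a\Gamma_b+\Gamma_b\Gamma_a=2\eta_{ab}$ and $\Gamma_0\Gamma_1\cdots\Gamma_{10}=1$, let $\Gamma_{a_1\cdots a_p}$ be the skew-symmetrized products (with prefactor $1/p!$), and let $(\bar\psi\phi)=\psi^\alpha\eta_{\alpha\beta}\phi^\beta$ be a non-degenerate skew-symmetric bilinear form on $\mathbb{R}^{32}$ for which all $\Gamma_a$ are skew self-adjoint. For $s\in\mathbb{R}$ consider the free graded-commutative super-algebra over $\mathbb{R}$ on generators $e^a$, $e_{a_1a_2}=e_{[a_1a_2]}$, $e_{a_1\cdots a_5}=e_{[a_1\cdots a_5]}$ of bidegree $(1,\mathrm{even})$ and $\psi^\alpha,\phi^\alpha,\psi_a^\alpha$ ($1\le\alpha\le 32$) of bidegree $(1,\mathrm{odd})$, with sign rule $xy=(-1)^{n_xn_y+\sigma_x\sigma_y}yx$,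 and its derivation $\mathrm{d}$ of bidegree $(1,\mathrm{even})$ given by $$\mathrm{d}\psi=0,\quad \mathrm{d}e^a=(\bar\psi\Gamma^a\psi),\quad \mathrm{d}e_{a_1a_2}=-(\bar\psi\Gamma_{a_1a_2}\psi),\quad \mathrm{d}e_{a_1\cdots a_5}=(\bar\psi\Gamma_{a_1\cdots a_5}\psi),$$ $$\mathrm{d}\phi=2(1+s)\,\Gamma_a\psi\,e^a+\Gamma^{a_1a_2}\psi\,e_{a_1a_2}+2\big(\tfrac1{5!}+\tfrac{s}{6!}\big)\Gamma^{a_1\cdots a_5}\psi\,e_{a_1\cdots a_5},$$ $$\mathrm{d}\psi_a=\Gamma_{ac}\psi\,e^c-\Gamma_c\psi\,e_a{}^c .$$ Let $G_4=\tfrac12(\bar\psi\Gamma_{a_1a_2}\psi)e^{a_1}e^{a_2}$ and, for real coefficients $(\alpha_0,\dots,\alpha_4,\beta_1,\beta_2,\beta_3,\beta_1')$, $$\begin{aligned}\widehat P_3={}&\alpha_0\,e_{a_1a_2}e^{a_1}e^{a_2}+\alpha_1\,e^{a_1}{}_{a_2}e^{a_2}{}_{a_3}e^{a_3}{}_{a_1}+\alpha_2\,e^{a_1\cdots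 a_4b_1}e_{b_1}{}^{b_2}e_{b_2a_1\cdots a_4}\\&+\alpha_3\,\epsilon_{a_1\cdots a_5b_1\cdots b_5c}\,e^{a_1\cdots a_5}e^{b_1\cdots b_5}e^c+\alpha_4\,\epsilon_{a_1a_2a_3b_1b_2b_3c_1\cdots c_5}\,e^{a_1a_2a_3d_1d_2}e_{d_1d_2}{}^{b_1b_2b_3}e^{c_1\cdots c_5}\\&+\beta_1(\bar\psi\Gamma_a\phi)e^a+\beta_2(\bar\psi\Gamma_{a_1a_2}\phi)e^{a_1a_2}+\beta_3(\bar\psi\Gamma_{a_1\cdots a_5}\phi)e^{a_1\cdots a_5}\\&+\beta_1'\big((\bar\psi\Gamma^{ab}\psi_a)e_b-(\bar\psi\Gamma_b\psi_a)e^{ab}\big).\end{aligned}$$ **Proposition (Three-form with vector-spinor).** (1) For every $s\in\mathbb{R}$, the Bianchi identity $\mathrm{d}\widehat P_3=G_4$ is solved by $$\alpha_0=-\tfrac1{20},\quad \alpha_1=-\tfrac1{60},\quad \beta_1'=-\tfrac1{20},\quad \alpha_2=\alpha_3=\alpha_4=\beta_1=\beta_2=\beta_3=0.$$ (2) For every $s\neq0$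 it is also solved by $\beta_1'=0$ and $$\alpha_0=-\tfrac1{10}\tfrac{6+2s+s^2}{s^2},\quad \alpha_1=\tfrac1{30}\tfrac{6+2s}{s^2},\quad \alpha_2=\tfrac1{2\cdot 6!}\tfrac{(6+s)^2}{s^2},\quad \alpha_3=\tfrac1{10\cdot5!\cdot6!}\tfrac{(6+s)^2}{s^2},\quad \alpha_4=-\tfrac1{18\cdot5!\cdot6!}\tfrac{(6+s)^2}{s^2},$$ $$\beta_1=-\tfrac1{10}\tfrac{3-2s}{s^2},\quad \beta_2=-\tfrac1{20}\tfrac{3+s}{s^2},\quad \beta_3=-\tfrac3{10\cdot6!}\tfrac{6+s}{s^2},$$ and the solutions of $\mathrm{d}\widehat P_3=G_4$ are exactly the affine combinations $(1-t)\,(\text{solution (2)})+t\,(\text{solution (1)})$, $t\in\mathbb{R}$. -/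

import Mathlib

open scoped BigOperators

noncomputable section

namespace MAlg

/-! ### Tensor conventions -/

/-- The diagonal entry `η_{aa} = η^{aa}` of the Minkowski metric `diag(-1, +1, …, +1)` on
`ℝ^{1,10}`.  As `η` is diagonal, raising or lowering an index `a` is multiplication by
`eta a`. -/
def eta (a : Fin 11) : ℝ := if a = 0 then -1 else 1

/-- The factor which raises (or lowers) all the indices of the tuple `a`. -/
def etas {p : ℕ} (a : Fin p → Fin 11) : ℝ := ∏ i, eta (a i)

/-- The sign of a permutation, as a real number. -/
def sgn {p : ℕ} (σ : Equiv.Perm (Fin p)) : ℝ := ((Equiv.Perm.sign σ : ℤ) : ℝ)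

open Classical in
/-- The Levi-Civita symbol with lower indices, `ε_{0 1 2 ⋯ 10} = +1`. -/
def leviCivita (a : Fin 11 → Fin 11) : ℝ :=
  if h : Function.Bijective a then sgn (Equiv.ofBijective a h) else 0

/-- The skew-symmetrized product
`Γ_{a₁⋯a_p} = (1/p!) ∑_σ sgn(σ) Γ_{a_{σ(1)}} ⋯ Γ_{a_{σ(p)}}`. -/
def skewProd (Γ : Fin 11 → Matrix (Fin 32) (Fin 32) ℝ) {p : ℕ} (a : Fin p → Fin 11) :
    Matrix (Fin 32) (Fin 32) ℝ :=
  (1 / (p.factorial : ℝ)) •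
    ∑ σ : Equiv.Perm (Fin p), sgn σ • (List.ofFn fun i => Γ (a (σ i))).prod

/-! ### The Majorana representation -/

/-- The real representation `𝟑𝟐` of `Pin⁺(1,10)` with its spinor metric: generators `Γ_a` acting on
`ℝ³²` with `Γ_a Γ_b + Γ_b Γ_a = 2 η_{ab}` and `Γ_0 Γ_1 ⋯ Γ_{10} = 1`, and a non-degenerate
skew-symmetric bilinear form `C` for which all the `Γ_a` are skew self-adjoint. -/
structure MajoranaRep where
  /-- The generators `Γ_a`, with lower index. -/
  Γ : Fin 11 → Matrix (Fin 32) (Fin 32) ℝ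
  /-- The spinor metric `(η_{αβ})`. -/
  C : Matrix (Fin 32) (Fin 32) ℝ
  clifford : ∀ a b, Γ a * Γ b + Γ b * Γ a =
    (2 * if a = b then eta a else 0) • (1 : Matrix (Fin 32) (Fin 32) ℝ)
  volume : (List.ofFn Γ).prod = 1
  skew : C.transpose = -C
  nondegenerate : C.det ≠ 0
  skewAdjoint : ∀ a, (Γ a).transpose * C = -(C * Γ a)

/-- `Γ_{a₁⋯a_p}`, with lower indices. -/
def MajoranaRep.gam (M : MajoranaRep) {p : ℕ} (a : Fin p → Fin 11) :
    Matrix (Fin 32) (Fin 32) ℝ := skewProd M.Γ a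

/-! An explicit Majorana representation, by signed permutation matrices. -/

/-- The signed permutation matrix `v ↦ (i ↦ f(i) v(p(i)))`, for `A = (f, p)`. -/
def spm (A : (Fin 32 → ℤ) × (Fin 32 → Fin 32)) : Matrix (Fin 32) (Fin 32) ℝ :=
  Matrix.of fun i j => if j = A.2 i then (A.1 i : ℝ) else 0

/-- The product of signed permutations. -/
def spMul (A B : (Fin 32 → ℤ) × (Fin 32 → Fin 32)) : (Fin 32 → ℤ) × (Fin 32 → Fin 32) :=
  (fun i => A.1 i * B.1 (A.2 i), fun i => B.2 (A.2 i))

theorem spm_mul (A B : (Fin 32 → ℤ) × (Fin 32 → Fin 32)) : spm A * spm B = spm (spMul A B) := by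
  ext i j
  simp only [spm, spMul, Matrix.mul_apply, Matrix.of_apply]
  rw [Finset.sum_eq_single (A.2 i)]
  · simp
  · intro k _ hk
    simp [hk]
  · simp

theorem spm_one : spm (fun _ => 1, id) = 1 := by
  ext i j
  simp [spm, Matrix.one_apply, eq_comm]

theorem spm_neg (A : (Fin 32 → ℤ) × (Fin 32 → Fin 32)) :
    spm (fun i => -A.1 i, A.2) = -spm A := by
  ext i j
  simp only [spm, Matrix.of_apply, Matrix.neg_apply]
  split <;> simp

theorem spm_prod (l : List ((Fin 32 → ℤ) × (Fin 32 → Fin 32))) :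
    (l.map spm).prod = spm (l.foldr spMul (fun _ => 1, id)) := by
  induction l with
  | nil => simp [spm_one]
  | cons A l ih => simp [ih, spm_mul]

/-- The signed permutation `v ↦ (i ↦ (-1)^{|i ∧ z|} v(i ⊕ x))`, in binary. -/
def pauli (x z : Fin 32) : (Fin 32 → ℤ) × (Fin 32 → Fin 32) :=
  (fun i => if ((i &&& z).val % 2 + (i &&& z).val / 2 % 2 + (i &&& z).val / 4 % 2
      + (i &&& z).val / 8 % 2 + (i &&& z).val / 16 % 2) % 2 = 0 then 1 else -1,
    fun i => i ^^^ x)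

/-- Signed permutations representing `Γ_0, …, Γ_{10}`. -/
def majorana : Fin 11 → (Fin 32 → ℤ) × (Fin 32 → Fin 32) :=
  ![pauli 31 21, pauli 0 1, pauli 1 0, pauli 3 3, pauli 5 7, pauli 7 13, pauli 9 15, pauli 11 9,
    pauli 13 11, pauli 15 21, pauli 31 5]

theorem majorana_sq (a : Fin 11) :
    (∀ i, (spMul (majorana a) (majorana a)).1 i = if a = 0 then -1 else 1) ∧
    ∀ i, (spMul (majorana a) (majorana a)).2 i = i := by
  revert a; decide +kernel

theorem majorana_anti (a b : Fin 11) (h : a ≠ b) :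
    (∀ i, (spMul (majorana a) (majorana b)).1 i = -(spMul (majorana b) (majorana a)).1 i) ∧
    ∀ i, (spMul (majorana a) (majorana b)).2 i = (spMul (majorana b) (majorana a)).2 i := by
  revert a b; decide +kernel

theorem majorana_volume :
    (∀ i, ((List.ofFn majorana).foldr spMul (fun _ => 1, id)).1 i = 1) ∧
    ∀ i, ((List.ofFn majorana).foldr spMul (fun _ => 1, id)).2 i = i := by
  decide +kernel

theorem majorana_transpose (a : Fin 11) :
    (spm (majorana a)).transpose = if a = 0 then -spm (majorana a) else spm (majorana a) := by
  have key : ∀ a : Fin 11, ∀ i j : Fin 32,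
      (if i = (majorana a).2 j then (majorana a).1 j else 0) =
      if a = 0 then -(if j = (majorana a).2 i then (majorana a).1 i else 0)
      else (if j = (majorana a).2 i then (majorana a).1 i else 0) := by decide +kernel
  ext i j
  have := congrArg (Int.cast : ℤ → ℝ) (key a i j)
  by_cases ha : a = 0
  · simp only [ha, if_true] at this ⊢
    simp only [Matrix.transpose_apply, spm, Matrix.of_apply, Matrix.neg_apply]
    push_cast at this
    exact this
  · simp only [ha, if_false] at this ⊢
    simp only [Matrix.transpose_apply, spm, Matrix.of_apply]
    push_cast at this
    exact this

theorem spm_sq (a : Fin 11) : spm (majorana a) * spm (majorana a) = eta a • 1 := by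
  have h : spMul (majorana a) (majorana a) = (fun _ => if a = 0 then -1 else 1, id) :=
    Prod.ext (funext (majorana_sq a).1) (funext (majorana_sq a).2)
  rw [spm_mul, h]
  by_cases ha : a = 0
  · have h2 := spm_neg (fun _ => 1, id)
    rw [spm_one] at h2
    simpa [ha, eta] using h2
  · simpa [ha, eta] using spm_one

theorem spm_anti (a b : Fin 11) (h : a ≠ b) :
    spm (majorana a) * spm (majorana b) = -(spm (majorana b) * spm (majorana a)) := by
  rw [spm_mul, spm_mul, ← spm_neg]
  congr 1
  exact Prod.ext (funext (majorana_anti a b h).1) (funext (majorana_anti a b h).2)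

/-- Majorana representations exist: the matrices `majorana`, with spinor metric `Γ_0`. -/
theorem MajoranaRep.nonempty : Nonempty MajoranaRep := by
  refine ⟨{ Γ := fun a => spm (majorana a), C := spm (majorana 0), clifford := ?_, volume := ?_,
            skew := ?_, nondegenerate := ?_, skewAdjoint := ?_ }⟩
  · intro a b
    by_cases h : a = b
    · subst h
      rw [spm_sq]
      simp [two_mul, add_smul]
    · rw [spm_anti a b h]
      simp [h]
  · have h1 : (List.ofFn fun a => spm (majorana a)) = (List.ofFn majorana).map spm := by
      simp
    have h2 : (List.ofFn majorana).foldr spMul (fun _ => 1, id) = (fun _ => 1, id) :=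
      Prod.ext (funext majorana_volume.1) (funext majorana_volume.2)
    rw [h1, spm_prod, h2, spm_one]
  · simpa using majorana_transpose 0
  · intro h0
    have h := congrArg Matrix.det (spm_sq 0)
    rw [Matrix.det_mul, h0] at h
    simp [eta, Matrix.det_neg] at h
    norm_num at h
  · intro a
    rw [majorana_transpose]
    by_cases ha : a = 0
    · simp [ha]
    · rw [if_neg ha, spm_anti a 0 ha]

/-! ### The free graded-commutative super-algebra -/

/-- The generators, all of homological degree `1`; `e₂` and `e₅` carry lower indices and are made
skew-symmetric below. -/
inductive Gen : Type
  /-- `ψ^α`, of bidegree `(1, odd)` -/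
  | psi (α : Fin 32)
  /-- `φ^α`, of bidegree `(1, odd)` -/
  | phi (α : Fin 32)
  /-- the components `ψ_a^α` of the vector-spinor, of bidegree `(1, odd)` -/
  | vec (a : Fin 11) (α : Fin 32)
  /-- `e^a`, of bidegree `(1, even)` -/
  | e₁ (a : Fin 11)
  /-- `e_{a₁ a₂}`, of bidegree `(1, even)` -/
  | e₂ (a : Fin 2 → Fin 11)
  /-- `e_{a₁ ⋯ a₅}`, of bidegree `(1, even)` -/
  | e₅ (a : Fin 5 → Fin 11)

/-- The super-degree of a generator (`true` for odd). -/
def Gen.odd : Gen → Bool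
  | psi _ => true
  | phi _ => true
  | vec _ _ => true
  | e₁ _ => false
  | e₂ _ => false
  | e₅ _ => false

/-- The sign `(-1)^{n₁ n₂ + σ₁ σ₂}` of the sign rule, for two generators (`n₁ = n₂ = 1`). -/
def swapSign (x y : Gen) : ℝ := if x.odd && y.odd then 1 else -1

/-- The defining relations: the sign rule and the skew-symmetry of `e_{a₁a₂}`, `e_{a₁⋯a₅}`. -/
inductive CERel : FreeAlgebra ℝ Gen → FreeAlgebra ℝ Gen → Prop
  | swap (x y : Gen) : CERel (FreeAlgebra.ι ℝ x * FreeAlgebra.ι ℝ y)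
      (swapSign x y • (FreeAlgebra.ι ℝ y * FreeAlgebra.ι ℝ x))
  | skew₂ (a : Fin 2 → Fin 11) (σ : Equiv.Perm (Fin 2)) :
      CERel (FreeAlgebra.ι ℝ (Gen.e₂ (a ∘ σ))) (sgn σ • FreeAlgebra.ι ℝ (Gen.e₂ a))
  | skew₅ (a : Fin 5 → Fin 11) (σ : Equiv.Perm (Fin 5)) :
      CERel (FreeAlgebra.ι ℝ (Gen.e₅ (a ∘ σ))) (sgn σ • FreeAlgebra.ι ℝ (Gen.e₅ a))

/-- The graded-commutative algebra `ℝ[e^a, e_{a₁a₂}, e_{a₁⋯a₅}, ψ^α, φ^α, ψ_a^α]` underlying the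
Chevalley–Eilenberg algebra of the hidden M-algebra extended by the vector-spinor generator. -/
def CE : Type := RingQuot CERel

instance : Ring CE := inferInstanceAs (Ring (RingQuot CERel))

instance : Algebra ℝ CE := inferInstanceAs (Algebra ℝ (RingQuot CERel))

/-- The quotient map from the free algebra. -/
def CE.mk : FreeAlgebra ℝ Gen →ₐ[ℝ] CE := RingQuot.mkAlgHom ℝ CERel

theorem CE.mk_rel {x y : FreeAlgebra ℝ Gen} (h : CERel x y) : CE.mk x = CE.mk y :=
  RingQuot.mkAlgHom_rel ℝ h

theorem CE.mk_surjective : Function.Surjective CE.mk := RingQuot.mkAlgHom_surjective ℝ CERel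

/-- The universal property of the quotient. -/
def CE.lift {B : Type} [Ring B] [Algebra ℝ B] (f : FreeAlgebra ℝ Gen →ₐ[ℝ] B)
    (hf : ∀ ⦃x y⦄, CERel x y → f x = f y) : CE →ₐ[ℝ] B :=
  RingQuot.liftAlgHom ℝ ⟨f, hf⟩

theorem CE.lift_mk {B : Type} [Ring B] [Algebra ℝ B] (f : FreeAlgebra ℝ Gen →ₐ[ℝ] B)
    (hf : ∀ ⦃x y⦄, CERel x y → f x = f y) (x : FreeAlgebra ℝ Gen) :
    CE.lift f hf (CE.mk x) = f x :=
  RingQuot.liftAlgHom_mkAlgHom_apply ℝ f hf x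

/-- The class of a generator. -/
def gen (x : Gen) : CE := CE.mk (FreeAlgebra.ι ℝ x)

/-- `ψ = (ψ^α)` -/
def psi (α : Fin 32) : CE := gen (.psi α)
/-- `φ = (φ^α)` -/
def phi (α : Fin 32) : CE := gen (.phi α)
/-- `ψ_a = (ψ_a^α)` -/
def vec (a : Fin 11) (α : Fin 32) : CE := gen (.vec a α)
/-- `e^a`, with upper index -/
def e₁ (a : Fin 11) : CE := gen (.e₁ a)
/-- `e_{a₁ a₂}`, with lower indices -/
def e₂ (a : Fin 2 → Fin 11) : CE := gen (.e₂ a)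
/-- `e_{a₁ ⋯ a₅}`, with lower indices -/
def e₅ (a : Fin 5 → Fin 11) : CE := gen (.e₅ a)
/-- `e_a`, with lower index -/
def e₁low (a : Fin 11) : CE := eta a • e₁ a
/-- `e^{a₁ a₂}`, with upper indices -/
def e₂up (a : Fin 2 → Fin 11) : CE := etas a • e₂ a
/-- `e^{a₁ ⋯ a₅}`, with upper indices -/
def e₅up (a : Fin 5 → Fin 11) : CE := etas a • e₅ a

/-- The spinor `A u` with components `(A u)^α = A^α_β u^β`. -/
def act (A : Matrix (Fin 32) (Fin 32) ℝ) (u : Fin 32 → CE) (α : Fin 32) : CE :=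
  ∑ β, A α β • u β

/-- The spinor pairing `(ū A v) = u^α η_{αβ} A^β_γ v^γ`. -/
def pair (M : MajoranaRep) (u : Fin 32 → CE) (A : Matrix (Fin 32) (Fin 32) ℝ)
    (v : Fin 32 → CE) : CE :=
  ∑ α, ∑ γ, (M.C * A) α γ • (u α * v γ)

/-! ### The differential -/

/-- The parameters `δ(s) = 2(1+s)`, `γ₁(s) = 1`, `γ₂(s) = 2(1/5! + s/6!)`. -/
def delta (s : ℝ) : ℝ := 2 * (1 + s)
/-- `γ₁(s) = 1` -/
def gamma₁ (_s : ℝ) : ℝ := 1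
/-- `γ₂(s) = 2(1/5! + s/6!)` -/
def gamma₂ (s : ℝ) : ℝ := 2 * (1 / (Nat.factorial 5 : ℝ) + s / (Nat.factorial 6 : ℝ))

/-- The differential on generators:
`dψ = 0`, `d e^a = (ψ̄ Γ^a ψ)`, `d e_{a₁a₂} = -(ψ̄ Γ_{a₁a₂} ψ)`, `d e_{a₁⋯a₅} = (ψ̄ Γ_{a₁⋯a₅} ψ)`,
`dφ = δ Γ_a ψ e^a + γ₁ Γ^{a₁a₂} ψ e_{a₁a₂} + γ₂ Γ^{a₁⋯a₅} ψ e_{a₁⋯a₅}`,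
`dψ_a = Γ_{ac} ψ e^c - Γ_c ψ e_a{}^c`. -/
def dGen (M : MajoranaRep) (s : ℝ) : Gen → CE
  | .psi _ => 0
  | .e₁ a => pair M psi (eta a • M.Γ a) psi
  | .e₂ a => -pair M psi (M.gam a) psi
  | .e₅ a => pair M psi (M.gam a) psi
  | .phi α =>
      delta s • ∑ a, act (M.Γ a) psi α * e₁ a
      + gamma₁ s • ∑ a : Fin 2 → Fin 11, act (etas a • M.gam a) psi α * e₂ a
      + gamma₂ s • ∑ a : Fin 5 → Fin 11, act (etas a • M.gam a) psi α * e₅ a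
  | .vec a α =>
      (∑ c, act (M.gam ![a, c]) psi α * e₁ c)
      - ∑ c, act (M.Γ c) psi α * (eta c • e₂ ![a, c])

/-- The span of the products `x y` of two generators with given total super-degree. -/
def quad (o : Bool) : Submodule ℝ CE :=
  Submodule.span ℝ {q | ∃ x y : Gen, (x.odd ^^ y.odd) = o ∧ q = gen x * gen y}

theorem gen_swap (x y : Gen) : gen x * gen y = swapSign x y • (gen y * gen x) := by
  have h := CE.mk_rel (CERel.swap x y)
  simpa [gen] using h

theorem gen_skew₂ (a : Fin 2 → Fin 11) (σ : Equiv.Perm (Fin 2)) :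
    gen (.e₂ (a ∘ σ)) = sgn σ • gen (.e₂ a) := by
  have h := CE.mk_rel (CERel.skew₂ a σ)
  simpa [gen] using h

theorem gen_skew₅ (a : Fin 5 → Fin 11) (σ : Equiv.Perm (Fin 5)) :
    gen (.e₅ (a ∘ σ)) = sgn σ • gen (.e₅ a) := by
  have h := CE.mk_rel (CERel.skew₅ a σ)
  simpa [gen] using h

theorem quad_swap {o : Bool} {q : CE} (hq : q ∈ quad o) (y : Gen) :
    q * gen y = (if o && y.odd then (-1 : ℝ) else 1) • (gen y * q) := by
  induction hq using Submodule.span_induction with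
  | mem q h =>
    obtain ⟨x, z, ho, rfl⟩ := h
    rw [mul_assoc, gen_swap z y, mul_smul_comm, ← mul_assoc, gen_swap x y, smul_mul_assoc,
      smul_smul, mul_assoc]
    congr 1
    subst ho
    cases hx : x.odd <;> cases hz : z.odd <;> cases hy : y.odd <;> simp [swapSign, hx, hz, hy]
  | zero => simp
  | add a b _ _ ha hb => rw [add_mul, ha, hb, mul_add, smul_add]
  | smul r a _ ha => rw [smul_mul_assoc, ha, mul_smul_comm, smul_comm]

theorem gen_mul_mem (x y : Gen) : gen x * gen y ∈ quad (x.odd ^^ y.odd) :=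
  Submodule.subset_span ⟨x, y, rfl, rfl⟩

theorem pair_mem (M : MajoranaRep) (A : Matrix (Fin 32) (Fin 32) ℝ) :
    pair M psi A psi ∈ quad false :=
  Submodule.sum_mem _ fun α _ => Submodule.sum_mem _ fun β _ =>
    Submodule.smul_mem _ _ (gen_mul_mem (.psi α) (.psi β))

theorem act_mul_mem (A : Matrix (Fin 32) (Fin 32) ℝ) (α : Fin 32) (x : Gen) (hx : x.odd = false) :
    act A psi α * gen x ∈ quad true := by
  rw [act, Finset.sum_mul]
  refine Submodule.sum_mem _ fun β _ => ?_
  rw [smul_mul_assoc]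
  refine Submodule.smul_mem _ _ ?_
  have h := gen_mul_mem (.psi β) x
  rw [hx] at h
  exact h

theorem dGen_mem (M : MajoranaRep) (s : ℝ) (x : Gen) : dGen M s x ∈ quad x.odd := by
  cases x with
  | psi α => exact Submodule.zero_mem _
  | e₁ a => exact pair_mem M _
  | e₂ a => exact Submodule.neg_mem _ (pair_mem M _)
  | e₅ a => exact pair_mem M _
  | phi α =>
    refine Submodule.add_mem _ (Submodule.add_mem _ ?_ ?_) ?_ <;>
    exact Submodule.smul_mem _ _ (Submodule.sum_mem _ fun a _ => act_mul_mem _ _ _ rfl)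
  | vec a α =>
    refine Submodule.sub_mem _ (Submodule.sum_mem _ fun c _ => act_mul_mem _ _ _ rfl)
      (Submodule.sum_mem _ fun c _ => ?_)
    rw [mul_smul_comm]
    exact Submodule.smul_mem _ _ (act_mul_mem _ _ _ rfl)

theorem sgn_mul_self {p : ℕ} (σ : Equiv.Perm (Fin p)) : sgn σ * sgn σ = 1 := by
  rcases Int.units_eq_one_or (Equiv.Perm.sign σ) with h | h <;> simp [sgn, h]

theorem skewProd_perm (Γ : Fin 11 → Matrix (Fin 32) (Fin 32) ℝ) {p : ℕ} (a : Fin p → Fin 11)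
    (σ : Equiv.Perm (Fin p)) : skewProd Γ (a ∘ σ) = sgn σ • skewProd Γ a := by
  rw [skewProd, skewProd, smul_comm]
  congr 1
  rw [Finset.smul_sum, ← Equiv.sum_comp (Equiv.mulLeft σ) (fun τ => sgn σ • sgn τ • (List.ofFn fun i => Γ (a (τ i))).prod)]
  refine Finset.sum_congr rfl fun τ _ => ?_
  have h : sgn (σ * τ) = sgn σ * sgn τ := by simp [sgn]
  have h2 : (List.ofFn fun i => Γ ((a ∘ σ) (τ i))) = List.ofFn fun i => Γ (a ((σ * τ) i)) := rfl
  rw [h2, Equiv.coe_mulLeft, h, smul_smul, ← mul_assoc, sgn_mul_self, one_mul]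

theorem pair_smul (M : MajoranaRep) (r : ℝ) (u v : Fin 32 → CE)
    (A : Matrix (Fin 32) (Fin 32) ℝ) : pair M u (r • A) v = r • pair M u A v := by
  simp only [pair, Matrix.mul_smul, Matrix.smul_apply, smul_eq_mul, Finset.smul_sum, smul_smul]

/-- The grading involution `x ↦ (-1)^n x` for `x` of homological degree `n`. -/
def gradeInv : CE →ₐ[ℝ] CE :=
  CE.lift (FreeAlgebra.lift ℝ fun x => -gen x) (by
    intro x y h
    cases h with
    | swap x y => simpa using gen_swap x y
    | skew₂ a σ => simpa using gen_skew₂ a σ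
    | skew₅ a σ => simpa using gen_skew₅ a σ)

/-- The algebra map `x ↦ ((gradeInv x, d x), (0, x))` into `2 × 2` matrices; that it is
multiplicative is the graded Leibniz rule for `d`. -/
def dMatrix (M : MajoranaRep) (s : ℝ) : CE →ₐ[ℝ] Matrix (Fin 2) (Fin 2) CE :=
  CE.lift (FreeAlgebra.lift ℝ fun x => !![-gen x, dGen M s x; 0, gen x]) (by
    intro x y h
    cases h with
    | swap x y =>
      have h1 := quad_swap (dGen_mem M s x) y
      have h2 := quad_swap (dGen_mem M s y) x
      have h3 := gen_swap x y
      simp only [map_mul, map_smul, FreeAlgebra.lift_ι_apply, Matrix.mul_fin_two, Matrix.smul_of,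
        Matrix.smul_cons, Matrix.smul_empty]
      have key : -gen x * dGen M s y + dGen M s x * gen y
          = swapSign x y • (-gen y * dGen M s x + dGen M s y * gen x) := by
        rw [h1, h2]
        cases hx : x.odd <;> cases hy : y.odd <;> simp [swapSign, hx, hy] <;> abel
      rw [key]
      simp [h3]
    | skew₂ a σ =>
      have h : dGen M s (.e₂ (a ∘ σ)) = sgn σ • dGen M s (.e₂ a) := by
        simp only [dGen, MajoranaRep.gam, skewProd_perm, pair_smul, smul_neg]
      simp [h, gen_skew₂]
    | skew₅ a σ =>
      have h : dGen M s (.e₅ (a ∘ σ)) = sgn σ • dGen M s (.e₅ a) := by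
        simp only [dGen, MajoranaRep.gam, skewProd_perm, pair_smul]
      simp [h, gen_skew₅])

/-- The differential: the graded derivation of degree `(1, even)` given by `dGen` on generators
(see `d_gen` and `d_mul`). -/
def d (M : MajoranaRep) (s : ℝ) : CE →ₗ[ℝ] CE where
  toFun x := dMatrix M s x 0 1
  map_add' x y := by simp
  map_smul' r x := by simp

theorem gradeInv_gen (x : Gen) : gradeInv (gen x) = -gen x := by
  simp [gradeInv, gen, CE.lift_mk]

theorem dMatrix_gen (M : MajoranaRep) (s : ℝ) (x : Gen) :
    dMatrix M s (gen x) = !![-gen x, dGen M s x; 0, gen x] := by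
  simp [dMatrix, gen, CE.lift_mk]

theorem d_gen (M : MajoranaRep) (s : ℝ) (x : Gen) : d M s (gen x) = dGen M s x := by
  change dMatrix M s (gen x) 0 1 = _
  rw [dMatrix_gen]; rfl

theorem dMatrix_eq (M : MajoranaRep) (s : ℝ) (x : CE) :
    dMatrix M s x = !![gradeInv x, d M s x; 0, x] := by
  suffices h : dMatrix M s x 0 0 = gradeInv x ∧ dMatrix M s x 1 0 = 0 ∧ dMatrix M s x 1 1 = x by
    ext i j
    fin_cases i <;> fin_cases j
    · exact h.1
    · rfl
    · exact h.2.1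
    · exact h.2.2
  obtain ⟨y, rfl⟩ := CE.mk_surjective x
  induction y using FreeAlgebra.induction with
  | grade0 r => simp [AlgHom.commutes, Matrix.algebraMap_matrix_apply]
  | grade1 x =>
    change dMatrix M s (gen x) 0 0 = gradeInv (gen x) ∧ dMatrix M s (gen x) 1 0 = 0 ∧
      dMatrix M s (gen x) 1 1 = gen x
    rw [dMatrix_gen, gradeInv_gen]
    exact ⟨rfl, rfl, rfl⟩
  | mul a b ha hb =>
    simp only [map_mul, Matrix.mul_apply, Fin.sum_univ_two]
    rw [ha.1, ha.2.1, ha.2.2, hb.1, hb.2.1, hb.2.2]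
    simp
  | add a b ha hb =>
    simp only [map_add, Matrix.add_apply]
    rw [ha.1, ha.2.1, ha.2.2, hb.1, hb.2.1, hb.2.2]
    simp

/-- The graded Leibniz rule `d(x y) = (d x) y + (-1)^{deg x} x (d y)`. -/
theorem d_mul (M : MajoranaRep) (s : ℝ) (x y : CE) :
    d M s (x * y) = d M s x * y + gradeInv x * d M s y := by
  have h : dMatrix M s (x * y) 0 1 = (dMatrix M s x * dMatrix M s y) 0 1 := by rw [map_mul]
  rw [dMatrix_eq M s x, dMatrix_eq M s y, Matrix.mul_apply, Fin.sum_univ_two] at h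
  change dMatrix M s (x * y) 0 1 = _
  rw [h]
  simp [add_comm]

/-! ### The 4-flux, the 3-form ansatz and the two solutions -/

/-- `G₄ = ½ (ψ̄ Γ_{a₁a₂} ψ) e^{a₁} e^{a₂}`, pulled back along `e^a ↦ e^a`, `ψ^α ↦ ψ^α`. -/
def G₄ (M : MajoranaRep) : CE :=
  (1 / 2 : ℝ) • ∑ a₁, ∑ a₂, pair M psi (M.gam ![a₁, a₂]) psi * e₁ a₁ * e₁ a₂

/-- The ansatz for the 3-form, with coefficients
`k = (α₀, α₁, α₂, α₃, α₄, β₁, β₂, β₃, βv)`. -/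
def P₃ (M : MajoranaRep) (k : Fin 9 → ℝ) : CE :=
  -- α₀ e_{a₁a₂} e^{a₁} e^{a₂}
  k 0 • (∑ a₁, ∑ a₂, e₂ ![a₁, a₂] * e₁ a₁ * e₁ a₂)
  -- α₁ e^{a₁}_{a₂} e^{a₂}_{a₃} e^{a₃}_{a₁}
  + k 1 • (∑ a₁, ∑ a₂, ∑ a₃,
      (eta a₁ • e₂ ![a₁, a₂]) * (eta a₂ • e₂ ![a₂, a₃]) * (eta a₃ • e₂ ![a₃, a₁]))
  -- α₂ e^{a₁⋯a₄ b₁} e_{b₁}^{b₂} e_{b₂ a₁⋯a₄}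
  + k 2 • (∑ a : Fin 4 → Fin 11, ∑ b₁, ∑ b₂,
      e₅up (Fin.snoc a b₁) * (eta b₂ • e₂ ![b₁, b₂]) * e₅ (Fin.cons b₂ a))
  -- α₃ ε_{a₁⋯a₅ b₁⋯b₅ c} e^{a₁⋯a₅} e^{b₁⋯b₅} e^c
  + k 3 • (∑ a : Fin 5 → Fin 11, ∑ b : Fin 5 → Fin 11, ∑ c : Fin 11,
      leviCivita (Fin.append (Fin.append a b) ![c]) • (e₅up a * e₅up b * e₁ c))
  -- α₄ ε_{a₁a₂a₃ b₁b₂b₃ c₁⋯c₅} e^{a₁a₂a₃ d₁d₂} e_{d₁d₂}^{b₁b₂b₃} e^{c₁⋯c₅}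
  + k 4 • (∑ a : Fin 3 → Fin 11, ∑ b : Fin 3 → Fin 11, ∑ c : Fin 5 → Fin 11,
      ∑ d : Fin 2 → Fin 11,
        leviCivita (Fin.append (Fin.append a b) c) •
          (e₅up (Fin.append a d) * (etas b • e₅ (Fin.append d b)) * e₅up c))
  -- β₁ (ψ̄ Γ_a φ) e^a
  + k 5 • (∑ a, pair M psi (M.Γ a) phi * e₁ a)
  -- β₂ (ψ̄ Γ_{a₁a₂} φ) e^{a₁a₂}
  + k 6 • (∑ a : Fin 2 → Fin 11, pair M psi (M.gam a) phi * e₂up a)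
  -- β₃ (ψ̄ Γ_{a₁⋯a₅} φ) e^{a₁⋯a₅}
  + k 7 • (∑ a : Fin 5 → Fin 11, pair M psi (M.gam a) phi * e₅up a)
  -- βv ((ψ̄ Γ^{ab} ψ_a) e_b - (ψ̄ Γ_b ψ_a) e^{ab})
  + k 8 • (∑ a, ∑ b,
      (pair M psi (etas ![a, b] • M.gam ![a, b]) (vec a) * e₁low b
        - pair M psi (M.Γ b) (vec a) * e₂up ![a, b]))

/-- The solution without vector-spinor contribution, as a function of the parameter `s ≠ 0`. -/
def oldSolution (s : ℝ) : Fin 9 → ℝ :=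
  ![1 / 2 * (-1 / 5) * ((6 + 2 * s + s ^ 2) / s ^ 2),
    1 / 2 * (1 / 15) * ((6 + 2 * s) / s ^ 2),
    1 / 2 * (1 / (Nat.factorial 6 : ℝ)) * ((6 + s) ^ 2 / s ^ 2),
    1 / 2 * (1 / (5 * (Nat.factorial 5 : ℝ) * (Nat.factorial 6 : ℝ))) * ((6 + s) ^ 2 / s ^ 2),
    1 / 2 * (-1 / (9 * (Nat.factorial 5 : ℝ) * (Nat.factorial 6 : ℝ))) * ((6 + s) ^ 2 / s ^ 2),
    -1 * (1 / (10 * gamma₁ s)) * ((3 - 2 * s) / s ^ 2),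
    -1 * (1 / (20 * gamma₁ s)) * ((3 + s) / s ^ 2),
    -1 * (3 / (10 * (Nat.factorial 6 : ℝ) * gamma₁ s)) * ((6 + s) / s ^ 2),
    0]

/-- The solution `α₀ = -1/20`, `α₁ = -1/60`, `βv = -1/20`, all others zero. -/
def newSolution : Fin 9 → ℝ := ![-1 / 20, -1 / 60, 0, 0, 0, 0, 0, 0, -1 / 20]

end MAlg

end

/-! The proof expresses d P₃ − G₄ in a few invariants, shows the needed ones to be independent, and
is left with a linear system for the nine coefficients.

Everything rests on one completeness relation: the 1024 = 32² gamma matrices with at most five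
indices are orthogonal for the trace form, hence a basis of the 32 × 32 matrices. Since the ψ^α
commute with each other, (ψ̄ A ψ) only sees the matrices of grades 1, 2, 5, and `completeness`
becomes the Fierz expansions `quadForm_fierz` and `quadForm_mul_pairing`.

Each term of P₃ without spinors is a constant times tr(Γ_a Γ_b Γ_c) e^a e^b e^c for multi-indices of
lengths 1, 2, 5 (`P₃_eq`), because such a trace is built from metrics and, for odd total length, ε.
The signs in the differentials of the even generators equal the Fierz signs `kappa`, so `d_cubic`
yields just the expressions `trilin`, that is tr(Γ_a Γ_b Γ_c) (ψ̄ Γ^c ψ) e^a e^b. The φ-terms give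
expressions `bilin`, which the Fierz expansion turns into the same `trilin`, and terms (ψ̄ Γ^a ψ)(ψ̄
Γ_a φ) for the three grades, which are all multiples of the one of grade 1 (`fierzTerm_two`,
`fierzTerm_five`). In the differential of the vector-spinor term ψ_a drops out by the membrane Fierz
identity `membrane_fierz`, leaving a combination of `bilin` (`d_vecTerm`).

Hence d P₃ − G₄ is a combination of nine invariants with coefficients `residual`, affine in the
unknowns (`d_P₃_sub_G₄`). That the stated coefficients solve the equation is the vanishing of
`residual`. Conversely, algebra homomorphisms `evalHom` to the operators on the exterior algebra of
ℝ² detect eight of the nine invariants separately (`residual_eq_zero`). Those eight equations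
determine all coefficients from the one of the vector-spinor term, since the decisive 2 × 2
determinant is a nonzero multiple of s² (`eq_of_residual_eq_zero`). -/

noncomputable section

namespace MAlg

/-! ### Words in the gamma matrices -/

/-- The product `Γ_{a₁} ⋯ Γ_{a_p}`. -/
def MajoranaRep.word (M : MajoranaRep) {p : ℕ} (a : Fin p → Fin 11) :
    Matrix (Fin 32) (Fin 32) ℝ := (List.ofFn fun i => M.Γ (a i)).prod

/-- The multiplicity of `b` in the tuple `a`. -/
def mult {p : ℕ} (a : Fin p → Fin 11) (b : Fin 11) : ℕ := ∑ i, if a i = b then 1 else 0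

theorem eta_mul_self (a : Fin 11) : eta a * eta a = 1 := by
  unfold eta; split <;> norm_num

theorem etas_mul_self {p : ℕ} (a : Fin p → Fin 11) : etas a * etas a = 1 := by
  simp [etas, ← Finset.prod_mul_distrib, eta_mul_self]

theorem etas_comp_perm {p : ℕ} (a : Fin p → Fin 11) (σ : Equiv.Perm (Fin p)) :
    etas (a ∘ σ) = etas a := Equiv.prod_comp σ fun i => eta (a i)

theorem etas_succ {p : ℕ} (a : Fin (p + 1) → Fin 11) :
    etas a = eta (a 0) * etas (fun i => a i.succ) := Fin.prod_univ_succ _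

theorem mult_succ {p : ℕ} (a : Fin (p + 1) → Fin 11) (b : Fin 11) :
    mult a b = (if a 0 = b then 1 else 0) + mult (fun i => a i.succ) b := Fin.sum_univ_succ _

theorem sum_mult {p : ℕ} (a : Fin p → Fin 11) : ∑ b, mult a b = p := by
  simp only [mult]
  rw [Finset.sum_comm]
  simp

theorem sum_mult_mul_mult {p q : ℕ} (a : Fin p → Fin 11) (c : Fin q → Fin 11) :
    ∑ b, mult a b * mult c b = ∑ i, ∑ j, if a i = c j then 1 else 0 := by
  simp only [mult, Finset.sum_mul_sum]
  rw [Finset.sum_comm]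
  refine Finset.sum_congr rfl fun i _ => ?_
  rw [Finset.sum_comm]
  refine Finset.sum_congr rfl fun j _ => ?_
  simp [eq_comm]

theorem mult_eq_zero {p : ℕ} {a : Fin p → Fin 11} {b : Fin 11} :
    mult a b = 0 ↔ ∀ i, a i ≠ b := by
  simp [mult]

theorem mult_le_one {p : ℕ} {a : Fin p → Fin 11} (ha : Function.Injective a) (b : Fin 11) :
    mult a b ≤ 1 := by
  by_cases h : ∃ i, a i = b
  · obtain ⟨i, rfl⟩ := h
    simp [mult, ha.eq_iff]
  · have : mult a b = 0 := mult_eq_zero.2 fun i hi => h ⟨i, hi⟩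
    omega

namespace MajoranaRep

variable (M : MajoranaRep)

theorem Γ_sq (a : Fin 11) : M.Γ a * M.Γ a = eta a • 1 := by
  have h := M.clifford a a
  rw [if_pos rfl, ← two_smul ℝ, mul_smul] at h
  exact smul_right_injective _ (two_ne_zero (α := ℝ)) h

theorem Γ_anticomm {a b : Fin 11} (h : a ≠ b) : M.Γ a * M.Γ b = -(M.Γ b * M.Γ a) := by
  have := M.clifford a b
  rw [if_neg h, mul_zero, zero_smul] at this
  exact eq_neg_of_add_eq_zero_left this

theorem word_zero (a : Fin 0 → Fin 11) : M.word a = 1 := by simp [word]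

theorem word_succ {p : ℕ} (a : Fin (p + 1) → Fin 11) :
    M.word a = M.Γ (a 0) * M.word (fun i => a i.succ) := by
  simp [word, List.ofFn_succ]

theorem word_append {p q : ℕ} (a : Fin p → Fin 11) (b : Fin q → Fin 11) :
    M.word (Fin.append a b) = M.word a * M.word b := by
  have h : (fun i => M.Γ (Fin.append a b i)) =
      Fin.append (fun i => M.Γ (a i)) (fun i => M.Γ (b i)) := by
    funext i
    refine Fin.addCases (fun j => ?_) (fun j => ?_) i <;> simp
  rw [word, h, List.ofFn_fin_append, List.prod_append, word, word]

theorem word_one (a : Fin 1 → Fin 11) : M.word a = M.Γ (a 0) := by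
  simp [word_succ, word_zero]

theorem word_two (a : Fin 2 → Fin 11) : M.word a = M.Γ (a 0) * M.Γ (a 1) := by
  simp [word_succ, word_zero]

theorem word_cons {p : ℕ} (x : Fin 11) (a : Fin p → Fin 11) :
    M.word (Fin.cons x a : Fin (p + 1) → Fin 11) = M.Γ x * M.word a := by
  simp [word_succ]

theorem word_snoc {p : ℕ} (a : Fin p → Fin 11) (x : Fin 11) :
    M.word (Fin.snoc a x : Fin (p + 1) → Fin 11) = M.word a * M.Γ x := by
  rw [← Fin.append_right_eq_snoc a (fun _ => x), word_append, word_one]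

/-- Γ_b anticommutes with every letter except itself; modulo 2 the exponent counts the letters
different from b. -/
theorem Γ_mul_word {p : ℕ} (b : Fin 11) (a : Fin p → Fin 11) :
    M.Γ b * M.word a = (-1 : ℝ) ^ (p + mult a b) • (M.word a * M.Γ b) := by
  induction p with
  | zero => simp [word_zero, mult]
  | succ p ih =>
    have h : M.Γ b * M.Γ (a 0) =
        (-1 : ℝ) ^ (1 + if a 0 = b then 1 else 0) • (M.Γ (a 0) * M.Γ b) := by
      by_cases h : a 0 = b
      · simp [h]
      · simp [h, M.Γ_anticomm (Ne.symm h)]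
    rw [word_succ, mult_succ, ← mul_assoc, h, smul_mul_assoc, mul_assoc, ih, mul_smul_comm,
      smul_smul, ← pow_add, ← mul_assoc]
    congr 2
    ring

theorem word_mul_word {p q : ℕ} (a : Fin p → Fin 11) (c : Fin q → Fin 11) :
    M.word a * M.word c =
      (-1 : ℝ) ^ (p * q + ∑ i, mult c (a i)) • (M.word c * M.word a) := by
  induction p with
  | zero => simp [word_zero]
  | succ p ih =>
    rw [word_succ, Fin.sum_univ_succ, mul_assoc, ih, mul_smul_comm, ← mul_assoc, Γ_mul_word,
      smul_mul_assoc, smul_smul, ← pow_add, mul_assoc]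
    congr 2
    ring

theorem word_mul_self {p : ℕ} {a : Fin p → Fin 11} (ha : Function.Injective a) :
    M.word a * M.word a = ((-1 : ℝ) ^ (p * (p - 1) / 2) * etas a) • 1 := by
  induction p with
  | zero => simp [word_zero, etas]
  | succ p ih =>
    have h0 : mult (fun i => a i.succ) (a 0) = 0 :=
      mult_eq_zero.2 fun i hi => Fin.succ_ne_zero i (ha hi)
    have h1 := M.Γ_mul_word (a 0) (fun i => a i.succ)
    rw [h0] at h1
    have h2 := ih (a := fun i => a i.succ) (ha.comp (Fin.succ_injective _))
    rw [word_succ]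
    nth_rw 1 [h1]
    rw [smul_mul_assoc, mul_assoc, ← mul_assoc (M.Γ _) (M.Γ _), Γ_sq, smul_mul_assoc, one_mul,
      mul_smul_comm, h2, smul_smul, smul_smul, etas_succ]
    congr 1
    have h3 : (p + 1) * (p + 1 - 1) / 2 = p + p * (p - 1) / 2 := by
      have := Nat.triangle_succ p
      omega
    rw [h3, pow_add]
    ring

/-- The adjoint negates each letter and reverses the word, giving p + p(p−1)/2 signs. So grades 1,
2, 5 are skew self-adjoint and grades 0, 3, 4 self-adjoint. -/
theorem word_transpose_mul {p : ℕ} {a : Fin p → Fin 11} (ha : Function.Injective a) :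
    (M.word a).transpose * M.C = (-1 : ℝ) ^ (p * (p + 1) / 2) • (M.C * M.word a) := by
  induction p with
  | zero => simp [word_zero]
  | succ p ih =>
    have h0 : mult (fun i => a i.succ) (a 0) = 0 :=
      mult_eq_zero.2 fun i hi => Fin.succ_ne_zero i (ha hi)
    have h1 := M.Γ_mul_word (a 0) (fun i => a i.succ)
    rw [h0] at h1
    have h2 := ih (a := fun i => a i.succ) (ha.comp (Fin.succ_injective _))
    rw [word_succ]
    nth_rw 2 [h1]
    rw [Matrix.transpose_mul, mul_assoc, M.skewAdjoint, mul_neg, ← mul_assoc, h2,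
      smul_mul_assoc, mul_smul_comm, smul_smul, mul_assoc, ← neg_smul]
    congr 1
    have h3 : (p + 1) * (p + 1 + 1) / 2 = (p + 1) + p * (p + 1) / 2 := by
      have := Nat.triangle_succ (p + 1)
      simp only [Nat.add_sub_cancel] at this
      rw [mul_comm (p + 1), this, mul_comm p]
      ring
    have h4 : (-1 : ℝ) ^ p * (-1) ^ p = 1 := by rw [← mul_pow]; norm_num
    rw [h3, pow_add, pow_add, add_zero]
    linear_combination (-1 : ℝ) ^ (p * (p + 1) / 2) * h4

theorem word_comp_perm {p : ℕ} {a : Fin p → Fin 11} (ha : Function.Injective a)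
    (σ : Equiv.Perm (Fin p)) : M.word (a ∘ σ) = sgn σ • M.word a := by
  -- Adjacent transpositions generate the symmetric group. By induction on the length, the
  -- transposition either exchanges the first two letters or acts on the tail.
  have swap : ∀ (p : ℕ) (i : Fin p) (a : Fin (p + 1) → Fin 11), Function.Injective a →
      M.word (a ∘ Equiv.swap i.castSucc i.succ) = -M.word a := by
    intro p
    induction p with
    | zero => exact fun i => i.elim0
    | succ p ih =>
      intro i a ha
      refine Fin.cases ?_ (fun j => ?_) i
      · rw [word_succ, word_succ, M.word_succ a, M.word_succ fun i => a i.succ, ← mul_assoc,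
          ← mul_assoc]
        have h1 : (a ∘ Equiv.swap (Fin.castSucc 0) (Fin.succ 0)) 0 = a 1 := by simp
        have h2 : (a ∘ Equiv.swap (Fin.castSucc 0) (Fin.succ 0)) (Fin.succ 0) = a 0 := by simp
        have h3 : (fun i : Fin p => (a ∘ Equiv.swap (Fin.castSucc 0) (Fin.succ 0)) i.succ.succ)
            = fun i => a i.succ.succ := by
          funext i
          simp only [Function.comp_apply]
          rw [Equiv.swap_apply_of_ne_of_ne]
          · exact Fin.succ_ne_zero _
          · exact fun h => Fin.succ_ne_zero _ (Fin.succ_injective _ h)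
        rw [h1, h2, h3, M.Γ_anticomm (ha.ne (by simp : (1 : Fin (p + 2)) ≠ 0)), neg_mul]
        rfl
      · rw [word_succ, M.word_succ a]
        have h1 : (a ∘ Equiv.swap (Fin.castSucc j.succ) (Fin.succ j.succ)) 0 = a 0 := by
          simp only [Function.comp_apply]
          rw [Equiv.swap_apply_of_ne_of_ne]
          · exact (Fin.succ_ne_zero j.castSucc).symm
          · exact (Fin.succ_ne_zero _).symm
        have h2 : (fun i : Fin (p + 1) =>
            (a ∘ Equiv.swap (Fin.castSucc j.succ) (Fin.succ j.succ)) i.succ) =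
            (fun i => a i.succ) ∘ Equiv.swap j.castSucc j.succ := by
          funext i
          simp only [Function.comp_apply]
          congr 1
          exact (Function.Injective.map_swap (Fin.succ_injective (p + 1)) j.castSucc j.succ i).symm
        rw [h1, h2, ih j (fun i => a i.succ) (ha.comp (Fin.succ_injective _)), mul_neg]
  cases p with
  | zero =>
    have : σ = 1 := Subsingleton.elim _ _
    subst this
    simp [sgn]
  | succ p =>
    have hσ : σ ∈ Submonoid.closure
        (Set.range fun i : Fin p => Equiv.swap i.castSucc i.succ) := by
      rw [Equiv.Perm.mclosure_swap_castSucc_succ]; trivial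
    induction hσ using Submonoid.closure_induction generalizing a with
    | mem σ h =>
      obtain ⟨i, rfl⟩ := h
      rw [swap p i a ha]
      have : i.castSucc ≠ i.succ := (Fin.castSucc_lt_succ).ne
      simp [sgn, Equiv.Perm.sign_swap this]
    | one => simp [sgn]
    | mul σ τ _ _ h1 h2 =>
      have : a ∘ (σ * τ : Equiv.Perm _) = (a ∘ σ) ∘ τ := rfl
      rw [this, h2 (ha.comp σ.injective), h1 ha, smul_smul]
      simp [sgn, mul_comm]

theorem gam_of_injective {p : ℕ} {a : Fin p → Fin 11} (ha : Function.Injective a) :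
    M.gam a = M.word a := by
  have h : ∀ σ : Equiv.Perm (Fin p),
      sgn σ • (List.ofFn fun i => M.Γ (a (σ i))).prod = M.word a := fun σ => by
    have h2 : (List.ofFn fun i => M.Γ (a (σ i))).prod = M.word (a ∘ σ) := rfl
    rw [h2, M.word_comp_perm ha, smul_smul, sgn_mul_self, one_smul]
  rw [gam, skewProd, Finset.sum_congr rfl fun σ _ => h σ]
  rw [Finset.sum_const, Finset.card_univ, Fintype.card_perm, Fintype.card_fin,
    ← Nat.cast_smul_eq_nsmul ℝ, smul_smul, one_div,
    inv_mul_cancel₀ (Nat.cast_ne_zero.2 (Nat.factorial_ne_zero p)), one_smul]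

theorem gam_comp_perm {p : ℕ} (a : Fin p → Fin 11) (σ : Equiv.Perm (Fin p)) :
    M.gam (a ∘ σ) = sgn σ • M.gam a := skewProd_perm M.Γ a σ

end MajoranaRep

theorem sgn_swap {p : ℕ} {i j : Fin p} (h : i ≠ j) : sgn (Equiv.swap i j) = -1 := by
  simp [sgn, Equiv.Perm.sign_swap h]

/-- Alternating functions of tuples vanish on tuples with repeated entries. -/
theorem eq_zero_of_alternating {V : Type*} [AddCommGroup V] [Module ℝ V] {p : ℕ}
    {f : (Fin p → Fin 11) → V} (hf : ∀ a (σ : Equiv.Perm (Fin p)), f (a ∘ σ) = sgn σ • f a)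
    {a : Fin p → Fin 11} (ha : ¬ Function.Injective a) : f a = 0 := by
  simp only [Function.Injective, not_forall] at ha
  obtain ⟨i, j, h, hij⟩ := ha
  have h1 : a ∘ Equiv.swap i j = a := by
    funext k
    simp only [Function.comp_apply, Equiv.swap_apply_def]
    split_ifs with h2 h3
    · rw [h2, h]
    · rw [h3, h]
    · rfl
  have h2 := hf a (Equiv.swap i j)
  rw [h1, sgn_swap hij, neg_one_smul] at h2
  have h3 : (2 : ℝ) • f a = 0 := by
    rw [two_smul]; nth_rw 1 [h2]; simp
  exact (smul_eq_zero.1 h3).resolve_left two_ne_zero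

namespace MajoranaRep

variable (M : MajoranaRep)

theorem gam_of_not_injective {p : ℕ} {a : Fin p → Fin 11} (ha : ¬ Function.Injective a) :
    M.gam a = 0 := eq_zero_of_alternating M.gam_comp_perm ha

theorem injective_of_gam_ne_zero {p : ℕ} {a : Fin p → Fin 11} (ha : M.gam a ≠ 0) :
    Function.Injective a := by
  by_contra h
  exact ha (M.gam_of_not_injective h)

theorem gam_one (a : Fin 1 → Fin 11) : M.gam a = M.Γ (a 0) := by
  rw [M.gam_of_injective (Function.injective_of_subsingleton a), word_one]

theorem gam_pair (a b : Fin 11) :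
    M.gam ![a, b] = M.Γ a * M.Γ b - (if a = b then eta a else 0) • 1 := by
  by_cases h : a = b
  · rw [gam_of_not_injective, if_pos h, h, Γ_sq, sub_self]
    intro hi
    have := @hi 0 1 (by simp [h])
    simp at this
  · rw [gam_of_injective, if_neg h, zero_smul, sub_zero, word_two]
    · simp
    · intro i j
      fin_cases i <;> fin_cases j <;> simp [h, Ne.symm h]

theorem Γ_mul_gam {p : ℕ} (b : Fin 11) (a : Fin p → Fin 11) :
    M.Γ b * M.gam a = (-1 : ℝ) ^ (p + mult a b) • (M.gam a * M.Γ b) := by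
  by_cases ha : Function.Injective a
  · rw [M.gam_of_injective ha, Γ_mul_word]
  · simp [M.gam_of_not_injective ha]

theorem gam_mul_self {p : ℕ} {a : Fin p → Fin 11} (ha : Function.Injective a) :
    M.gam a * M.gam a = ((-1 : ℝ) ^ (p * (p - 1) / 2) * etas a) • 1 := by
  rw [M.gam_of_injective ha, M.word_mul_self ha]

theorem gam_transpose_mul {p : ℕ} (a : Fin p → Fin 11) :
    (M.gam a).transpose * M.C = (-1 : ℝ) ^ (p * (p + 1) / 2) • (M.C * M.gam a) := by
  by_cases ha : Function.Injective a
  · rw [M.gam_of_injective ha, M.word_transpose_mul ha]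
  · simp [M.gam_of_not_injective ha]

/-! ### Traces -/

/-- The trace of Γ_b A Γ_b is η_bb tr A by cyclicity and its negative by anticommutation. -/
theorem trace_eq_zero_of_anticomm {A : Matrix (Fin 32) (Fin 32) ℝ} {b : Fin 11}
    (h : M.Γ b * A = -(A * M.Γ b)) : A.trace = 0 := by
  have h1 : (M.Γ b * A * M.Γ b).trace = -(eta b * A.trace) := by
    rw [h, neg_mul, mul_assoc, Γ_sq]
    simp
  rw [Matrix.trace_mul_cycle, Γ_sq, smul_mul_assoc, one_mul, Matrix.trace_smul, smul_eq_mul] at h1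
  have h2 : eta b ≠ 0 := by unfold eta; split <;> norm_num
  have h3 : eta b * A.trace = 0 := by linarith
  exact (mul_eq_zero.1 h3).resolve_left h2

theorem even_of_trace_ne_zero {A : Matrix (Fin 32) (Fin 32) ℝ} {b : Fin 11} {n : ℕ}
    (h : M.Γ b * A = (-1 : ℝ) ^ n • (A * M.Γ b)) (hA : A.trace ≠ 0) : Even n := by
  by_contra hn
  rw [Nat.not_even_iff_odd] at hn
  rw [hn.neg_one_pow, neg_one_smul] at h
  exact hA (M.trace_eq_zero_of_anticomm h)

/-- The selection rule for traces: the product commutes or anticommutes with each Γ_c, and a nonzero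
trace excludes the latter. -/
theorem trace_gam_gam {p q : ℕ} {a : Fin p → Fin 11} {b : Fin q → Fin 11}
    (h : (M.gam a * M.gam b).trace ≠ 0) (c : Fin 11) :
    Even (p + q + (mult a c + mult b c)) := by
  refine M.even_of_trace_ne_zero (b := c) ?_ h
  rw [← mul_assoc, Γ_mul_gam, smul_mul_assoc, mul_assoc, Γ_mul_gam, mul_smul_comm, smul_smul,
    ← pow_add, mul_assoc]
  congr 2
  ring

theorem trace_gam_gam_gam {p q r : ℕ} {a : Fin p → Fin 11} {b : Fin q → Fin 11}
    {c : Fin r → Fin 11} (h : (M.gam a * M.gam b * M.gam c).trace ≠ 0) :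
    Function.Injective a ∧ Function.Injective b ∧ Function.Injective c ∧
      ∀ x, Even (p + q + r + (mult a x + mult b x + mult c x)) := by
  refine ⟨M.injective_of_gam_ne_zero ?_, M.injective_of_gam_ne_zero ?_,
    M.injective_of_gam_ne_zero ?_, fun x => M.even_of_trace_ne_zero (b := x) ?_ h⟩
  · rintro h0; simp [h0] at h
  · rintro h0; simp [h0] at h
  · rintro h0; simp [h0] at h
  · rw [← mul_assoc, ← mul_assoc, Γ_mul_gam, smul_mul_assoc, mul_assoc (M.gam a), Γ_mul_gam,
      mul_smul_comm, smul_smul, smul_mul_assoc, mul_assoc (M.gam a), mul_assoc (M.gam b),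
      Γ_mul_gam, mul_smul_comm, mul_smul_comm, smul_smul, ← pow_add, ← pow_add]
    simp only [mul_assoc]
    congr 2
    ring

/-- A bijective tuple is a rearrangement of the volume element. Otherwise some Γ_b does not occur,
and it anticommutes with the word because 11 is odd. -/
theorem trace_word_eleven (a : Fin 11 → Fin 11) : (M.word a).trace = 32 * leviCivita a := by
  unfold leviCivita
  split_ifs with h
  · have h1 : M.word (id ∘ Equiv.ofBijective a h) = _ := M.word_comp_perm Function.injective_id _
    have h2 : M.word (id : Fin 11 → Fin 11) = 1 := M.volume
    rw [h2] at h1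
    have h3 : M.word a = sgn (Equiv.ofBijective a h) • 1 := h1
    rw [h3, Matrix.trace_smul, Matrix.trace_one]
    simp [mul_comm]
  · rw [mul_zero]
    have h1 : ¬ Function.Surjective a := fun h2 => h ⟨Finite.injective_iff_surjective.2 h2, h2⟩
    simp only [Function.Surjective, not_forall, not_exists] at h1
    obtain ⟨b, hb⟩ := h1
    refine M.trace_eq_zero_of_anticomm (b := b) ?_
    rw [Γ_mul_word, mult_eq_zero.2 hb]
    norm_num

end MajoranaRep

/-! ### The Fierz completeness relation -/

/-- A sum over tuples supported on the rearrangements of a single tuple `u`. -/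
theorem sum_eq_factorial_smul {V : Type*} [AddCommGroup V] [Module ℝ V] {n : ℕ}
    (u : Fin n → Fin 11) (f : (Fin n → Fin 11) → V)
    (hf : ∀ σ : Equiv.Perm (Fin n), f (u ∘ σ) = f u)
    (hs : ∀ r, f r ≠ 0 → Function.Injective r ∧ ∀ i, ∃ j, u j = r i) :
    ∑ r, f r = (n.factorial : ℝ) • f u := by
  have key : ∀ r, f r ≠ 0 → ∃ σ : Equiv.Perm (Fin n), u ∘ σ = r := fun r hr => by
    obtain ⟨hi, hj⟩ := hs r hr
    choose g hg using hj
    have hginj : Function.Injective g := fun i j h => hi (by rw [← hg, ← hg, h])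
    exact ⟨Equiv.ofBijective g (Finite.injective_iff_bijective.1 hginj), funext hg⟩
  by_cases h0 : f u = 0
  · rw [h0, smul_zero]
    refine Finset.sum_eq_zero fun r _ => ?_
    by_contra hr
    obtain ⟨σ, rfl⟩ := key r hr
    exact hr ((hf σ).trans h0)
  · have hu := (hs u h0).1
    have hinj : Function.Injective fun σ : Equiv.Perm (Fin n) => u ∘ σ := fun σ τ h =>
      Equiv.ext fun i => hu (congrFun h i)
    have h1 : ∑ r, f r = ∑ σ : Equiv.Perm (Fin n), f (u ∘ σ) := by
      rw [← Finset.sum_image (s := Finset.univ) (g := fun σ : Equiv.Perm (Fin n) => u ∘ σ)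
        (f := f) (fun σ _ τ _ h => hinj h)]
      refine (Finset.sum_subset (Finset.subset_univ _) fun r _ hr => ?_).symm
      by_contra h
      obtain ⟨σ, rfl⟩ := key r h
      exact hr (Finset.mem_image_of_mem _ (Finset.mem_univ σ))
    rw [h1, Finset.sum_congr rfl fun σ _ => hf σ, Finset.sum_const, Finset.card_univ,
      Fintype.card_perm, Fintype.card_fin, ← Nat.cast_smul_eq_nsmul ℝ]

/-- The sign in `Γ_a Γ^a` for the grades `1, 2, 5` of symmetric gamma matrices; zero for other
grades. -/
def kappa : ℕ → ℝ
  | 1 => 1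
  | 2 => -1
  | 5 => 1
  | _ => 0

/-- If p + q were odd, each of the eleven indices would have to occur, which p + q ≤ 10 forbids. So
p + q is even, and multiplicities in {0, 1} of equal parity agree. -/
theorem mult_eq_of_even {p q : ℕ} {a : Fin p → Fin 11} {b : Fin q → Fin 11}
    (ha : Function.Injective a) (hb : Function.Injective b) (hpq : p + q ≤ 10)
    (h : ∀ c, Even (p + q + (mult a c + mult b c))) : p = q ∧ ∀ c, mult a c = mult b c := by
  have hs : ∑ c, (mult a c + mult b c) = p + q := by
    rw [Finset.sum_add_distrib, sum_mult, sum_mult]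
  have he : Even (p + q) := by
    by_contra hodd
    have h1 : ∑ c : Fin 11, 1 ≤ ∑ c, (mult a c + mult b c) :=
      Finset.sum_le_sum fun c _ => by
        by_contra h0
        have : mult a c + mult b c = 0 := by omega
        have h2 := h c
        rw [this] at h2
        exact hodd h2
    rw [hs] at h1
    simp at h1
    omega
  have heq : ∀ c, mult a c = mult b c := fun c => by
    have h1 := mult_le_one ha c
    have h2 := mult_le_one hb c
    have h3 := (Nat.even_add.1 (h c)).1 he
    rw [Nat.even_iff] at h3
    omega
  refine ⟨?_, heq⟩
  rw [← sum_mult a, ← sum_mult b]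
  exact Finset.sum_congr rfl fun c _ => heq c

theorem exists_eq_of_mult_ne_zero {p : ℕ} {a : Fin p → Fin 11} {b : Fin 11} (h : mult a b ≠ 0) :
    ∃ i, a i = b := by
  by_contra h'
  exact h (mult_eq_zero.2 (by simpa using h'))

theorem mult_apply_ne_zero {p : ℕ} (a : Fin p → Fin 11) (i : Fin p) : mult a (a i) ≠ 0 :=
  fun h => mult_eq_zero.1 h i rfl

namespace MajoranaRep

variable (M : MajoranaRep)

theorem trace_gam_gam_of_ne {p q : ℕ} (h : p ≠ q) (hpq : p + q ≤ 10) (a : Fin p → Fin 11)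
    (b : Fin q → Fin 11) : (M.gam a * M.gam b).trace = 0 := by
  by_contra h0
  have ha := M.injective_of_gam_ne_zero (a := a) (by rintro h; simp [h] at h0)
  have hb := M.injective_of_gam_ne_zero (a := b) (by rintro h; simp [h] at h0)
  exact h (mult_eq_of_even ha hb hpq (M.trace_gam_gam h0)).1

theorem trace_gam_mul_self {p : ℕ} {a : Fin p → Fin 11} (ha : Function.Injective a) :
    (M.gam a * M.gam a).trace = 32 * ((-1 : ℝ) ^ (p * (p - 1) / 2) * etas a) := by
  rw [M.gam_mul_self ha, Matrix.trace_smul, Matrix.trace_one]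
  simp [mul_comm]

/-- By trace orthogonality only the p! rearrangements of w contribute, and equally, since the sign
of the rearrangement enters twice. -/
theorem sum_trace_gam_smul {V : Type*} [AddCommGroup V] [Module ℝ V]
    (L : Matrix (Fin 32) (Fin 32) ℝ →ₗ[ℝ] V) {p : ℕ} (hp : p ≤ 5) (w : Fin p → Fin 11) :
    ∑ a : Fin p → Fin 11, ((M.gam w * M.gam a).trace * etas a) • L (M.gam a) =
      (32 * (-1 : ℝ) ^ (p * (p - 1) / 2) * p.factorial) • L (M.gam w) := by
  by_cases hw : Function.Injective w
  · rw [sum_eq_factorial_smul w]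
    · rw [M.trace_gam_mul_self hw, smul_smul]
      congr 1
      linear_combination (32 * (-1 : ℝ) ^ (p * (p - 1) / 2) * p.factorial) * etas_mul_self w
    · intro σ
      rw [etas_comp_perm, gam_comp_perm, map_smul, smul_smul, mul_smul_comm, Matrix.trace_smul,
        smul_eq_mul]
      congr 1
      linear_combination ((M.gam w * M.gam w).trace * etas w) * sgn_mul_self σ
    · intro r hr
      have h0 : (M.gam w * M.gam r).trace ≠ 0 := fun h => hr (by simp [h])
      have hri := M.injective_of_gam_ne_zero (a := r) (by rintro h; simp [h] at h0)
      refine ⟨hri, fun i => exists_eq_of_mult_ne_zero ?_⟩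
      rw [(mult_eq_of_even hw hri (by omega) (M.trace_gam_gam h0)).2]
      exact mult_apply_ne_zero r i
  · simp [M.gam_of_not_injective hw]

/-- The gamma matrix of a set of indices. -/
def gamSet (S : Finset (Fin 11)) : Matrix (Fin 32) (Fin 32) ℝ := M.gam (S.orderEmbOfFin rfl)

/-- Multiplying a linear relation by Γ_T and taking the trace isolates the coefficient of T. -/
theorem linearIndependent_gamSet :
    LinearIndependent ℝ fun S : {S : Finset (Fin 11) // S.card ≤ 5} => M.gamSet S := by
  rw [Fintype.linearIndependent_iff]
  intro g hg T
  have h1 := congrArg (fun A => (A * M.gamSet T).trace) hg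
  simp only [Finset.sum_mul, Matrix.trace_sum, zero_mul, Matrix.trace_zero, smul_mul_assoc,
    Matrix.trace_smul, smul_eq_mul] at h1
  rw [Finset.sum_eq_single T] at h1
  · refine (mul_eq_zero.1 h1).resolve_right ?_
    rw [gamSet, M.trace_gam_mul_self (Finset.orderEmbOfFin _ _).injective]
    have h2 := etas_mul_self ((T : Finset (Fin 11)).orderEmbOfFin rfl)
    refine mul_ne_zero (by norm_num) (mul_ne_zero (pow_ne_zero _ (by norm_num)) fun h => ?_)
    rw [h] at h2
    norm_num at h2
  · intro S _ hST
    rw [mul_eq_zero]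
    right
    by_contra h0
    have hS := S.2
    have hT := T.2
    have h3 := (mult_eq_of_even (Finset.orderEmbOfFin S.1 rfl).injective
      (Finset.orderEmbOfFin T.1 rfl).injective (by omega) (M.trace_gam_gam h0)).2
    have h4 : ∀ (S : Finset (Fin 11)) c, c ∈ S ↔ mult (S.orderEmbOfFin rfl) c ≠ 0 := by
      intro S c
      rw [Ne, mult_eq_zero, not_forall]
      simp only [not_not]
      rw [← Finset.mem_coe, ← Finset.range_orderEmbOfFin S rfl, Set.mem_range]
    exact hST (Subtype.ext (Finset.ext fun c => by rw [h4, h4, h3]))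
  · simp

/-- Half of the subsets of an eleven-element set have at most five elements: 2¹⁰ = 32² independent
matrices. -/
theorem span_gamSet :
    Submodule.span ℝ (Set.range fun S : {S : Finset (Fin 11) // S.card ≤ 5} => M.gamSet S) = ⊤ := by
  refine M.linearIndependent_gamSet.span_eq_top_of_card_eq_finrank' ?_
  have h : Fintype.card {S : Finset (Fin 11) // S.card ≤ 5} = 1024 := by
    rw [Fintype.card_subtype]
    decide +kernel
  rw [h, Module.finrank_matrix]
  simp

/-- The Fierz completeness relation, for linear maps which vanish on the skew-symmetric gamma
matrices. -/
theorem completeness {V : Type*} [AddCommGroup V] [Module ℝ V]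
    (L : Matrix (Fin 32) (Fin 32) ℝ →ₗ[ℝ] V) (h0 : ∀ a : Fin 0 → Fin 11, L (M.gam a) = 0)
    (h3 : ∀ a : Fin 3 → Fin 11, L (M.gam a) = 0) (h4 : ∀ a : Fin 4 → Fin 11, L (M.gam a) = 0)
    (A : Matrix (Fin 32) (Fin 32) ℝ) :
    (32 : ℝ) • L A = ∑ p ∈ ({1, 2, 5} : Finset ℕ), (kappa p / p.factorial) •
      ∑ a : Fin p → Fin 11, ((A * M.gam a).trace * etas a) • L (M.gam a) := by
  have hA : A ∈ Submodule.span ℝ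
      (Set.range fun S : {S : Finset (Fin 11) // S.card ≤ 5} => M.gamSet S) := by
    rw [M.span_gamSet]; trivial
  induction hA using Submodule.span_induction with
  | mem A h =>
    obtain ⟨⟨S, hS⟩, rfl⟩ := h
    simp only [gamSet]
    generalize (⇑(S.orderEmbOfFin rfl) : Fin S.card → Fin 11) = w
    generalize S.card = q at w hS
    have hne : ∀ p ∈ ({1, 2, 5} : Finset ℕ), p ≠ q → (kappa p / p.factorial) •
        ∑ a : Fin p → Fin 11, ((M.gam w * M.gam a).trace * etas a) • L (M.gam a) = 0 := by
      intro p hp hpq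
      have hp5 : p ≤ 5 := by simp at hp; omega
      rw [Finset.sum_eq_zero, smul_zero]
      intro a _
      rw [M.trace_gam_gam_of_ne hpq.symm (by omega), zero_mul, zero_smul]
    -- For q = 1, 2, 5 the sign `kappa q` equals (−1)^{q(q−1)/2}, so `kappa q / q!` cancels the
    -- normalization of `sum_trace_gam_smul` up to 32. The grades 0, 3, 4 are killed by `L`.
    have heq : (32 : ℝ) • L (M.gam w) = if q ∈ ({1, 2, 5} : Finset ℕ) then
        (kappa q / q.factorial) • ∑ a : Fin q → Fin 11,
          ((M.gam w * M.gam a).trace * etas a) • L (M.gam a) else 0 := by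
      rw [M.sum_trace_gam_smul L hS, smul_smul]
      interval_cases q
      · simp [h0]
      · simp [kappa]
      · norm_num [kappa, Nat.factorial, ← neg_smul]
      · simp [h3]
      · simp [h4]
      · norm_num [kappa, Nat.factorial, ← neg_smul]
    rw [heq]
    split_ifs with hq
    · rw [Finset.sum_eq_single q (fun p hp hpq => hne p hp hpq) fun h => absurd hq h]
    · rw [Finset.sum_eq_zero]
      exact fun p hp => hne p hp fun h => hq (h ▸ hp)
  | zero => simp
  | add A B _ _ hA hB =>
    simp only [map_add, smul_add, hA, hB, add_mul, Matrix.trace_add, add_smul,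
      Finset.sum_add_distrib]
  | smul r A _ hA =>
    rw [map_smul, smul_comm, hA]
    simp only [smul_mul_assoc, Matrix.trace_smul, smul_eq_mul, Finset.smul_sum, smul_smul]
    refine Finset.sum_congr rfl fun p _ => Finset.sum_congr rfl fun a _ => ?_
    congr 1
    ring

end MajoranaRep

/-! ### Bilinear expressions in `ψ` -/

theorem psi_mul_psi (α β : Fin 32) : psi α * psi β = psi β * psi α := by
  have h := gen_swap (.psi α) (.psi β)
  simp only [swapSign, Gen.odd, Bool.and_self, if_true, one_smul] at h
  exact h

/-- `(ψ̄ A χ)`, linear in the matrix `A`. -/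
def pairing (M : MajoranaRep) (χ : Fin 32 → CE) : Matrix (Fin 32) (Fin 32) ℝ →ₗ[ℝ] CE where
  toFun A := pair M psi A χ
  map_add' A B := by
    simp only [pair, Matrix.mul_add, Matrix.add_apply, add_smul, Finset.sum_add_distrib]
  map_smul' r A := pair_smul M r psi χ A

theorem pairing_apply (M : MajoranaRep) (χ : Fin 32 → CE) (A : Matrix (Fin 32) (Fin 32) ℝ) :
    pairing M χ A = pair M psi A χ := rfl

theorem pairing_act (M : MajoranaRep) (A B : Matrix (Fin 32) (Fin 32) ℝ) (χ : Fin 32 → CE) :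
    pairing M (act B χ) A = pairing M χ (A * B) := by
  simp only [pairing_apply, pair, act, Finset.mul_sum, Finset.smul_sum, mul_smul_comm, smul_smul]
  refine Finset.sum_congr rfl fun α _ => ?_
  rw [Finset.sum_comm]
  refine Finset.sum_congr rfl fun γ _ => ?_
  rw [← Finset.sum_smul, ← mul_assoc, Matrix.mul_apply]

/-- `(ψ̄ A ψ)`, linear in the matrix `A`. -/
def quadForm (M : MajoranaRep) : Matrix (Fin 32) (Fin 32) ℝ →ₗ[ℝ] CE := pairing M psi

theorem quadForm_apply (M : MajoranaRep) (A : Matrix (Fin 32) (Fin 32) ℝ) :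
    quadForm M A = pair M psi A psi := rfl

theorem commute_of_gen {q : CE} (h : ∀ y, Commute q (gen y)) (x : CE) : Commute q x := by
  obtain ⟨y, rfl⟩ := CE.mk_surjective x
  induction y using FreeAlgebra.induction with
  | grade0 r => rw [AlgHom.commutes]; exact (Algebra.commutes r q).symm
  | grade1 y => exact h y
  | mul a b ha hb => rw [map_mul]; exact ha.mul_right hb
  | add a b ha hb => rw [map_add]; exact ha.add_right hb

/-- Its bidegree is (2, even), so the sign rule makes it central. -/
theorem quadForm_commute (M : MajoranaRep) (A : Matrix (Fin 32) (Fin 32) ℝ) (x : CE) :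
    Commute (quadForm M A) x := by
  refine commute_of_gen (fun y => ?_) x
  have h := quad_swap (pair_mem M A) y
  rw [Bool.false_and, if_neg Bool.false_ne_true, one_smul] at h
  exact h

theorem mul_quadForm (M : MajoranaRep) (A : Matrix (Fin 32) (Fin 32) ℝ) (x : CE) :
    x * quadForm M A = quadForm M A * x := (quadForm_commute M A x).eq.symm

/-- The ψ^α commute, so only the symmetric part of `M.C * A` contributes; for a self-adjoint A it
vanishes because C is skew. -/
theorem quadForm_eq_zero_of_skew (M : MajoranaRep) {A : Matrix (Fin 32) (Fin 32) ℝ}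
    (h : A.transpose * M.C = M.C * A) : quadForm M A = 0 := by
  have h1 : (M.C * A).transpose = -(M.C * A) := by
    rw [Matrix.transpose_mul, M.skew, mul_neg, h]
  have h2 : quadForm M A = -quadForm M A := by
    nth_rw 1 [quadForm_apply, pair, Finset.sum_comm]
    rw [quadForm_apply, pair, ← Finset.sum_neg_distrib]
    refine Finset.sum_congr rfl fun α _ => ?_
    rw [← Finset.sum_neg_distrib]
    refine Finset.sum_congr rfl fun γ _ => ?_
    have h3 := congrFun (congrFun h1 α) γ
    rw [Matrix.transpose_apply, Matrix.neg_apply] at h3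
    rw [h3, neg_smul, psi_mul_psi]
  have h3 : (2 : ℝ) • quadForm M A = 0 := by
    rw [two_smul]; nth_rw 1 [h2]; simp
  exact (smul_eq_zero.1 h3).resolve_left two_ne_zero

theorem quadForm_gam_eq_zero (M : MajoranaRep) {p : ℕ} (hp : Even (p * (p + 1) / 2))
    (a : Fin p → Fin 11) : quadForm M (M.gam a) = 0 :=
  quadForm_eq_zero_of_skew M (by rw [M.gam_transpose_mul, hp.neg_one_pow, one_smul])

theorem quadForm_one (M : MajoranaRep) : quadForm M 1 = 0 :=
  quadForm_eq_zero_of_skew M (by simp)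

/-- `A` is skew self-adjoint for the spinor metric. -/
def MajoranaRep.IsSkewAdjoint (M : MajoranaRep) (A : Matrix (Fin 32) (Fin 32) ℝ) : Prop :=
  A.transpose * M.C = -(M.C * A)

theorem MajoranaRep.isSkewAdjoint_gam (M : MajoranaRep) {p : ℕ} (hp : kappa p ≠ 0)
    (a : Fin p → Fin 11) : M.IsSkewAdjoint (M.gam a) := by
  rw [MajoranaRep.IsSkewAdjoint, M.gam_transpose_mul, ← neg_one_smul ℝ]
  unfold kappa at hp
  split at hp <;> first | exact absurd rfl hp | norm_num

/-- The anticommutator of two skew self-adjoint matrices is self-adjoint. -/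
theorem quadForm_mul_eq (M : MajoranaRep) {A B : Matrix (Fin 32) (Fin 32) ℝ}
    (hA : M.IsSkewAdjoint A) (hB : M.IsSkewAdjoint B) :
    quadForm M (A * B) = -quadForm M (B * A) := by
  rw [eq_neg_iff_add_eq_zero, ← map_add]
  apply quadForm_eq_zero_of_skew
  rw [Matrix.transpose_add, add_mul, Matrix.transpose_mul, Matrix.transpose_mul, mul_assoc, hA,
    mul_assoc, hB, mul_neg, ← mul_assoc, hB, mul_neg, ← mul_assoc, hA, mul_add]
  simp only [neg_mul, neg_neg, mul_assoc]
  rw [add_comm]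

/-- The C-adjoint preserves the trace, reverses the product and contributes three signs; a cyclic
permutation then restores D to the end. -/
theorem trace_mul_mul_swap (M : MajoranaRep) {A B D : Matrix (Fin 32) (Fin 32) ℝ}
    (hA : M.IsSkewAdjoint A) (hB : M.IsSkewAdjoint B) (hD : M.IsSkewAdjoint D) :
    (A * B * D).trace = -(B * A * D).trace := by
  have hC : IsUnit M.C.det := isUnit_iff_ne_zero.2 M.nondegenerate
  have h1 : (A * B * D).transpose * M.C = -(M.C * (D * B * A)) := by
    rw [Matrix.transpose_mul, Matrix.transpose_mul, mul_assoc, mul_assoc, hA, mul_neg,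
      ← mul_assoc B.transpose, hB, neg_mul, neg_neg, mul_assoc, ← mul_assoc, hD]
    simp only [neg_mul, mul_assoc]
  have h2 : (A * B * D).transpose = -(M.C * (D * B * A) * M.C⁻¹) := by
    rw [← neg_mul, ← h1, Matrix.mul_nonsing_inv_cancel_right _ _ hC]
  rw [← Matrix.trace_transpose, h2, Matrix.trace_neg, Matrix.trace_mul_comm, ← mul_assoc,
    Matrix.nonsing_inv_mul _ hC, one_mul, ← Matrix.trace_mul_cycle]

/-- The Fierz expansion of `(ψ̄ A ψ)`. -/
theorem quadForm_fierz (M : MajoranaRep) (A : Matrix (Fin 32) (Fin 32) ℝ) :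
    (32 : ℝ) • quadForm M A = ∑ p ∈ ({1, 2, 5} : Finset ℕ), (kappa p / p.factorial) •
      ∑ a : Fin p → Fin 11, ((A * M.gam a).trace * etas a) • quadForm M (M.gam a) :=
  M.completeness (quadForm M) (quadForm_gam_eq_zero M (by decide))
    (quadForm_gam_eq_zero M (by decide)) (quadForm_gam_eq_zero M (by decide)) A

/-- This is `quadForm_fierz` for the matrix A = C⁻¹ E_{γβ}, for which (ψ̄ A ψ) = ψ^β ψ^γ. -/
theorem psi_mul_psi_fierz (M : MajoranaRep) (β γ : Fin 32) :
    (32 : ℝ) • (psi β * psi γ) = ∑ p ∈ ({1, 2, 5} : Finset ℕ), (kappa p / p.factorial) •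
      ∑ a : Fin p → Fin 11,
        ((M.gam a * M.C⁻¹) β γ * etas a) • quadForm M (M.gam a) := by
  have hC : IsUnit M.C.det := isUnit_iff_ne_zero.2 M.nondegenerate
  have h := quadForm_fierz M (M.C⁻¹ * Matrix.single γ β 1)
  have h1 : quadForm M (M.C⁻¹ * Matrix.single γ β 1) = psi β * psi γ := by
    rw [quadForm_apply, pair, ← mul_assoc, Matrix.mul_nonsing_inv _ hC, one_mul,
      psi_mul_psi β, Finset.sum_eq_single γ, Finset.sum_eq_single β]
    · simp
    · intro δ _ hδ
      simp [hδ.symm]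
    · simp
    · intro δ _ hδ
      simp [hδ.symm]
    · simp
  have h2 : ∀ G : Matrix (Fin 32) (Fin 32) ℝ,
      (M.C⁻¹ * Matrix.single γ β 1 * G).trace = (G * M.C⁻¹) β γ := by
    intro G
    rw [Matrix.trace_mul_cycle, Matrix.trace_mul_single]
    simp
  simpa only [h1, h2] using h

theorem sum_mul_smul_mul (X Y : Matrix (Fin 32) (Fin 32) ℝ) (u v : Fin 32 → CE) :
    ∑ α, ∑ δ, (X * Y) α δ • (u α * v δ) =
      ∑ β, (∑ α, X α β • u α) * ∑ δ, Y β δ • v δ := by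
  simp only [Matrix.mul_apply, Finset.sum_smul, Finset.sum_mul_sum, smul_mul_assoc,
    mul_smul_comm, smul_smul]
  rw [← Finset.sum_comm_cycle, ← Finset.sum_comm_cycle]
  simp only [mul_comm]

/-- The Fierz rearrangement of `(ψ̄ N ψ)(ψ̄ R χ)`. -/
theorem quadForm_mul_pairing (M : MajoranaRep) (N R : Matrix (Fin 32) (Fin 32) ℝ)
    (χ : Fin 32 → CE) :
    (32 : ℝ) • (quadForm M N * pairing M χ R) =
      ∑ p ∈ ({1, 2, 5} : Finset ℕ), (kappa p / p.factorial) • ∑ a : Fin p → Fin 11,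
        etas a • (quadForm M (M.gam a) * pairing M χ (N * M.gam a * R)) := by
  have hC : IsUnit M.C.det := isUnit_iff_ne_zero.2 M.nondegenerate
  -- The product takes the form l_β ψ^β ψ^γ r_γ, in which the two inner factors are replaced by
  -- their Fierz expansion.
  obtain ⟨l, hl⟩ : ∃ l : Fin 32 → CE, l = fun β => ∑ α, (M.C * N) α β • psi α := ⟨_, rfl⟩
  obtain ⟨r, hr⟩ : ∃ r : Fin 32 → CE, r = fun γ => ∑ δ, (M.C * R) γ δ • χ δ := ⟨_, rfl⟩
  have h1 : quadForm M N * pairing M χ R = ∑ β, ∑ γ, l β * (psi β * psi γ) * r γ := by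
    have h2 : quadForm M N = ∑ β, l β * psi β := by
      rw [quadForm_apply, pair, Finset.sum_comm]
      simp only [hl, Finset.sum_mul, smul_mul_assoc]
    have h3 : pairing M χ R = ∑ γ, psi γ * r γ := by
      rw [pairing_apply, pair]
      simp only [hr, Finset.mul_sum, mul_smul_comm]
    rw [h2, h3, Finset.sum_mul_sum]
    simp only [mul_assoc]
  have h4 : ∀ G : Matrix (Fin 32) (Fin 32) ℝ, pairing M χ (N * G * R) =
      ∑ β, ∑ γ, (G * M.C⁻¹) β γ • (l β * r γ) := by
    intro G
    have h5 : M.C * (N * G * R) = M.C * N * (G * M.C⁻¹) * (M.C * R) := by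
      simp only [mul_assoc]
      rw [← mul_assoc M.C⁻¹, Matrix.nonsing_inv_mul _ hC, one_mul]
    rw [pairing_apply, pair, h5, mul_assoc, sum_mul_smul_mul]
    refine Finset.sum_congr rfl fun β _ => ?_
    simp only [Matrix.mul_apply (M := G * _), Finset.sum_smul, hr, Finset.mul_sum, mul_smul,
      Finset.smul_sum, mul_smul_comm, hl]
    rw [Finset.sum_comm]
  have h6 : ∀ β γ, (32 : ℝ) • (l β * (psi β * psi γ) * r γ) =
      ∑ p ∈ ({1, 2, 5} : Finset ℕ), (kappa p / p.factorial) • ∑ a : Fin p → Fin 11,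
        etas a • (quadForm M (M.gam a) * (M.gam a * M.C⁻¹) β γ • (l β * r γ)) := by
    intro β γ
    rw [← smul_mul_assoc, ← mul_smul_comm, psi_mul_psi_fierz M, Finset.mul_sum, Finset.sum_mul]
    refine Finset.sum_congr rfl fun p _ => ?_
    rw [mul_smul_comm, smul_mul_assoc, Finset.mul_sum, Finset.sum_mul]
    congr 1
    refine Finset.sum_congr rfl fun a _ => ?_
    rw [mul_smul_comm, smul_mul_assoc, mul_quadForm, mul_smul_comm, smul_smul, mul_comm (etas a),
      mul_assoc]
  simp only [h1, Finset.smul_sum, h6, h4, Finset.mul_sum]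
  rw [Finset.sum_comm_cycle]
  refine Finset.sum_congr rfl fun p _ => ?_
  rw [Finset.sum_comm_cycle]

/-! ### The even generators and their differentials -/

/-- The generators `e^a`, `e^{a₁a₂}`, `e^{a₁⋯a₅}` with upper indices, by their number of indices. -/
def form : (p : ℕ) → (Fin p → Fin 11) → CE
  | 1 => fun a => e₁ (a 0)
  | 2 => e₂up
  | 5 => e₅up
  | _ => fun _ => 0

/-- Outside the grades 1, 2, 5 both `kappa` and `form` take the default value zero, so the
identities below hold for every p without side conditions. -/
theorem kappa_eq_zero_or_form_eq (p : ℕ) :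
    (kappa p = 0 ∧ ∀ a, form p a = 0) ∨ (kappa p ≠ 0 ∧
      ∀ a : Fin p → Fin 11, ∃ (r : ℝ) (x : Gen), x.odd = false ∧ form p a = r • gen x) := by
  match p with
  | 0 => exact .inl ⟨rfl, fun _ => rfl⟩
  | 1 => exact .inr ⟨one_ne_zero, fun a => ⟨1, .e₁ (a 0), rfl, (one_smul _ _).symm⟩⟩
  | 2 => exact .inr ⟨by simp [kappa], fun a => ⟨etas a, .e₂ a, rfl, rfl⟩⟩
  | 3 => exact .inl ⟨rfl, fun _ => rfl⟩
  | 4 => exact .inl ⟨rfl, fun _ => rfl⟩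
  | 5 => exact .inr ⟨one_ne_zero, fun a => ⟨etas a, .e₅ a, rfl, rfl⟩⟩
  | n + 6 => exact .inl ⟨rfl, fun _ => rfl⟩

theorem form_eq_smul_gen (p : ℕ) (a : Fin p → Fin 11) :
    ∃ (r : ℝ) (x : Gen), x.odd = false ∧ form p a = r • gen x := by
  rcases kappa_eq_zero_or_form_eq p with h | h
  · exact ⟨0, .e₁ 0, rfl, by rw [h.2, zero_smul]⟩
  · exact h.2 a

theorem form_mul_form {p q : ℕ} (a : Fin p → Fin 11) (b : Fin q → Fin 11) :
    form p a * form q b = -(form q b * form p a) := by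
  obtain ⟨r, x, hx, h⟩ := form_eq_smul_gen p a
  obtain ⟨t, y, hy, h'⟩ := form_eq_smul_gen q b
  have h2 := gen_swap x y
  simp only [swapSign, hx, hy, Bool.and_self, Bool.false_eq_true, if_false] at h2
  rw [h, h', smul_mul_smul_comm, h2, smul_mul_smul_comm, mul_comm t, neg_one_smul, smul_neg]

theorem gradeInv_form {p : ℕ} (a : Fin p → Fin 11) : gradeInv (form p a) = -form p a := by
  obtain ⟨r, x, -, h⟩ := form_eq_smul_gen p a
  rw [h, map_smul, gradeInv_gen, smul_neg]

theorem form_comp_perm {p : ℕ} (a : Fin p → Fin 11) (σ : Equiv.Perm (Fin p)) :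
    form p (a ∘ σ) = sgn σ • form p a := by
  match p with
  | 0 => exact (smul_zero _).symm
  | 1 =>
    have : σ = 1 := Subsingleton.elim _ _
    subst this
    simp [sgn]
  | 2 =>
    change etas (a ∘ σ) • gen (.e₂ (a ∘ σ)) = sgn σ • etas a • gen (.e₂ a)
    rw [etas_comp_perm, gen_skew₂, smul_comm]
  | 3 => exact (smul_zero _).symm
  | 4 => exact (smul_zero _).symm
  | 5 =>
    change etas (a ∘ σ) • gen (.e₅ (a ∘ σ)) = sgn σ • etas a • gen (.e₅ a)
    rw [etas_comp_perm, gen_skew₅, smul_comm]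
  | n + 6 => exact (smul_zero _).symm

theorem form_eq_zero {p : ℕ} {a : Fin p → Fin 11} (ha : ¬ Function.Injective a) :
    form p a = 0 := eq_zero_of_alternating form_comp_perm ha

theorem d_psi (M : MajoranaRep) (s : ℝ) (α : Fin 32) : d M s (psi α) = 0 := d_gen M s (.psi α)

theorem gradeInv_psi (α : Fin 32) : gradeInv (psi α) = -psi α := gradeInv_gen (.psi α)

theorem d_pairing (M : MajoranaRep) (s : ℝ) (χ : Fin 32 → CE) (A : Matrix (Fin 32) (Fin 32) ℝ) :
    d M s (pairing M χ A) = -pairing M (fun α => d M s (χ α)) A := by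
  simp only [pairing_apply, pair, map_sum, map_smul, d_mul, d_psi, gradeInv_psi, zero_mul,
    zero_add, neg_mul, smul_neg, Finset.sum_neg_distrib]

theorem gradeInv_pairing (M : MajoranaRep) {χ : Fin 32 → CE} (hχ : ∀ α, gradeInv (χ α) = -χ α)
    (A : Matrix (Fin 32) (Fin 32) ℝ) : gradeInv (pairing M χ A) = pairing M χ A := by
  simp only [pairing_apply, pair, map_sum, map_smul, map_mul, gradeInv_psi, hχ, neg_mul_neg]

/-- The signs prescribed for d on the three kinds of even generators are exactly the Fierz signs.
This makes a uniform treatment of the three grades possible. -/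
theorem d_form (M : MajoranaRep) (s : ℝ) (p : ℕ) (a : Fin p → Fin 11) :
    d M s (form p a) = (kappa p * etas a) • quadForm M (M.gam a) := by
  match p with
  | 0 => change d M s 0 = _; simp [kappa]
  | 1 =>
    change d M s (gen (.e₁ (a 0))) = _
    rw [d_gen, M.gam_one, ← map_smul]
    simp [dGen, kappa, etas, quadForm_apply, pair_smul]
  | 2 =>
    change d M s (etas a • gen (.e₂ a)) = _
    rw [map_smul, d_gen]
    simp [dGen, kappa, quadForm_apply]
  | 3 => change d M s 0 = _; simp [kappa]
  | 4 => change d M s 0 = _; simp [kappa]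
  | 5 =>
    change d M s (etas a • gen (.e₅ a)) = _
    rw [map_smul, d_gen]
    simp [dGen, kappa, quadForm_apply]
  | n + 6 => change d M s 0 = _; simp [kappa]

/-! ### Invariant quadratic and cubic expressions -/

/-- `(ψ̄ Γ_a Γ_b ψ) e^a e^b`, for multi-indices `a`, `b` of lengths `p`, `q`. -/
def bilin (M : MajoranaRep) (p q : ℕ) : CE :=
  ∑ a : Fin p → Fin 11, ∑ b : Fin q → Fin 11,
    quadForm M (M.gam a * M.gam b) * (form p a * form q b)

/-- `± tr(Γ_a Γ_b Γ_c) (ψ̄ Γ^c ψ) e^a e^b`, for multi-indices `a`, `b`, `c` of lengths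
`p`, `q`, `r`. -/
def trilin (M : MajoranaRep) (r p q : ℕ) : CE :=
  kappa r • ∑ a : Fin p → Fin 11, ∑ b : Fin q → Fin 11, ∑ c : Fin r → Fin 11,
    ((M.gam a * M.gam b * M.gam c).trace * etas c) •
      (quadForm M (M.gam c) * (form p a * form q b))

/-- `tr(Γ_a Γ_b Γ_c) e^a e^b e^c`, for multi-indices `a`, `b`, `c` of lengths `p`, `q`, `r`. -/
def cubic (M : MajoranaRep) (p q r : ℕ) : CE :=
  ∑ a : Fin p → Fin 11, ∑ b : Fin q → Fin 11, ∑ c : Fin r → Fin 11,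
    (M.gam a * M.gam b * M.gam c).trace • (form p a * form q b * form r c)

/-- The Fierz expansion of (ψ̄ Γ_a Γ_b ψ). The Fierz sign is part of `trilin`, which leaves only the
factorials. -/
theorem smul_bilin (M : MajoranaRep) (p q : ℕ) :
    (32 : ℝ) • bilin M p q =
      ∑ r ∈ ({1, 2, 5} : Finset ℕ), (1 / (r.factorial : ℝ)) • trilin M r p q := by
  have h : ∀ (a : Fin p → Fin 11) (b : Fin q → Fin 11),
      (32 : ℝ) • (quadForm M (M.gam a * M.gam b) * (form p a * form q b)) =
      ∑ r ∈ ({1, 2, 5} : Finset ℕ), (1 / (r.factorial : ℝ)) • kappa r • ∑ c : Fin r → Fin 11,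
        ((M.gam a * M.gam b * M.gam c).trace * etas c) •
        (quadForm M (M.gam c) * (form p a * form q b)) := by
    intro a b
    rw [← smul_mul_assoc, quadForm_fierz, Finset.sum_mul]
    refine Finset.sum_congr rfl fun r _ => ?_
    rw [smul_mul_assoc, Finset.sum_mul, smul_smul, one_div_mul_eq_div]
    simp only [smul_mul_assoc]
  simp only [bilin, trilin, Finset.smul_sum (r := (32 : ℝ)), h]
  rw [Finset.sum_comm_cycle]
  simp only [Finset.smul_sum]

/-- Two signs cancel: one from exchanging Γ_a and Γ_b in the trace, one from exchanging e^a and e^b.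
-/
theorem trilin_symm (M : MajoranaRep) (r p q : ℕ) : trilin M r p q = trilin M r q p := by
  rcases kappa_eq_zero_or_form_eq r with hr | hr
  · simp [trilin, hr.1]
  rcases kappa_eq_zero_or_form_eq p with hp | hp
  · simp [trilin, hp.2]
  rcases kappa_eq_zero_or_form_eq q with hq | hq
  · simp [trilin, hq.2]
  unfold trilin
  congr 1
  refine Finset.sum_comm.trans ?_
  refine Finset.sum_congr rfl fun b _ => Finset.sum_congr rfl fun a _ =>
    Finset.sum_congr rfl fun c _ => ?_
  rw [trace_mul_mul_swap M (M.isSkewAdjoint_gam hp.1 a) (M.isSkewAdjoint_gam hq.1 b)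
    (M.isSkewAdjoint_gam hr.1 c), form_mul_form a b, mul_neg, neg_mul, neg_smul, smul_neg, neg_neg]

/-- The Leibniz rule gives three terms. Centrality of (ψ̄ Γ ψ) and cyclicity of the trace bring each
to the standard order. -/
theorem d_cubic (M : MajoranaRep) (s : ℝ) (p q r : ℕ) :
    d M s (cubic M p q r) = trilin M p q r + trilin M q r p + trilin M r p q := by
  have h : ∀ (a : Fin p → Fin 11) (b : Fin q → Fin 11) (c : Fin r → Fin 11),
      d M s ((M.gam a * M.gam b * M.gam c).trace • (form p a * form q b * form r c)) =
      kappa p • ((M.gam b * M.gam c * M.gam a).trace * etas a) •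
        (quadForm M (M.gam a) * (form q b * form r c)) +
      kappa q • ((M.gam c * M.gam a * M.gam b).trace * etas b) •
        (quadForm M (M.gam b) * (form r c * form p a)) +
      kappa r • ((M.gam a * M.gam b * M.gam c).trace * etas c) •
        (quadForm M (M.gam c) * (form p a * form q b)) := by
    intro a b c
    rw [Matrix.trace_mul_cycle (M.gam b), ← Matrix.trace_mul_cycle (M.gam a), map_smul, d_mul,
      d_mul, d_form, d_form, d_form, map_mul, gradeInv_form, gradeInv_form, neg_mul_neg,
      form_mul_form c a]
    simp only [smul_mul_assoc, mul_smul_comm, add_mul, mul_quadForm, smul_add, smul_smul, neg_mul,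
      mul_neg, smul_neg]
    simp only [mul_assoc]
    congr 2
    · congr 1; ring
    · congr 1; congr 1; ring
    · ring
  simp only [cubic, map_sum, h, Finset.sum_add_distrib, trilin, Finset.smul_sum]
  congr 1
  congr 1
  · rw [Finset.sum_comm_cycle]
    rw [Finset.sum_comm_cycle]
  · rw [Finset.sum_comm_cycle]

/-- For odd total length a nonzero trace needs each of the eleven indices an odd number of times,
hence at least eleven indices in total. -/
theorem trilin_eq_zero_of_odd (M : MajoranaRep) {r p q : ℕ} (h : Odd (p + q + r))
    (h' : p + q + r < 11) : trilin M r p q = 0 := by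
  have key : ∀ (a : Fin p → Fin 11) (b : Fin q → Fin 11) (c : Fin r → Fin 11),
      (M.gam a * M.gam b * M.gam c).trace = 0 := by
    intro a b c
    by_contra h0
    have h1 : ∑ x : Fin 11, 1 ≤ ∑ x, (mult a x + mult b x + mult c x) :=
      Finset.sum_le_sum fun x _ => by
        have h2 := (M.trace_gam_gam_gam h0).2.2.2 x
        rw [Nat.even_iff] at h2
        rw [Nat.odd_iff] at h
        omega
    rw [Finset.sum_add_distrib, Finset.sum_add_distrib, sum_mult, sum_mult, sum_mult] at h1
    simp at h1
    omega
  simp [trilin, key]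

/-- For even total length a nonzero trace needs each index in none or in exactly two of the three
tuples, which forces the triangle inequalities on the lengths. -/
theorem trilin_eq_zero_of_even (M : MajoranaRep) {r p q : ℕ} (h : Even (p + q + r))
    (h' : p + q < r ∨ q + r < p ∨ r + p < q) : trilin M r p q = 0 := by
  have key : ∀ (a : Fin p → Fin 11) (b : Fin q → Fin 11) (c : Fin r → Fin 11),
      (M.gam a * M.gam b * M.gam c).trace = 0 := by
    intro a b c
    by_contra h0
    obtain ⟨ha, hb, hc, he⟩ := M.trace_gam_gam_gam h0
    have h1 : ∀ x, mult a x ≤ mult b x + mult c x ∧ mult b x ≤ mult c x + mult a x ∧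
        mult c x ≤ mult a x + mult b x := fun x => by
      have h2 := he x
      have h3 := mult_le_one ha x
      have h4 := mult_le_one hb x
      have h5 := mult_le_one hc x
      rw [Nat.even_iff] at h2 h
      omega
    have h2 := Finset.sum_le_sum fun x (_ : x ∈ Finset.univ) => (h1 x).1
    have h3 := Finset.sum_le_sum fun x (_ : x ∈ Finset.univ) => (h1 x).2.1
    have h4 := Finset.sum_le_sum fun x (_ : x ∈ Finset.univ) => (h1 x).2.2
    rw [Finset.sum_add_distrib, sum_mult, sum_mult, sum_mult] at h2 h3 h4
    omega
  simp [trilin, key]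

/-! ### Contractions -/

theorem mult_cons {p : ℕ} (x : Fin 11) (a : Fin p → Fin 11) (c : Fin 11) :
    mult (Fin.cons x a : Fin (p + 1) → Fin 11) c = (if x = c then 1 else 0) + mult a c := by
  simp [mult_succ]

theorem mult_snoc {p : ℕ} (a : Fin p → Fin 11) (x : Fin 11) (c : Fin 11) :
    mult (Fin.snoc a x : Fin (p + 1) → Fin 11) c = mult a c + if x = c then 1 else 0 := by
  rw [mult, Fin.sum_univ_castSucc]
  simp only [Fin.snoc_castSucc, Fin.snoc_last, mult]

theorem snoc_comp_swap {p : ℕ} (a : Fin p → Fin 11) (x : Fin 11) (i j : Fin p) :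
    (Fin.snoc (a ∘ Equiv.swap i j) x : Fin (p + 1) → Fin 11) =
      (Fin.snoc a x : Fin (p + 1) → Fin 11) ∘ Equiv.swap i.castSucc j.castSucc := by
  funext k
  refine Fin.lastCases ?_ (fun k => ?_) k
  · rw [Function.comp_apply, Equiv.swap_apply_of_ne_of_ne (Fin.castSucc_lt_last i).ne'
      (Fin.castSucc_lt_last j).ne', Fin.snoc_last, Fin.snoc_last]
  · rw [Function.comp_apply, ← (Fin.castSucc_injective p).map_swap, Fin.snoc_castSucc,
      Fin.snoc_castSucc, Function.comp_apply]

theorem cons_comp_swap {p : ℕ} (x : Fin 11) (a : Fin p → Fin 11) (i j : Fin p) :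
    (Fin.cons x (a ∘ Equiv.swap i j) : Fin (p + 1) → Fin 11) =
      (Fin.cons x a : Fin (p + 1) → Fin 11) ∘ Equiv.swap i.succ j.succ := by
  funext k
  refine Fin.cases ?_ (fun k => ?_) k
  · rw [Function.comp_apply, Equiv.swap_apply_of_ne_of_ne (Fin.succ_ne_zero i).symm
      (Fin.succ_ne_zero j).symm, Fin.cons_zero, Fin.cons_zero]
  · rw [Function.comp_apply, ← (Fin.succ_injective p).map_swap, Fin.cons_succ,
      Fin.cons_succ, Function.comp_apply]

section

variable {V : Type*} [AddCommGroup V]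

theorem sum_snoc {m : ℕ} (f : (Fin (m + 1) → Fin 11) → V) :
    ∑ s, f s = ∑ a : Fin m → Fin 11, ∑ x, f (Fin.snoc a x) := by
  rw [← (Fin.snocEquiv fun _ : Fin (m + 1) => Fin 11).sum_comp, Fintype.sum_prod_type,
    Finset.sum_comm]
  rfl

theorem sum_cons {m : ℕ} (f : (Fin (m + 1) → Fin 11) → V) :
    ∑ s, f s = ∑ x, ∑ a : Fin m → Fin 11, f (Fin.cons x a) := by
  rw [← (Fin.consEquiv fun _ : Fin (m + 1) => Fin 11).sum_comp, Fintype.sum_prod_type]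
  rfl

/-- A sum over pairs of tuples which have `c` entries in common, by contraction of the last entry of
the first with the first entry of the second. -/
theorem smul_sum_eq_sum_contract [Module ℝ V] {m n c : ℕ}
    (f : (Fin (m + 1) → Fin 11) → (Fin (n + 1) → Fin 11) → V)
    (h₁ : ∀ s t i j, f (s ∘ Equiv.swap i j) t = f s t)
    (h₂ : ∀ s t i j, f s (t ∘ Equiv.swap i j) = f s t)
    (hc : ∀ s t, f s t ≠ 0 → ∑ b, mult s b * mult t b = c) :
    (c : ℝ) • ∑ s, ∑ t, f s t = ((m + 1 : ℕ) * (n + 1 : ℕ) : ℝ) •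
      ∑ a : Fin m → Fin 11, ∑ b : Fin n → Fin 11, ∑ x, f (Fin.snoc a x) (Fin.cons x b) := by
  -- The number c of common entries is the number of coincidences `s i = t j`.
  have h3 : ∀ s t, (c : ℝ) • f s t = ∑ i, ∑ j, if s i = t j then f s t else 0 := by
    intro s t
    by_cases h : f s t = 0
    · simp [h]
    · rw [← hc s t h, sum_mult_mul_mult]
      push_cast
      simp only [Finset.sum_smul, ite_smul, one_smul, zero_smul]
  -- By symmetry of f any coincidence can be moved to the last entry of s and the first of t, so all
  -- (m+1)(n+1) pairs contribute equally.
  have h4 : ∀ i j, ∑ s, ∑ t, (if s i = t j then f s t else 0) =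
      ∑ s, ∑ t, (if s (Fin.last m) = t 0 then f s t else 0) := by
    intro i j
    rw [← ((Equiv.swap i (Fin.last m)).arrowCongr (Equiv.refl (Fin 11))).sum_comp]
    refine Finset.sum_congr rfl fun s _ => ?_
    rw [← ((Equiv.swap j 0).arrowCongr (Equiv.refl (Fin 11))).sum_comp]
    refine Finset.sum_congr rfl fun t _ => ?_
    have e1 : (Equiv.swap i (Fin.last m)).arrowCongr (Equiv.refl (Fin 11)) s =
      s ∘ Equiv.swap i (Fin.last m) := rfl
    have e2 : (Equiv.swap j 0).arrowCongr (Equiv.refl (Fin 11)) t = t ∘ Equiv.swap j 0 := rfl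
    rw [e1, e2, h₁, h₂]
    simp
  have h5 : (c : ℝ) • ∑ s, ∑ t, f s t =
      ∑ i : Fin (m + 1), ∑ j : Fin (n + 1), ∑ s, ∑ t, (if s i = t j then f s t else 0) := by
    simp only [Finset.smul_sum, h3]
    rw [Finset.sum_comm_cycle]
    refine Finset.sum_congr rfl fun i _ => ?_
    rw [Finset.sum_comm_cycle]
  rw [h5]
  simp only [h4, Finset.sum_const, Finset.card_univ, Fintype.card_fin]
  rw [smul_smul, ← Nat.cast_smul_eq_nsmul ℝ, Nat.cast_mul]
  congr 1
  rw [sum_snoc]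
  refine Finset.sum_congr rfl fun a _ => ?_
  simp only [sum_cons (m := n), Fin.snoc_last, Fin.cons_zero]
  rw [Finset.sum_comm (γ := Fin n → Fin 11)]
  refine Finset.sum_congr rfl fun x _ => ?_
  rw [Finset.sum_eq_single x]
  · simp
  · intro y _ hy
    simp [hy.symm]
  · simp

end

/-! ### Reduction of the trace cubics to index contractions. -/

/-- The sum of the summands of `cubic` over the last index. -/
def cubicAux (M : MajoranaRep) {p q : ℕ} (r : ℕ) (s : Fin p → Fin 11) (t : Fin q → Fin 11) : CE :=
  ∑ c : Fin r → Fin 11, (M.gam s * M.gam t * M.gam c).trace • (form p s * form q t * form r c)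

theorem cubic_eq (M : MajoranaRep) (p q r : ℕ) :
    cubic M p q r = ∑ s : Fin p → Fin 11, ∑ t : Fin q → Fin 11, cubicAux M r s t := rfl

section

variable (M : MajoranaRep) {p q r : ℕ}

theorem cubicAux_comp_perm_left (s : Fin p → Fin 11) (t : Fin q → Fin 11)
    (σ : Equiv.Perm (Fin p)) : cubicAux M r (s ∘ σ) t = cubicAux M r s t := by
  simp only [cubicAux, M.gam_comp_perm, form_comp_perm, smul_mul_assoc, Matrix.trace_smul,
    smul_smul, smul_eq_mul]
  refine Finset.sum_congr rfl fun c _ => ?_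
  congr 1
  linear_combination (M.gam s * M.gam t * M.gam c).trace * sgn_mul_self σ

theorem cubicAux_comp_perm_right (s : Fin p → Fin 11) (t : Fin q → Fin 11)
    (σ : Equiv.Perm (Fin q)) : cubicAux M r s (t ∘ σ) = cubicAux M r s t := by
  simp only [cubicAux, M.gam_comp_perm, form_comp_perm, smul_mul_assoc, mul_smul_comm,
    Matrix.trace_smul, smul_smul, smul_eq_mul]
  refine Finset.sum_congr rfl fun c _ => ?_
  congr 1
  linear_combination (M.gam s * M.gam t * M.gam c).trace * sgn_mul_self σ

theorem exists_trace_ne_zero {s : Fin p → Fin 11} {t : Fin q → Fin 11}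
    (h : cubicAux M r s t ≠ 0) : ∃ c : Fin r → Fin 11, (M.gam s * M.gam t * M.gam c).trace ≠ 0 := by
  obtain ⟨c, -, hc⟩ := Finset.exists_ne_zero_of_sum_ne_zero h
  exact ⟨c, fun h0 => hc (by rw [h0, zero_smul])⟩

/-- The entries of c are the indices lying in exactly one of s and t. -/
theorem sum_mult_of_trace_ne_zero_of_even (h : Even (p + q + r)) {s : Fin p → Fin 11}
    {t : Fin q → Fin 11} {c : Fin r → Fin 11} (h0 : (M.gam s * M.gam t * M.gam c).trace ≠ 0) :
    2 * ∑ b, mult s b * mult t b + r = p + q := by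
  obtain ⟨hs, ht, hc, he⟩ := M.trace_gam_gam_gam h0
  have h1 : ∀ b, 2 * (mult s b * mult t b) + mult c b = mult s b + mult t b := fun b => by
    have h2 := he b
    have h3 := mult_le_one hs b
    have h4 := mult_le_one ht b
    have h5 := mult_le_one hc b
    rw [Nat.even_iff] at h2 h
    generalize mult s b = x at *
    generalize mult t b = y at *
    interval_cases x <;> interval_cases y <;> omega
  have h2 := Finset.sum_congr (rfl : (Finset.univ : Finset (Fin 11)) = _) fun b _ => h1 b
  rwa [Finset.sum_add_distrib, Finset.sum_add_distrib, sum_mult, sum_mult, sum_mult,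
    ← Finset.mul_sum] at h2

/-- Each of the eleven indices lies in exactly one or in all three of the tuples, and the indices
common to s and t are those in all three. -/
theorem sum_mult_of_trace_ne_zero_of_odd (h : Odd (p + q + r)) {s : Fin p → Fin 11}
    {t : Fin q → Fin 11} {c : Fin r → Fin 11} (h0 : (M.gam s * M.gam t * M.gam c).trace ≠ 0) :
    2 * ∑ b, mult s b * mult t b + 11 = p + q + r := by
  obtain ⟨hs, ht, hc, he⟩ := M.trace_gam_gam_gam h0
  have h1 : ∀ b, 2 * (mult s b * mult t b) + 1 = mult s b + mult t b + mult c b := fun b => by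
    have h2 := he b
    have h3 := mult_le_one hs b
    have h4 := mult_le_one ht b
    have h5 := mult_le_one hc b
    rw [Nat.even_iff] at h2
    rw [Nat.odd_iff] at h
    generalize mult s b = x at *
    generalize mult t b = y at *
    interval_cases x <;> interval_cases y <;> omega
  have h2 := Finset.sum_congr (rfl : (Finset.univ : Finset (Fin 11)) = _) fun b _ => h1 b
  simpa [Finset.sum_add_distrib, sum_mult, ← Finset.mul_sum] using h2

end

/-- The sum over the last index, for multi-indices with exactly one index in common. -/
theorem cubicAux_snoc_cons (M : MajoranaRep) {m n : ℕ} (a : Fin m → Fin 11) (x : Fin 11)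
    (b : Fin n → Fin 11) :
    cubicAux M (n + m) (Fin.snoc a x : Fin (m + 1) → Fin 11) (Fin.cons x b : Fin (n + 1) → Fin 11) =
      (32 * ((n + m).factorial : ℝ) * (-1) ^ (n * (n - 1) / 2) * (-1) ^ (m * (m - 1) / 2) *
        (eta x * etas a * etas b)) •
      (form (m + 1) (Fin.snoc a x) * form (n + 1) (Fin.cons x b) *
        form (n + m) (Fin.append b a)) := by
  rw [cubicAux, sum_eq_factorial_smul (Fin.append b a)]
  · by_cases h : Function.Injective (Fin.snoc a x : Fin (m + 1) → Fin 11) ∧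
        Function.Injective (Fin.cons x b : Fin (n + 1) → Fin 11) ∧
        Function.Injective (Fin.append b a)
    · obtain ⟨h1, h2, h3⟩ := h
      have ha : Function.Injective a := fun i j hij => by
        have := @h1 i.castSucc j.castSucc (by simpa using hij)
        exact Fin.castSucc_injective _ this
      have hb : Function.Injective b := fun i j hij => by
        have := @h2 i.succ j.succ (by simpa using hij)
        exact Fin.succ_injective _ this
      rw [smul_smul]
      congr 1
      rw [M.gam_of_injective h1, M.gam_of_injective h2, M.gam_of_injective h3, M.word_snoc,
        M.word_cons, M.word_append]
      -- The word (Γ_a Γ_x)(Γ_x Γ_b)(Γ_b Γ_a) collapses from the inside to a multiple of the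
      -- identity.
      have e : M.word a * M.Γ x * (M.Γ x * M.word b) * (M.word b * M.word a) =
          M.word a * (M.Γ x * M.Γ x) * (M.word b * M.word b) * M.word a := by
        simp only [mul_assoc]
      rw [e, M.Γ_sq, M.word_mul_self hb]
      simp only [mul_smul_comm, smul_mul_assoc, mul_one, M.word_mul_self ha, Matrix.trace_smul,
        Matrix.trace_one, smul_eq_mul, Fintype.card_fin]
      push_cast
      ring
    · have h0 : form (m + 1) (Fin.snoc a x) * form (n + 1) (Fin.cons x b) *
          form (n + m) (Fin.append b a) = 0 := by
        by_cases h1 : Function.Injective (Fin.snoc a x : Fin (m + 1) → Fin 11)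
        · by_cases h2 : Function.Injective (Fin.cons x b : Fin (n + 1) → Fin 11)
          · rw [form_eq_zero (a := Fin.append b a) fun h3 => h ⟨h1, h2, h3⟩, mul_zero]
          · rw [form_eq_zero h2, mul_zero, zero_mul]
        · rw [form_eq_zero h1, zero_mul, zero_mul]
      simp only [h0, smul_zero]
  · intro σ
    rw [M.gam_comp_perm, form_comp_perm, mul_smul_comm, mul_smul_comm, Matrix.trace_smul,
      smul_smul, smul_eq_mul]
    congr 1
    linear_combination (M.gam (Fin.snoc a x : Fin (m + 1) → Fin 11) *
      M.gam (Fin.cons x b : Fin (n + 1) → Fin 11) * M.gam (Fin.append b a)).trace * sgn_mul_self σ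
  -- A nonzero trace forces the third tuple to consist of the entries of a and b: an index that
  -- occurs in neither would violate the parity rule.
  · intro r hr
    have h0 : (M.gam (Fin.snoc a x : Fin (m + 1) → Fin 11) *
      M.gam (Fin.cons x b : Fin (n + 1) → Fin 11) * M.gam r).trace ≠ 0 := fun h => hr (by
        rw [h, zero_smul])
    obtain ⟨-, -, hri, he⟩ := M.trace_gam_gam_gam h0
    refine ⟨hri, fun i => ?_⟩
    have h1 := he (r i)
    rw [mult_snoc, mult_cons] at h1
    have h2 : mult r (r i) = 1 :=
      le_antisymm (mult_le_one hri _) (Nat.one_le_iff_ne_zero.2 (mult_apply_ne_zero r i))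
    rw [h2, Nat.even_iff] at h1
    have h3 : mult a (r i) ≠ 0 ∨ mult b (r i) ≠ 0 := by
      by_contra hcon
      push Not at hcon
      rw [hcon.1, hcon.2] at h1
      omega
    rcases h3 with h3 | h3
    · obtain ⟨j, hj⟩ := exists_eq_of_mult_ne_zero h3
      exact ⟨Fin.natAdd n j, by simpa using hj⟩
    · obtain ⟨j, hj⟩ := exists_eq_of_mult_ne_zero h3
      exact ⟨Fin.castAdd m j, by simpa using hj⟩

/-- With lengths m+1, n+1, n+m the first two tuples share exactly one index. Contracting it fixes
the third tuple up to order, whence the factor (n+m)!. -/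
theorem cubic_even (M : MajoranaRep) (m n : ℕ) :
    cubic M (m + 1) (n + 1) (n + m) =
      (32 * ((m + 1 : ℕ) * (n + 1 : ℕ)) * ((n + m).factorial : ℝ) * (-1) ^ (n * (n - 1) / 2) *
        (-1) ^ (m * (m - 1) / 2)) •
      ∑ a : Fin m → Fin 11, ∑ b : Fin n → Fin 11, ∑ x,
        (eta x * etas a * etas b) • (form (m + 1) (Fin.snoc a x) * form (n + 1) (Fin.cons x b) *
          form (n + m) (Fin.append b a)) := by
  have h := smul_sum_eq_sum_contract (c := 1)
    (fun (s : Fin (m + 1) → Fin 11) (t : Fin (n + 1) → Fin 11) => cubicAux M (n + m) s t)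
    (fun s t i j => cubicAux_comp_perm_left M s t _)
    (fun s t i j => cubicAux_comp_perm_right M s t _) (fun s t hst => by
      obtain ⟨c, hc⟩ := exists_trace_ne_zero M hst
      have := sum_mult_of_trace_ne_zero_of_even M ⟨m + n + 1, by ring⟩ hc
      omega)
  rw [Nat.cast_one, one_smul] at h
  rw [cubic_eq, h]
  simp only [cubicAux_snoc_cons, Finset.smul_sum, smul_smul]
  refine Finset.sum_congr rfl fun a _ => Finset.sum_congr rfl fun b _ =>
    Finset.sum_congr rfl fun x _ => ?_
  congr 1
  ring

/-- The first two tuples share (15 − 11)/2 = 2 indices. Contracting twice gives 5·5/2 · 4·4 = 200.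
-/
theorem cubic_five_five_five (M : MajoranaRep) :
    cubic M 5 5 5 = (200 : ℝ) • ∑ a : Fin 3 → Fin 11, ∑ b : Fin 3 → Fin 11, ∑ y, ∑ x,
      cubicAux M 5 (Fin.snoc (Fin.snoc a y : Fin 4 → Fin 11) x : Fin 5 → Fin 11)
        (Fin.cons x (Fin.cons y b : Fin 4 → Fin 11) : Fin 5 → Fin 11) := by
  have h := smul_sum_eq_sum_contract (c := 2)
    (fun (s : Fin 5 → Fin 11) (t : Fin 5 → Fin 11) => cubicAux M 5 s t)
    (fun s t i j => cubicAux_comp_perm_left M s t _)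
    (fun s t i j => cubicAux_comp_perm_right M s t _) (fun s t hst => by
      obtain ⟨c, hc⟩ := exists_trace_ne_zero M hst
      have := sum_mult_of_trace_ne_zero_of_odd M (by decide) hc
      omega)
  -- Once the index x is contracted, exactly one common index is left, so c = 1 here.
  have h' : ∀ x, _ := fun x => smul_sum_eq_sum_contract (c := 1)
    (fun (s : Fin 4 → Fin 11) (t : Fin 4 → Fin 11) => cubicAux M 5
      (Fin.snoc s x : Fin 5 → Fin 11) (Fin.cons x t : Fin 5 → Fin 11))
    (fun s t i j => by rw [snoc_comp_swap, cubicAux_comp_perm_left])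
    (fun s t i j => by rw [cons_comp_swap, cubicAux_comp_perm_right]) (fun s t hst => by
      obtain ⟨c, hc⟩ := exists_trace_ne_zero M hst
      have h1 := sum_mult_of_trace_ne_zero_of_odd M (by decide) hc
      obtain ⟨hs, ht, -, -⟩ := M.trace_gam_gam_gam hc
      have h2 := mult_le_one hs x
      have h3 := mult_le_one ht x
      simp only [mult_snoc, mult_cons, add_mul, mul_add, Finset.sum_add_distrib] at h1 h2 h3
      simp at h1 h2 h3
      omega)
  simp only [Nat.cast_one, one_smul] at h'
  have h2 : (2 : ℝ) • cubic M 5 5 5 = (2 : ℝ) • (200 : ℝ) • ∑ a : Fin 3 → Fin 11,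
      ∑ b : Fin 3 → Fin 11, ∑ y, ∑ x,
      cubicAux M 5 (Fin.snoc (Fin.snoc a y : Fin 4 → Fin 11) x : Fin 5 → Fin 11)
        (Fin.cons x (Fin.cons y b : Fin 4 → Fin 11) : Fin 5 → Fin 11) := by
    have h3 : (∑ a : Fin 4 → Fin 11, ∑ b : Fin 4 → Fin 11, ∑ x,
        cubicAux M 5 (Fin.snoc a x : Fin 5 → Fin 11) (Fin.cons x b : Fin 5 → Fin 11)) =
        (16 : ℝ) • ∑ a : Fin 3 → Fin 11, ∑ b : Fin 3 → Fin 11, ∑ y, ∑ x,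
      cubicAux M 5 (Fin.snoc (Fin.snoc a y : Fin 4 → Fin 11) x : Fin 5 → Fin 11)
        (Fin.cons x (Fin.cons y b : Fin 4 → Fin 11) : Fin 5 → Fin 11) := by
      rw [Finset.sum_comm_cycle]
      simp only [h', Finset.smul_sum]
      rw [← Finset.sum_comm_cycle]
      refine Finset.sum_congr rfl fun a _ => Finset.sum_congr rfl fun b _ => ?_
      rw [Finset.sum_comm]
      norm_num
    rw [cubic_eq]
    rw [Nat.cast_ofNat] at h
    rw [h, h3, smul_smul, smul_smul]
    norm_num
  exact smul_right_injective _ (two_ne_zero (α := ℝ)) h2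

/-! ### The cubic terms of the ansatz as traces -/

theorem sum_fin_one {V : Type*} [AddCommGroup V] (f : (Fin 1 → Fin 11) → V) :
    ∑ a, f a = ∑ x, f ![x] := by
  rw [sum_cons]
  simp only [Finset.univ_unique, Finset.sum_singleton]
  refine Finset.sum_congr rfl fun x _ => congrArg f ?_
  funext i
  fin_cases i
  rfl

theorem sum_fin_two {V : Type*} [AddCommGroup V] (f : (Fin 2 → Fin 11) → V) :
    ∑ a, f a = ∑ x, ∑ y, f ![x, y] := by
  rw [sum_cons]
  simp only [sum_fin_one]
  rfl

theorem etas_one (a : Fin 1 → Fin 11) : etas a = eta (a 0) := by simp [etas]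

theorem etas_pair (a b : Fin 11) : etas ![a, b] = eta a * eta b := by simp [etas]

theorem etas_cons {p : ℕ} (x : Fin 11) (a : Fin p → Fin 11) :
    etas (Fin.cons x a : Fin (p + 1) → Fin 11) = eta x * etas a := by
  simp [etas_succ]

theorem form_one (a : Fin 1 → Fin 11) : form 1 a = e₁ (a 0) := rfl

theorem form_two (a : Fin 2 → Fin 11) : form 2 a = etas a • e₂ a := rfl

theorem form_five (a : Fin 5 → Fin 11) : form 5 a = etas a • e₅ a := rfl

theorem e₁_mul_e₁ (a b : Fin 11) : e₁ a * e₁ b = -(e₁ b * e₁ a) :=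
  form_mul_form (p := 1) (q := 1) ![a] ![b]

/-- The contraction produces e_{ax} e^x e^a; restoring the order of the last two factors gives the
minus sign. -/
theorem cubic_two_one_one (M : MajoranaRep) :
    cubic M 2 1 1 = (-64 : ℝ) • ∑ a₁, ∑ a₂, e₂ ![a₁, a₂] * e₁ a₁ * e₁ a₂ := by
  refine (cubic_even M 1 0).trans ?_
  simp only [sum_fin_one, Finset.univ_unique, Finset.sum_singleton, Finset.smul_sum]
  refine Finset.sum_congr rfl fun a _ => Finset.sum_congr rfl fun x _ => ?_
  have h1 : (Fin.snoc ![a] x : Fin 2 → Fin 11) = ![a, x] := by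
    funext i; fin_cases i <;> rfl
  have h2 : ∀ c : Fin 0 → Fin 11, (Fin.append c ![a] : Fin (0 + 1) → Fin 11) = ![a] := fun c => by
    funext i; fin_cases i; rfl
  have h3 : ∀ c : Fin 0 → Fin 11, form (0 + 1) (Fin.append c ![a]) = e₁ a := fun c => by
    rw [h2]; rfl
  have h4 : ∀ c : Fin 0 → Fin 11, form (0 + 1) (Fin.cons x c) = e₁ x := fun c => rfl
  have h5 : form (1 + 1) (Fin.snoc ![a] x) = (eta a * eta x) • e₂ ![a, x] := by
    rw [← etas_pair, ← h1]; rfl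
  have h8 : e₂ ![a, x] * e₁ a * e₁ x = -(e₂ ![a, x] * e₁ x * e₁ a) := by
    rw [mul_assoc, e₁_mul_e₁ a, mul_neg, mul_assoc]
  rw [h3, h4, h5, h8, smul_mul_assoc, smul_mul_assoc, smul_smul, smul_smul, smul_neg, ← neg_smul]
  congr 1
  simp only [etas_one, Matrix.cons_val_zero]
  have h6 := eta_mul_self a
  have h7 := eta_mul_self x
  have h9 : ∀ c : Fin 0 → Fin 11, etas c = 1 := fun c => by simp [etas]
  simp only [h9]
  have h10 : eta x * eta a * 1 * (eta a * eta x) = 1 := by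
    linear_combination eta a * eta a * h7 + h6
  rw [mul_assoc _ (eta x * eta a * 1) (eta a * eta x), h10]
  norm_num [Nat.factorial]

theorem cubic_two_two_two (M : MajoranaRep) :
    cubic M 2 2 2 = (256 : ℝ) • ∑ a₁, ∑ a₂, ∑ a₃,
      (eta a₁ • e₂ ![a₁, a₂]) * (eta a₂ • e₂ ![a₂, a₃]) * (eta a₃ • e₂ ![a₃, a₁]) := by
  refine (cubic_even M 1 1).trans ?_
  simp only [sum_fin_one, Finset.smul_sum]
  refine Finset.sum_congr rfl fun a _ => ?_
  rw [Finset.sum_comm]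
  refine Finset.sum_congr rfl fun x _ => Finset.sum_congr rfl fun b _ => ?_
  have h1 : form (1 + 1) (Fin.snoc ![a] x) = (eta a * eta x) • e₂ ![a, x] := by
    have h : (Fin.snoc ![a] x : Fin 2 → Fin 11) = ![a, x] := by
      funext i; fin_cases i <;> rfl
    rw [← etas_pair, ← h]; rfl
  have h2 : form (1 + 1) (Fin.cons x ![b]) = (eta x * eta b) • e₂ ![x, b] := by
    rw [← etas_pair]; rfl
  have h3 : form (1 + 1) (Fin.append ![b] ![a]) = (eta b * eta a) • e₂ ![b, a] := by
    have h : (Fin.append ![b] ![a] : Fin 2 → Fin 11) = ![b, a] := by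
      funext i; fin_cases i <;> rfl
    rw [← etas_pair, ← h]; rfl
  rw [h1, h2, h3]
  simp only [smul_mul_smul_comm, smul_smul]
  congr 1
  simp only [etas_one, Matrix.cons_val_zero]
  have h5 := eta_mul_self x
  have h6 := eta_mul_self a
  have h7 := eta_mul_self b
  norm_num [Nat.factorial]
  linear_combination eta x * eta a * eta b * (eta a * eta a * eta b * eta b * h5 +
    eta b * eta b * h6 + h7)

theorem cubic_five_two_five (M : MajoranaRep) :
    cubic M 5 2 5 = (38400 : ℝ) • ∑ a : Fin 4 → Fin 11, ∑ b₁, ∑ b₂,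
      e₅up (Fin.snoc a b₁) * (eta b₂ • e₂ ![b₁, b₂]) * e₅ (Fin.cons b₂ a) := by
  refine (cubic_even M 4 1).trans ?_
  simp only [sum_fin_one, Finset.smul_sum]
  refine Finset.sum_congr rfl fun a _ => ?_
  rw [Finset.sum_comm]
  refine Finset.sum_congr rfl fun x _ => Finset.sum_congr rfl fun b _ => ?_
  have h1 : form (4 + 1) (Fin.snoc a x) = e₅up (Fin.snoc a x) := rfl
  have h2 : form (1 + 1) (Fin.cons x ![b]) = (eta x * eta b) • e₂ ![x, b] := by
    rw [← etas_pair]; rfl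
  have h3 : form (1 + 4) (Fin.append ![b] a) = (eta b * etas a) • e₅ (Fin.cons b a) := by
    have h : (Fin.append ![b] a : Fin 5 → Fin 11) = Fin.cons b a := by
      funext i; fin_cases i <;> rfl
    rw [← etas_cons, ← h]; rfl
  rw [h1, h2, h3]
  simp only [smul_smul, mul_smul_comm, smul_mul_assoc]
  congr 1
  simp only [etas_one, Matrix.cons_val_zero]
  have h5 := eta_mul_self x
  have h6 := etas_mul_self a
  have h7 := eta_mul_self b
  norm_num [Nat.factorial]
  linear_combination eta b * (eta b * eta b * etas a * etas a * h5 +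
    eta b * eta b * h6 + h7)

/-- No contraction is needed: the trace of an eleven-letter word is 32 ε. -/
theorem cubic_five_five_one (M : MajoranaRep) :
    cubic M 5 5 1 = (32 : ℝ) • ∑ a : Fin 5 → Fin 11, ∑ b : Fin 5 → Fin 11, ∑ c : Fin 11,
      leviCivita (Fin.append (Fin.append a b) ![c]) • (e₅up a * e₅up b * e₁ c) := by
  simp only [cubic, sum_fin_one, Finset.smul_sum]
  refine Finset.sum_congr rfl fun a _ => Finset.sum_congr rfl fun b _ =>
    Finset.sum_congr rfl fun c _ => ?_
  have h1 : form 5 a * form 5 b * form 1 ![c] = e₅up a * e₅up b * e₁ c := rfl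
  rw [h1, smul_smul, ← M.trace_word_eleven, M.word_append, M.word_append]
  by_cases ha : Function.Injective a
  · by_cases hb : Function.Injective b
    · rw [M.gam_of_injective ha, M.gam_of_injective hb,
        M.gam_of_injective (Function.injective_of_subsingleton ![c])]
    · have : e₅up b = 0 := form_eq_zero (p := 5) hb
      simp [this]
  · have : e₅up a = 0 := form_eq_zero (p := 5) ha
    simp [this]

/-- Here 6400 = 200 · 32. The sign arises because the contracted pair d₁d₂ stands in the same order
in both factors of the ansatz, but in opposite orders after the successive contractions. -/
theorem cubic_five_five_five' (M : MajoranaRep) :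
    cubic M 5 5 5 = (-6400 : ℝ) • ∑ a : Fin 3 → Fin 11, ∑ b : Fin 3 → Fin 11,
      ∑ c : Fin 5 → Fin 11, ∑ d : Fin 2 → Fin 11,
        leviCivita (Fin.append (Fin.append a b) c) •
          (e₅up (Fin.append a d) * (etas b • e₅ (Fin.append d b)) * e₅up c) := by
  rw [cubic_five_five_five]
  simp only [cubicAux, sum_fin_two, Finset.smul_sum]
  refine Finset.sum_congr rfl fun a _ => Finset.sum_congr rfl fun b _ => ?_
  rw [Finset.sum_comm_cycle]
  refine Finset.sum_congr rfl fun c _ => Finset.sum_congr rfl fun y _ =>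
    Finset.sum_congr rfl fun x _ => ?_
  have h1 : (Fin.append a ![y, x] : Fin 5 → Fin 11) =
      Fin.snoc (Fin.snoc a y : Fin 4 → Fin 11) x := by
    funext i; fin_cases i <;> rfl
  have h2 : (Fin.append ![y, x] b : Fin 5 → Fin 11) =
      (Fin.cons x (Fin.cons y b : Fin 4 → Fin 11) : Fin 5 → Fin 11) ∘ Equiv.swap 0 1 := by
    funext i; fin_cases i <;> rfl
  set s : Fin 5 → Fin 11 := Fin.snoc (Fin.snoc a y : Fin 4 → Fin 11) x with hs
  set t : Fin 5 → Fin 11 := Fin.cons x (Fin.cons y b : Fin 4 → Fin 11) with ht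
  have h3 : etas b • e₅ (t ∘ Equiv.swap 0 1) = -((eta x * eta y) • form 5 t) := by
    have h4 : e₅ (t ∘ Equiv.swap 0 1) = -e₅ t := by
      have := gen_skew₅ t (Equiv.swap 0 1)
      rwa [sgn_swap (by decide), neg_one_smul] at this
    rw [h4, form_five, smul_smul, smul_neg, ht, etas_cons, etas_cons]
    congr 2
    linear_combination -(etas b) * (eta y * eta y * eta_mul_self x + eta_mul_self y)
  rw [h1, h2, h3]
  have h5 : e₅up s = form 5 s := rfl
  have h6 : e₅up c = form 5 c := rfl
  rw [h5, h6]
  by_cases hsi : Function.Injective s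
  swap
  · simp [form_eq_zero hsi]
  by_cases hti : Function.Injective t
  swap
  · simp [form_eq_zero hti]
  by_cases hci : Function.Injective c
  swap
  · simp [form_eq_zero hci]
  have h7 : (M.gam s * M.gam t * M.gam c).trace =
      eta x * eta y * (32 * leviCivita (Fin.append (Fin.append a b) c)) := by
    rw [← M.trace_word_eleven, M.gam_of_injective hsi, M.gam_of_injective hti,
      M.gam_of_injective hci, hs, ht, M.word_snoc, M.word_snoc, M.word_cons, M.word_cons,
      M.word_append, M.word_append]
    have e : M.word a * M.Γ y * M.Γ x * (M.Γ x * (M.Γ y * M.word b)) * M.word c =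
        M.word a * (M.Γ y * (M.Γ x * M.Γ x) * M.Γ y) * M.word b * M.word c := by
      simp only [mul_assoc]
    rw [e, M.Γ_sq, mul_smul_comm, mul_one, smul_mul_assoc, M.Γ_sq, smul_smul]
    simp only [mul_smul_comm, smul_mul_assoc, mul_one, Matrix.trace_smul, smul_eq_mul]
  rw [h7]
  simp only [mul_neg, neg_mul, mul_smul_comm, smul_mul_assoc, smul_smul, ← neg_smul]
  congr 1
  ring

/-! ### Cubic Fierz identities -/

/-- The Minkowski metric. -/
def metric (a b : Fin 11) : ℝ := if a = b then eta a else 0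

theorem metric_comm (a b : Fin 11) : metric a b = metric b a := by
  unfold metric
  by_cases h : a = b
  · rw [h]
  · rw [if_neg h, if_neg (Ne.symm h)]

theorem sum_metric_smul {V : Type*} [AddCommGroup V] [Module ℝ V] (a : Fin 11)
    (f : Fin 11 → V) : ∑ b, metric a b • f b = eta a • f a := by
  simp [metric, ite_smul]

namespace MajoranaRep

variable (M : MajoranaRep)

theorem Γ_mul_Γ (a b : Fin 11) :
    M.Γ a * M.Γ b = (2 * metric a b) • 1 - M.Γ b * M.Γ a :=
  eq_sub_of_add_eq (M.clifford a b)

theorem gam_pair' (a b : Fin 11) : M.gam ![a, b] = M.Γ a * M.Γ b - metric a b • 1 :=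
  M.gam_pair a b

theorem gam_pair_swap (a b : Fin 11) : M.gam ![a, b] = metric a b • 1 - M.Γ b * M.Γ a := by
  rw [gam_pair', Γ_mul_Γ]
  module

theorem Γ_mul_gam_pair (c a b : Fin 11) :
    M.Γ c * M.gam ![a, b] = M.gam ![a, b] * M.Γ c +
      ((2 * metric c a) • M.Γ b - (2 * metric c b) • M.Γ a) := by
  rw [gam_pair', mul_sub, sub_mul, ← mul_assoc, M.Γ_mul_Γ c a, sub_mul, mul_assoc _ (M.Γ c),
    M.Γ_mul_Γ c b, mul_sub]
  simp only [smul_mul_assoc, mul_smul_comm, one_mul, mul_one, mul_assoc]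
  module

/-- The p indices of a contribute −(−1)^p each and the 11 − p others contribute (−1)^p each. -/
theorem sum_Γ_mul_gam_mul_Γ {p : ℕ} (a : Fin p → Fin 11) :
    ∑ b, eta b • (M.Γ b * M.gam a * M.Γ b) = ((-1 : ℝ) ^ p * (11 - 2 * p)) • M.gam a := by
  by_cases ha : Function.Injective a
  · have h : ∀ b, eta b • (M.Γ b * M.gam a * M.Γ b) =
        ((-1 : ℝ) ^ p * (1 - 2 * (mult a b : ℝ))) • M.gam a := by
      intro b
      rw [Γ_mul_gam, smul_mul_assoc, mul_assoc, Γ_sq, mul_smul_comm, mul_one, smul_smul, smul_smul,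
        pow_add]
      congr 1
      have h1 : (-1 : ℝ) ^ mult a b = 1 - 2 * (mult a b : ℝ) := by
        have := mult_le_one ha b
        interval_cases mult a b <;> norm_num
      rw [h1]
      linear_combination ((-1 : ℝ) ^ p * (1 - 2 * (mult a b : ℝ))) * eta_mul_self b
    rw [Finset.sum_congr rfl fun b _ => h b, ← Finset.sum_smul, ← Finset.mul_sum,
      Finset.sum_sub_distrib, ← Finset.mul_sum, ← Nat.cast_sum, sum_mult]
    simp
  · simp [M.gam_of_not_injective ha]

end MajoranaRep

/-- `± (ψ̄ Γ^a ψ)(ψ̄ Γ_a χ)`, for multi-indices `a` of length `p`. -/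
def fierzTerm (M : MajoranaRep) (χ : Fin 32 → CE) (p : ℕ) : CE :=
  kappa p • ∑ a : Fin p → Fin 11, etas a • (quadForm M (M.gam a) * pairing M χ (M.gam a))

theorem fierzTerm_one (M : MajoranaRep) (χ : Fin 32 → CE) :
    fierzTerm M χ 1 = ∑ a, eta a • (quadForm M (M.Γ a) * pairing M χ (M.Γ a)) := by
  simp only [fierzTerm, kappa, one_smul, sum_fin_one, M.gam_one, etas_one, Matrix.cons_val_zero]

/-- The Fierz rearrangement with N = R = 1, whose left-hand side vanishes because (ψ̄ ψ) = 0. -/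
theorem sum_fierzTerm (M : MajoranaRep) (χ : Fin 32 → CE) :
    fierzTerm M χ 1 + (1 / 2 : ℝ) • fierzTerm M χ 2 + (1 / 120 : ℝ) • fierzTerm M χ 5 = 0 := by
  have h := quadForm_mul_pairing M 1 1 χ
  simp only [quadForm_one, zero_mul, smul_zero, one_mul, mul_one] at h
  rw [Finset.sum_insert (by decide), Finset.sum_insert (by decide), Finset.sum_singleton] at h
  rw [h]
  simp only [fierzTerm, smul_smul, add_assoc]
  norm_num [Nat.factorial, kappa]

/-- The Fierz rearrangement with N = Γ_b and R = Γ^b, summed over b; `sum_Γ_mul_gam_mul_Γ` gives the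
coefficients. -/
theorem smul_fierzTerm_one (M : MajoranaRep) (χ : Fin 32 → CE) :
    (32 : ℝ) • fierzTerm M χ 1 =
      (-9 : ℝ) • fierzTerm M χ 1 + (7 / 2 : ℝ) • fierzTerm M χ 2 -
        (1 / 120 : ℝ) • fierzTerm M χ 5 := by
  have h : (32 : ℝ) • fierzTerm M χ 1 = ∑ p ∈ ({1, 2, 5} : Finset ℕ),
      ((-1 : ℝ) ^ p * (11 - 2 * p) / p.factorial) • fierzTerm M χ p := by
    have h1 : ∀ b, (32 : ℝ) • (eta b • (quadForm M (M.Γ b) * pairing M χ (M.Γ b))) =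
        ∑ p ∈ ({1, 2, 5} : Finset ℕ), (kappa p / p.factorial) • ∑ a : Fin p → Fin 11,
        etas a • (quadForm M (M.gam a) * eta b • pairing M χ (M.Γ b * M.gam a * M.Γ b)) := by
      intro b
      rw [smul_comm, quadForm_mul_pairing, Finset.smul_sum]
      refine Finset.sum_congr rfl fun p _ => ?_
      rw [smul_comm, Finset.smul_sum]
      congr 1
      refine Finset.sum_congr rfl fun a _ => ?_
      rw [smul_comm, mul_smul_comm]
    rw [fierzTerm_one, Finset.smul_sum, Finset.sum_congr rfl fun b _ => h1 b, Finset.sum_comm]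
    refine Finset.sum_congr rfl fun p _ => ?_
    have h2 : ((-1 : ℝ) ^ p * (11 - 2 * p) / p.factorial) * kappa p =
        (kappa p / p.factorial) * ((-1 : ℝ) ^ p * (11 - 2 * p)) := by ring
    rw [← Finset.smul_sum, Finset.sum_comm, fierzTerm, smul_smul, h2, mul_smul]
    congr 1
    rw [Finset.smul_sum]
    refine Finset.sum_congr rfl fun a _ => ?_
    rw [← Finset.smul_sum, ← Finset.mul_sum]
    simp only [← map_smul]
    rw [← map_sum, M.sum_Γ_mul_gam_mul_Γ, map_smul, mul_smul_comm, smul_comm]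
  rw [Finset.sum_insert (by decide), Finset.sum_insert (by decide), Finset.sum_singleton] at h
  rw [h]
  norm_num [Nat.factorial]
  module

/-- The two preceding relations among three quantities leave a single one. This is why d P₃ has only
one sector with φ. -/
theorem fierzTerm_two (M : MajoranaRep) (χ : Fin 32 → CE) :
    fierzTerm M χ 2 = (10 : ℝ) • fierzTerm M χ 1 := by
  have h1 := sum_fierzTerm M χ
  have h2 := smul_fierzTerm_one M χ
  linear_combination (norm := module) (1 / 4 : ℝ) • h1 - (1 / 4 : ℝ) • h2

theorem fierzTerm_five (M : MajoranaRep) (χ : Fin 32 → CE) :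
    fierzTerm M χ 5 = (-720 : ℝ) • fierzTerm M χ 1 := by
  have h1 := sum_fierzTerm M χ
  have h2 := fierzTerm_two M χ
  linear_combination (norm := module) (120 : ℝ) • h1 - (60 : ℝ) • h2

/-- The summands in the Fierz expansion of `(ψ̄ Γ_c ψ)(ψ̄ χ)`. -/
def fierzVec (M : MajoranaRep) (χ : Fin 32 → CE) (c : Fin 11) (p : ℕ) : CE :=
  (kappa p / p.factorial) • ∑ a : Fin p → Fin 11,
    etas a • (quadForm M (M.gam a) * pairing M χ (M.Γ c * M.gam a))

/-- `(ψ̄ Γ_c{}^b ψ)(ψ̄ Γ_b χ)` -/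
def membraneTerm (M : MajoranaRep) (χ : Fin 32 → CE) (c : Fin 11) : CE :=
  ∑ b, eta b • (quadForm M (M.gam ![c, b]) * pairing M χ (M.Γ b))

theorem membraneTerm_eq (M : MajoranaRep) (χ : Fin 32 → CE) (c : Fin 11) :
    membraneTerm M χ c = ∑ b, eta b • (quadForm M (M.Γ c * M.Γ b) * pairing M χ (M.Γ b)) := by
  simp only [membraneTerm, M.gam_pair', map_sub, map_smul, quadForm_one, smul_zero, sub_zero]

theorem fierzTerm_act_one (M : MajoranaRep) (χ : Fin 32 → CE) (c : Fin 11) :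
    fierzTerm M (act (M.Γ c) χ) 1 = ∑ b, eta b • (quadForm M (M.Γ b) * pairing M χ (M.Γ b * M.Γ
        c)) := by
  simp only [fierzTerm_one, pairing_act]

theorem fierzVec_sum (M : MajoranaRep) (χ : Fin 32 → CE) (c : Fin 11) :
    (32 : ℝ) • (quadForm M (M.Γ c) * pairing M χ 1) =
      fierzVec M χ c 1 + fierzVec M χ c 2 + fierzVec M χ c 5 := by
  rw [quadForm_mul_pairing]
  rw [Finset.sum_insert (by decide), Finset.sum_insert (by decide), Finset.sum_singleton]
  simp only [fierzVec, mul_one, add_assoc]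

theorem smul_membraneTerm (M : MajoranaRep) (χ : Fin 32 → CE) (c : Fin 11) :
    (32 : ℝ) • membraneTerm M χ c = (-9 : ℝ) • fierzVec M χ c 1 + (7 : ℝ) • fierzVec M χ c 2 -
      fierzVec M χ c 5 := by
  have h : (32 : ℝ) • membraneTerm M χ c = ∑ p ∈ ({1, 2, 5} : Finset ℕ),
      ((-1 : ℝ) ^ p * (11 - 2 * p)) • fierzVec M χ c p := by
    have h1 : ∀ b, (32 : ℝ) • (eta b • (quadForm M (M.Γ c * M.Γ b) * pairing M χ (M.Γ b))) =
        ∑ p ∈ ({1, 2, 5} : Finset ℕ), (kappa p / p.factorial) • ∑ a : Fin p → Fin 11,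
        etas a • (quadForm M (M.gam a) *
          pairing M χ (M.Γ c * (eta b • (M.Γ b * M.gam a * M.Γ b)))) := by
      intro b
      rw [smul_comm, quadForm_mul_pairing, Finset.smul_sum]
      refine Finset.sum_congr rfl fun p _ => ?_
      rw [smul_comm, Finset.smul_sum]
      congr 1
      refine Finset.sum_congr rfl fun a _ => ?_
      rw [smul_comm, mul_smul_comm, map_smul, mul_smul_comm]
      simp only [mul_assoc]
    rw [membraneTerm_eq, Finset.smul_sum, Finset.sum_congr rfl fun b _ => h1 b, Finset.sum_comm]
    refine Finset.sum_congr rfl fun p _ => ?_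
    rw [← Finset.smul_sum, Finset.sum_comm, fierzVec, smul_comm]
    congr 1
    rw [Finset.smul_sum]
    refine Finset.sum_congr rfl fun a _ => ?_
    rw [← Finset.smul_sum, ← Finset.mul_sum, ← map_sum, ← Finset.mul_sum,
      M.sum_Γ_mul_gam_mul_Γ, mul_smul_comm, map_smul, mul_smul_comm, smul_comm]
  rw [Finset.sum_insert (by decide), Finset.sum_insert (by decide), Finset.sum_singleton] at h
  rw [h]
  norm_num
  module

/-- Moving Γ_c to the right of Γ_b turns χ into Γ_c χ and leaves one metric contraction. -/
theorem fierzVec_one (M : MajoranaRep) (χ : Fin 32 → CE) (c : Fin 11) :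
    fierzVec M χ c 1 = (2 : ℝ) • (quadForm M (M.Γ c) * pairing M χ 1) -
      fierzTerm M (act (M.Γ c) χ) 1 := by
  have h : ∀ b, eta b • (quadForm M (M.Γ b) * pairing M χ (M.Γ c * M.Γ b)) =
      metric c b • ((2 * eta b) • (quadForm M (M.Γ b) * pairing M χ 1)) -
        eta b • (quadForm M (M.Γ b) * pairing M χ (M.Γ b * M.Γ c)) := by
    intro b
    rw [M.Γ_mul_Γ c, map_sub, map_smul, mul_sub, mul_smul_comm]
    module
  have h0 : fierzVec M χ c 1 =
      ∑ b, eta b • (quadForm M (M.Γ b) * pairing M χ (M.Γ c * M.Γ b)) := by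
    simp only [fierzVec, sum_fin_one, M.gam_one, etas_one, Matrix.cons_val_zero]
    simp [kappa]
  rw [h0, Finset.sum_congr rfl fun b _ => h b, Finset.sum_sub_distrib, sum_metric_smul, ←
      fierzTerm_act_one,
    smul_smul, mul_left_comm, eta_mul_self, mul_one]

/-- Γ_c is moved to the right of Γ_{xy}. The reordered term is of `fierzTerm` type for Γ_c χ and
grade 2, reduced to grade 1 by `fierzTerm_two`; the two terms of the commutator give equal multiples
of `membraneTerm`. -/
theorem fierzVec_two (M : MajoranaRep) (χ : Fin 32 → CE) (c : Fin 11) :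
    fierzVec M χ c 2 = (5 : ℝ) • fierzTerm M (act (M.Γ c) χ) 1 -
      (2 : ℝ) • membraneTerm M χ c := by
  have h2 := fierzTerm_two M (act (M.Γ c) χ)
  rw [fierzTerm] at h2
  simp only [pairing_act, sum_fin_two, etas_pair] at h2
  have h : ∀ x y, (eta x * eta y) •
      (quadForm M (M.gam ![x, y]) * pairing M χ (M.Γ c * M.gam ![x, y])) =
      (eta x * eta y) • (quadForm M (M.gam ![x, y]) * pairing M χ (M.gam ![x, y] * M.Γ c)) +
      (metric c x • ((2 * eta x * eta y) •
        (quadForm M (M.gam ![x, y]) * pairing M χ (M.Γ y))) -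
      metric c y • ((2 * eta x * eta y) •
        (quadForm M (M.gam ![x, y]) * pairing M χ (M.Γ x)))) := by
    intro x y
    rw [M.Γ_mul_gam_pair, map_add, map_sub, map_smul, map_smul, mul_add, mul_sub, mul_smul_comm,
      mul_smul_comm]
    module
  have h3 : ∑ x, ∑ y, metric c x • ((2 * eta x * eta y) •
        (quadForm M (M.gam ![x, y]) * pairing M χ (M.Γ y))) = (2 : ℝ) • membraneTerm M χ c := by
    rw [Finset.sum_congr rfl fun x _ => (Finset.smul_sum (r := metric c x)).symm, sum_metric_smul]
    rw [membraneTerm, Finset.smul_sum, Finset.smul_sum]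
    refine Finset.sum_congr rfl fun y _ => ?_
    rw [smul_smul, smul_smul]
    congr 1
    linear_combination 2 * eta y * eta_mul_self c
  have h4 : ∑ x, ∑ y, metric c y • ((2 * eta x * eta y) •
        (quadForm M (M.gam ![x, y]) * pairing M χ (M.Γ x))) = (-2 : ℝ) • membraneTerm M χ c := by
    simp only [sum_metric_smul]
    rw [membraneTerm, Finset.smul_sum]
    refine Finset.sum_congr rfl fun x _ => ?_
    have h5 : M.gam ![x, c] = -M.gam ![c, x] := by
      rw [M.gam_pair_swap, M.gam_pair', metric_comm, neg_sub]
    rw [h5, map_neg, neg_mul, smul_smul, smul_smul, smul_neg, ← neg_smul]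
    congr 1
    linear_combination -2 * eta x * eta_mul_self c
  have h6 : fierzVec M χ c 2 = (-1 / 2 : ℝ) • ∑ x, ∑ y, (eta x * eta y) •
      (quadForm M (M.gam ![x, y]) * pairing M χ (M.Γ c * M.gam ![x, y])) := by
    simp only [fierzVec, sum_fin_two, etas_pair]
    norm_num [kappa, Nat.factorial]
  rw [h6]
  simp only [h, Finset.sum_add_distrib, Finset.sum_sub_distrib, h3, h4]
  simp only [kappa] at h2
  linear_combination (norm := module) (1 / 2 : ℝ) • h2

theorem membrane_sum_eq (M : MajoranaRep) (χ : Fin 32 → CE) (c : Fin 11) :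
    ∑ b, eta b • (quadForm M (M.Γ b) * pairing M χ (M.gam ![c, b]) +
      quadForm M (M.gam ![c, b]) * pairing M χ (M.Γ b)) =
    quadForm M (M.Γ c) * pairing M χ 1 - fierzTerm M (act (M.Γ c) χ) 1 + membraneTerm M χ c := by
  have h : ∀ b, eta b • (quadForm M (M.Γ b) * pairing M χ (M.gam ![c, b]) +
      quadForm M (M.gam ![c, b]) * pairing M χ (M.Γ b)) =
      metric c b • (eta b • (quadForm M (M.Γ b) * pairing M χ 1)) -
      eta b • (quadForm M (M.Γ b) * pairing M χ (M.Γ b * M.Γ c)) +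
      eta b • (quadForm M (M.gam ![c, b]) * pairing M χ (M.Γ b)) := by
    intro b
    nth_rw 1 [M.gam_pair_swap c]
    rw [map_sub, map_smul, mul_sub, mul_smul_comm]
    module
  rw [Finset.sum_congr rfl fun b _ => h b, Finset.sum_add_distrib, Finset.sum_sub_distrib,
    sum_metric_smul, ← fierzTerm_act_one, ← membraneTerm, smul_smul, eta_mul_self, one_smul]

/-- The Fierz identity behind the closure of the membrane 4-form. -/
theorem membrane_fierz (M : MajoranaRep) (χ : Fin 32 → CE) (c : Fin 11) :
    ∑ b, eta b • (quadForm M (M.Γ b) * pairing M χ (M.gam ![c, b]) +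
      quadForm M (M.gam ![c, b]) * pairing M χ (M.Γ b)) = 0 := by
  have e1 := fierzVec_sum M χ c
  have e2 := smul_membraneTerm M χ c
  have e3 := fierzVec_one M χ c
  have e4 := fierzVec_two M χ c
  rw [membrane_sum_eq]
  generalize quadForm M (M.Γ c) * pairing M χ 1 = H at *
  generalize fierzTerm M (act (M.Γ c) χ) 1 = G at *
  -- In e1 + e2 the grade 5 part cancels; inserting e3 and e4 turns the sum into 48 times the
  -- required relation.
  linear_combination (norm := module) (1 / 48 : ℝ) • e1 + (1 / 48 : ℝ) • e2 -
    (1 / 6 : ℝ) • e3 + (1 / 6 : ℝ) • e4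

/-! ### The differential of the ansatz -/

theorem sum_eq_three {V : Type*} [AddCommGroup V] (f : ℕ → V) :
    ∑ r ∈ ({1, 2, 5} : Finset ℕ), f r = f 1 + f 2 + f 5 := by
  rw [Finset.sum_insert (by decide), Finset.sum_insert (by decide), Finset.sum_singleton, add_assoc]

section bilin

variable (M : MajoranaRep)

theorem bilin_symm (p q : ℕ) : bilin M p q = bilin M q p := by
  have h : (32 : ℝ) • bilin M p q = (32 : ℝ) • bilin M q p := by
    simp only [smul_bilin, trilin_symm M _ p q]
  exact smul_right_injective _ (by norm_num : (32 : ℝ) ≠ 0) h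

theorem smul_bilin' (p q : ℕ) : (32 : ℝ) • bilin M p q =
    trilin M 1 p q + (1 / 2 : ℝ) • trilin M 2 p q + (1 / 120 : ℝ) • trilin M 5 p q := by
  rw [smul_bilin, sum_eq_three]
  norm_num [Nat.factorial]

/-- For this and the next four pairs of lengths the selection rules leave a single grade r; only the
pair (5, 5) keeps all three. -/
theorem bilin_one_one : bilin M 1 1 = (1 / 64 : ℝ) • trilin M 2 1 1 := by
  have h := smul_bilin' M 1 1
  rw [trilin_eq_zero_of_odd M (by decide) (by decide),
    trilin_eq_zero_of_odd M (r := 5) (by decide) (by decide)] at h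
  linear_combination (norm := module) (1 / 32 : ℝ) • h

theorem bilin_one_two : bilin M 1 2 = (1 / 32 : ℝ) • trilin M 1 1 2 := by
  have h := smul_bilin' M 1 2
  rw [trilin_eq_zero_of_odd M (r := 2) (by decide) (by decide),
    trilin_eq_zero_of_even M (r := 5) (by decide) (by decide)] at h
  linear_combination (norm := module) (1 / 32 : ℝ) • h

theorem bilin_two_two : bilin M 2 2 = (1 / 64 : ℝ) • trilin M 2 2 2 := by
  have h := smul_bilin' M 2 2
  rw [trilin_eq_zero_of_odd M (r := 1) (by decide) (by decide),
    trilin_eq_zero_of_odd M (r := 5) (by decide) (by decide)] at h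
  linear_combination (norm := module) (1 / 32 : ℝ) • h

theorem bilin_one_five : bilin M 1 5 = (1 / 3840 : ℝ) • trilin M 5 1 5 := by
  have h := smul_bilin' M 1 5
  rw [trilin_eq_zero_of_odd M (r := 1) (by decide) (by decide),
    trilin_eq_zero_of_even M (r := 2) (by decide) (by decide)] at h
  linear_combination (norm := module) (1 / 32 : ℝ) • h

theorem bilin_two_five : bilin M 2 5 = (1 / 3840 : ℝ) • trilin M 5 2 5 := by
  have h := smul_bilin' M 2 5
  rw [trilin_eq_zero_of_even M (r := 1) (by decide) (by decide),
    trilin_eq_zero_of_odd M (r := 2) (by decide) (by decide)] at h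
  linear_combination (norm := module) (1 / 32 : ℝ) • h

theorem bilin_five_five : bilin M 5 5 = (1 / 32 : ℝ) • trilin M 1 5 5 +
    (1 / 64 : ℝ) • trilin M 2 5 5 + (1 / 3840 : ℝ) • trilin M 5 5 5 := by
  have h := smul_bilin' M 5 5
  linear_combination (norm := module) (1 / 32 : ℝ) • h

theorem bilin_one_one_eq :
    bilin M 1 1 = ∑ a, ∑ b, quadForm M (M.Γ a * M.Γ b) * (e₁ a * e₁ b) := by
  simp only [bilin, sum_fin_one, M.gam_one, form_one, Matrix.cons_val_zero]

theorem G₄_eq : G₄ M = (1 / 2 : ℝ) • bilin M 1 1 := by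
  simp only [G₄, bilin_one_one_eq, ← quadForm_apply, M.gam_pair', map_sub, map_smul, quadForm_one,
    smul_zero, sub_zero, mul_assoc]

end bilin

/-! ### The differential of the terms with φ. -/

/-- `(ψ̄ Γ_a φ) e^a`, for multi-indices `a` of length `p`. -/
def phiTerm (M : MajoranaRep) (p : ℕ) : CE :=
  ∑ a : Fin p → Fin 11, pairing M phi (M.gam a) * form p a

theorem pairing_add_fun (M : MajoranaRep) (χ χ' : Fin 32 → CE)
    (A : Matrix (Fin 32) (Fin 32) ℝ) :
    pairing M (fun α => χ α + χ' α) A = pairing M χ A + pairing M χ' A := by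
  simp only [pairing_apply, pair, mul_add, smul_add, Finset.sum_add_distrib]

theorem pairing_sub_fun (M : MajoranaRep) (χ χ' : Fin 32 → CE)
    (A : Matrix (Fin 32) (Fin 32) ℝ) :
    pairing M (fun α => χ α - χ' α) A = pairing M χ A - pairing M χ' A := by
  simp only [pairing_apply, pair, mul_sub, smul_sub, Finset.sum_sub_distrib]

theorem pairing_smul_fun (M : MajoranaRep) (r : ℝ) (χ : Fin 32 → CE)
    (A : Matrix (Fin 32) (Fin 32) ℝ) :
    pairing M (fun α => r • χ α) A = r • pairing M χ A := by
  simp only [pairing_apply, pair, mul_smul_comm, Finset.smul_sum, smul_comm r]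

theorem pairing_mul_fun (M : MajoranaRep) (χ : Fin 32 → CE) (x : CE)
    (A : Matrix (Fin 32) (Fin 32) ℝ) :
    pairing M (fun α => χ α * x) A = pairing M χ A * x := by
  simp only [pairing_apply, pair, Finset.sum_mul, smul_mul_assoc, mul_assoc]

theorem pairing_sum_fun (M : MajoranaRep) {ι : Type*} (s : Finset ι) (χ : ι → Fin 32 → CE)
    (A : Matrix (Fin 32) (Fin 32) ℝ) :
    pairing M (fun α => ∑ i ∈ s, χ i α) A = ∑ i ∈ s, pairing M (χ i) A := by
  induction s using Finset.cons_induction with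
  | empty => simp [pairing_apply, pair]
  | cons i s hi ih => simp only [Finset.sum_cons, pairing_add_fun, ih]

theorem pairing_act_psi_mul (M : MajoranaRep) (A B : Matrix (Fin 32) (Fin 32) ℝ) (x : CE) :
    pairing M (fun α => act B psi α * x) A = quadForm M (A * B) * x := by
  rw [pairing_mul_fun, quadForm, ← pairing_act]

theorem d_phi (M : MajoranaRep) (s : ℝ) (α : Fin 32) : d M s (phi α) =
    delta s • ∑ a : Fin 1 → Fin 11, act (M.gam a) psi α * form 1 a +
      gamma₁ s • ∑ a : Fin 2 → Fin 11, act (M.gam a) psi α * form 2 a +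
      gamma₂ s • ∑ a : Fin 5 → Fin 11, act (M.gam a) psi α * form 5 a := by
  have h : ∀ (r : ℝ) (A : Matrix (Fin 32) (Fin 32) ℝ), act (r • A) psi α = r • act A psi α := by
    intro r A
    simp only [act, Matrix.smul_apply, smul_eq_mul, mul_smul, Finset.smul_sum]
  refine (d_gen M s (.phi α)).trans ?_
  simp only [dGen, sum_fin_one, M.gam_one, form_one, form_two, form_five, Matrix.cons_val_zero, h,
    smul_mul_assoc, mul_smul_comm]

theorem d_phiTerm (M : MajoranaRep) (s : ℝ) (p : ℕ) : d M s (phiTerm M p) =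
    delta s • bilin M p 1 + gamma₁ s • bilin M p 2 + gamma₂ s • bilin M p 5 +
      fierzTerm M phi p := by
  have h : ∀ a : Fin p → Fin 11, d M s (pairing M phi (M.gam a) * form p a) =
      delta s • ∑ b : Fin 1 → Fin 11, quadForm M (M.gam a * M.gam b) * (form p a * form 1 b) +
      gamma₁ s • ∑ b : Fin 2 → Fin 11, quadForm M (M.gam a * M.gam b) * (form p a * form 2 b) +
      gamma₂ s • ∑ b : Fin 5 → Fin 11, quadForm M (M.gam a * M.gam b) * (form p a * form 5 b) +
      kappa p • etas a • (quadForm M (M.gam a) * pairing M phi (M.gam a)) := by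
    intro a
    have h1 : ∀ q, ∀ b : Fin q → Fin 11, quadForm M (M.gam a * M.gam b) * form q b * form p a =
        -(quadForm M (M.gam a * M.gam b) * (form p a * form q b)) := fun q b => by
      rw [mul_assoc, form_mul_form b a, mul_neg]
    rw [d_mul, gradeInv_pairing M (χ := phi) fun α => gradeInv_gen (.phi α), d_form, d_pairing]
    simp only [d_phi, pairing_add_fun, pairing_smul_fun, pairing_sum_fun, pairing_act_psi_mul,
      neg_mul, add_mul, smul_mul_assoc, Finset.sum_mul, h1, Finset.sum_neg_distrib, smul_neg,
      neg_add, neg_neg, mul_smul_comm, mul_quadForm, mul_smul]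
  simp only [phiTerm, map_sum, h, Finset.sum_add_distrib, bilin, fierzTerm, Finset.smul_sum]

/-- The vector-spinor term of the ansatz. -/
def vecTerm (M : MajoranaRep) : CE :=
  ∑ a, ∑ b, (pair M psi (etas ![a, b] • M.gam ![a, b]) (vec a) * e₁low b
    - pair M psi (M.Γ b) (vec a) * e₂up ![a, b])

/-- The coefficients divide out the normalizations of the five trace formulas. -/
theorem P₃_eq (M : MajoranaRep) (k : Fin 9 → ℝ) : P₃ M k =
    (-(k 0 / 64)) • cubic M 2 1 1 + (k 1 / 256) • cubic M 2 2 2 + (k 2 / 38400) • cubic M 5 2 5 +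
      (k 3 / 32) • cubic M 5 5 1 + (-(k 4 / 6400)) • cubic M 5 5 5 + k 5 • phiTerm M 1 +
      k 6 • phiTerm M 2 + k 7 • phiTerm M 5 + k 8 • vecTerm M := by
  have h : phiTerm M 1 = ∑ a, pair M psi (M.Γ a) phi * e₁ a := by
    simp only [phiTerm, sum_fin_one, M.gam_one, form_one, Matrix.cons_val_zero, pairing_apply]
  rw [cubic_two_one_one, cubic_two_two_two, cubic_five_two_five, cubic_five_five_one,
    cubic_five_five_five', h, P₃]
  have e0 : -(k 0 / 64) * -64 = k 0 := by ring
  have e1 : k 1 / 256 * 256 = k 1 := by ring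
  have e2 : k 2 / 38400 * 38400 = k 2 := by ring
  have e3 : k 3 / 32 * 32 = k 3 := by ring
  have e4 : -(k 4 / 6400) * -6400 = k 4 := by ring
  simp only [smul_smul, e0, e1, e2, e3, e4]
  rfl

/-! ### The vector-spinor term -/

theorem gen_anticomm {x y : Gen} (hx : x.odd = false) (hy : y.odd = false) :
    gen x * gen y = -(gen y * gen x) := by
  have h := gen_swap x y
  simpa only [swapSign, hx, hy, Bool.and_self, Bool.false_eq_true, if_false, neg_one_smul] using h

theorem e₂_mul_e₂ (a b : Fin 2 → Fin 11) : e₂ a * e₂ b = -(e₂ b * e₂ a) :=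
  gen_anticomm (x := .e₂ a) (y := .e₂ b) rfl rfl

theorem e₁_mul_e₂ (a : Fin 11) (b : Fin 2 → Fin 11) : e₁ a * e₂ b = -(e₂ b * e₁ a) :=
  gen_anticomm (x := .e₁ a) (y := .e₂ b) rfl rfl

theorem e₂_swap (a b : Fin 11) : e₂ ![b, a] = -e₂ ![a, b] := by
  have h := gen_skew₂ ![a, b] (Equiv.swap 0 1)
  have h1 : ![a, b] ∘ Equiv.swap 0 1 = ![b, a] := by
    funext i; fin_cases i <;> rfl
  rwa [h1, sgn_swap (by decide), neg_one_smul] at h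

theorem e₂_self (a : Fin 11) : e₂ ![a, a] = 0 := by
  have h := e₂_swap a a
  have h3 : (2 : ℝ) • e₂ ![a, a] = 0 := by
    rw [two_smul]; nth_rw 1 [h]; simp
  exact (smul_eq_zero.1 h3).resolve_left two_ne_zero

section

variable (M : MajoranaRep) (s : ℝ)

theorem d_e₁ (a : Fin 11) : d M s (e₁ a) = eta a • quadForm M (M.Γ a) := by
  rw [← map_smul]
  exact d_gen M s (.e₁ a)

theorem d_e₂ (a : Fin 2 → Fin 11) : d M s (e₂ a) = -quadForm M (M.gam a) := d_gen M s (.e₂ a)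

theorem gradeInv_e₁ (a : Fin 11) : gradeInv (e₁ a) = -e₁ a := gradeInv_gen (.e₁ a)

theorem gradeInv_e₂ (a : Fin 2 → Fin 11) : gradeInv (e₂ a) = -e₂ a := gradeInv_gen (.e₂ a)

theorem quadForm_gam_pair (a b : Fin 11) :
    quadForm M (M.gam ![a, b]) = quadForm M (M.Γ a * M.Γ b) := by
  rw [M.gam_pair', map_sub, map_smul, quadForm_one, smul_zero, sub_zero]

/-- The differential of e_{ab} e^a e^b is computed twice, by `d_cubic` and directly by the Leibniz
rule; comparing the two identifies the index contraction with `trilin M 1 1 2`. -/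
theorem bilin_one_two_eq : bilin M 1 2 =
    (2 : ℝ) • ∑ a, ∑ b, eta a • (quadForm M (M.Γ a) * (e₂ ![a, b] * e₁ b)) := by
  -- The value 0 of the parameter is immaterial, since φ does not occur.
  have h1 := d_cubic M 0 2 1 1
  rw [trilin_symm M 1 2 1, cubic_two_one_one] at h1
  have h2 : ∀ a b, d M 0 (e₂ ![a, b] * e₁ a * e₁ b) =
      -(quadForm M (M.Γ a * M.Γ b) * (e₁ a * e₁ b)) -
        eta a • (quadForm M (M.Γ a) * (e₂ ![a, b] * e₁ b)) -
        eta b • (quadForm M (M.Γ b) * (e₂ ![b, a] * e₁ a)) := by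
    intro a b
    rw [d_mul, d_mul, map_mul, d_e₁, d_e₁, d_e₂, gradeInv_e₁, gradeInv_e₂, quadForm_gam_pair,
      e₂_swap a b]
    simp only [mul_smul_comm, mul_quadForm, add_mul, smul_mul_assoc, neg_mul, mul_neg, neg_neg,
      smul_neg]
    simp only [mul_assoc]
    abel
  have h3 : ∑ a, ∑ b, eta b • (quadForm M (M.Γ b) * (e₂ ![b, a] * e₁ a)) =
      ∑ a, ∑ b, eta a • (quadForm M (M.Γ a) * (e₂ ![a, b] * e₁ b)) := Finset.sum_comm
  rw [map_smul] at h1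
  simp only [map_sum, h2, Finset.sum_sub_distrib, h3, Finset.sum_neg_distrib,
    ← bilin_one_one_eq] at h1
  linear_combination (norm := module) (-1 / 64 : ℝ) • h1 + bilin_one_two M + bilin_one_one M

/-- The same comparison for the cyclic cubic in e_{ab}, whose Leibniz rule gives three equal terms
after relabelling. -/
theorem bilin_two_two_eq : bilin M 2 2 =
    (-4 : ℝ) • ∑ a, ∑ b, ∑ c, (eta a * eta b * eta c) •
      (quadForm M (M.Γ a * M.Γ b) * (e₂ ![b, c] * e₂ ![c, a])) := by
  have h1 := d_cubic M 0 2 2 2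
  rw [cubic_two_two_two, map_smul] at h1
  have h2 : ∀ a b c, d M 0 ((eta a • e₂ ![a, b]) * (eta b • e₂ ![b, c]) * (eta c • e₂ ![c, a])) =
      -((eta a * eta b * eta c) • (quadForm M (M.Γ a * M.Γ b) * (e₂ ![b, c] * e₂ ![c, a]))) -
      (eta b * eta c * eta a) • (quadForm M (M.Γ b * M.Γ c) * (e₂ ![c, a] * e₂ ![a, b])) -
      (eta c * eta a * eta b) • (quadForm M (M.Γ c * M.Γ a) * (e₂ ![a, b] * e₂ ![b, c])) := by
    intro a b c
    have h3 : (eta a • e₂ ![a, b]) * (eta b • e₂ ![b, c]) * (eta c • e₂ ![c, a]) =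
        (eta a * eta b * eta c) • (e₂ ![a, b] * e₂ ![b, c] * e₂ ![c, a]) := by
      simp only [smul_mul_smul_comm]
    have h4 : eta b * eta c * eta a = eta a * eta b * eta c := by ring
    have h5 : eta c * eta a * eta b = eta a * eta b * eta c := by ring
    rw [h3, h4, h5, map_smul, d_mul, d_mul, map_mul, d_e₂, d_e₂, d_e₂, gradeInv_e₂, gradeInv_e₂,
      quadForm_gam_pair, quadForm_gam_pair, quadForm_gam_pair, e₂_mul_e₂ ![c, a] ![a, b]]
    simp only [mul_quadForm, add_mul, neg_mul, mul_neg, neg_neg, smul_neg, smul_add]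
    simp only [mul_assoc]
    abel
  have h6 : ∀ f : Fin 11 → Fin 11 → Fin 11 → CE,
      ∑ a, ∑ b, ∑ c, f b c a = ∑ a, ∑ b, ∑ c, f a b c := fun f => Finset.sum_comm_cycle.symm
  have h7 : ∀ f : Fin 11 → Fin 11 → Fin 11 → CE,
      ∑ a, ∑ b, ∑ c, f c a b = ∑ a, ∑ b, ∑ c, f a b c := fun f => Finset.sum_comm_cycle
  simp only [map_sum, h2, Finset.sum_sub_distrib, Finset.sum_neg_distrib] at h1
  rw [h6 fun a b c => (eta a * eta b * eta c) •
      (quadForm M (M.Γ a * M.Γ b) * (e₂ ![b, c] * e₂ ![c, a])),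
    h7 fun a b c => (eta a * eta b * eta c) •
      (quadForm M (M.Γ a * M.Γ b) * (e₂ ![b, c] * e₂ ![c, a]))] at h1
  linear_combination (norm := module) (-1 / 192 : ℝ) • h1 + bilin_two_two M

/-- By skew self-adjointness only half the commutator of Γ_{ab} and Γ_c contributes, and it has
grade 1. -/
theorem quadForm_gam_pair_mul_Γ (a b c : Fin 11) : quadForm M (M.gam ![a, b] * M.Γ c) =
    metric c b • quadForm M (M.Γ a) - metric c a • quadForm M (M.Γ b) := by
  have h1 := quadForm_mul_eq M (M.isSkewAdjoint_gam (p := 2) (by simp [kappa]) ![a, b])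
    (M.skewAdjoint c)
  rw [M.Γ_mul_gam_pair, map_add, map_sub, map_smul, map_smul] at h1
  linear_combination (norm := module) (1 / 2 : ℝ) • h1

theorem quadForm_Γ_mul_gam_pair (a b c : Fin 11) : quadForm M (M.Γ c * M.gam ![a, b]) =
    -quadForm M (M.gam ![a, b] * M.Γ c) :=
  quadForm_mul_eq M (M.skewAdjoint c) (M.isSkewAdjoint_gam (p := 2) (by simp [kappa]) ![a, b])

theorem quadForm_gam_pair_mul_gam_pair (a b c : Fin 11) :
    quadForm M (M.gam ![a, b] * M.gam ![a, c]) =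
      metric b a • quadForm M (M.Γ a * M.Γ c) + metric c a • quadForm M (M.Γ b * M.Γ a) -
        eta a • quadForm M (M.Γ b * M.Γ c) := by
  have h : M.gam ![a, b] * M.gam ![a, c] = metric b a • (M.Γ a * M.Γ c) +
      metric c a • (M.Γ b * M.Γ a) - eta a • (M.Γ b * M.Γ c) - (metric b a * metric c a) • 1 := by
    rw [M.gam_pair_swap a b, M.gam_pair' a c, sub_mul, mul_sub, mul_sub, mul_assoc (M.Γ b),
      ← mul_assoc (M.Γ a) (M.Γ a), M.Γ_sq, metric_comm a b, metric_comm a c]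
    simp only [smul_mul_assoc, mul_smul_comm, one_mul, mul_one]
    module
  rw [h]
  simp only [map_sub, map_add, map_smul, quadForm_one, smul_zero, sub_zero]

theorem d_vec (a : Fin 11) (A : Matrix (Fin 32) (Fin 32) ℝ) :
    d M s (pairing M (vec a) A) = ∑ c, eta c • (quadForm M (A * M.Γ c) * e₂ ![a, c]) -
      ∑ c, quadForm M (A * M.gam ![a, c]) * e₁ c := by
  have h : (fun α => d M s (vec a α)) = fun α => (∑ c, act (M.gam ![a, c]) psi α * e₁ c) -
      ∑ c, act (M.Γ c) psi α * (eta c • e₂ ![a, c]) := funext fun α => d_gen M s (.vec a α)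
  rw [d_pairing, h, pairing_sub_fun, pairing_sum_fun, pairing_sum_fun, neg_sub]
  simp only [pairing_act_psi_mul, mul_smul_comm, pairing_smul_fun]

/-- The free summation over a contributes 11, and the two metric terms contribute −1 each. -/
theorem sum_contract_one_one :
    ∑ a, ∑ b, ∑ c, eta a • (quadForm M (M.gam ![a, b] * M.gam ![a, c]) * (e₁ c * e₁ b)) =
      (9 : ℝ) • bilin M 1 1 := by
  have h : ∀ a b c, eta a • (quadForm M (M.gam ![a, b] * M.gam ![a, c]) * (e₁ c * e₁ b)) =
      metric b a • (eta a • (quadForm M (M.Γ a * M.Γ c) * (e₁ c * e₁ b))) +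
      metric c a • (eta a • (quadForm M (M.Γ b * M.Γ a) * (e₁ c * e₁ b))) -
      quadForm M (M.Γ b * M.Γ c) * (e₁ c * e₁ b) := by
    intro a b c
    rw [quadForm_gam_pair_mul_gam_pair]
    simp only [add_mul, sub_mul, smul_mul_assoc, smul_add, smul_sub, smul_smul, eta_mul_self,
      one_smul, mul_comm (eta a)]
  have h2 : ∀ b c, quadForm M (M.Γ b * M.Γ c) * (e₁ c * e₁ b) =
      -(quadForm M (M.Γ b * M.Γ c) * (e₁ b * e₁ c)) := fun b c => by
    rw [e₁_mul_e₁ c b, mul_neg]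
  refine (Finset.sum_comm_cycle (f := fun b c a => eta a •
    (quadForm M (M.gam ![a, b] * M.gam ![a, c]) * (e₁ c * e₁ b)))).symm.trans ?_
  simp only [h, Finset.sum_sub_distrib, Finset.sum_add_distrib, sum_metric_smul,
    Finset.sum_const, Finset.card_univ, Fintype.card_fin]
  simp only [smul_smul, eta_mul_self, one_smul, h2, Finset.sum_neg_distrib, smul_neg, ←
      Finset.smul_sum, ← bilin_one_one_eq]
  module

theorem sum_contract_one_two :
    ∑ a, ∑ b, ∑ c, (eta a * eta c) •
      (quadForm M (M.gam ![a, b] * M.Γ c) * (e₂ ![a, c] * e₁ b)) =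
      (1 / 2 : ℝ) • bilin M 1 2 := by
  have h : ∀ a b c, (eta a * eta c) •
      (quadForm M (M.gam ![a, b] * M.Γ c) * (e₂ ![a, c] * e₁ b)) =
      metric b c • ((eta a * eta c) • (quadForm M (M.Γ a) * (e₂ ![a, c] * e₁ b))) -
      metric a c • ((eta a * eta c) • (quadForm M (M.Γ b) * (e₂ ![a, c] * e₁ b))) := by
    intro a b c
    rw [quadForm_gam_pair_mul_Γ, metric_comm c b, metric_comm c a]
    simp only [sub_mul, smul_mul_assoc, smul_sub, smul_comm (metric _ _)]
  simp only [h, Finset.sum_sub_distrib, sum_metric_smul, e₂_self, zero_mul, mul_zero, smul_zero,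
    sub_zero]
  rw [bilin_one_two_eq, smul_smul]
  norm_num
  refine Finset.sum_congr rfl fun a _ => Finset.sum_congr rfl fun b _ => ?_
  rw [smul_smul, mul_left_comm, eta_mul_self, mul_one]

theorem sum_contract_two_one :
    ∑ a, ∑ b, ∑ c, (eta a * eta b) •
      (quadForm M (M.Γ b * M.gam ![a, c]) * (e₁ c * e₂ ![a, b])) =
      (1 / 2 : ℝ) • bilin M 1 2 := by
  rw [← sum_contract_one_two]
  refine Finset.sum_congr rfl fun a _ => ?_
  rw [Finset.sum_comm]
  refine Finset.sum_congr rfl fun b _ => Finset.sum_congr rfl fun c _ => ?_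
  rw [quadForm_Γ_mul_gam_pair, e₁_mul_e₂, neg_mul_neg]

theorem sum_contract_two_two :
    ∑ a, ∑ b, ∑ c, (eta a * eta b * eta c) •
      (quadForm M (M.Γ b * M.Γ c) * (e₂ ![a, c] * e₂ ![a, b])) =
      (1 / 4 : ℝ) • bilin M 2 2 := by
  have h : ∀ a b c, (eta a * eta b * eta c) •
      (quadForm M (M.Γ b * M.Γ c) * (e₂ ![a, c] * e₂ ![a, b])) =
      -((eta b * eta c * eta a) • (quadForm M (M.Γ b * M.Γ c) * (e₂ ![c, a] * e₂ ![a, b]))) := by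
    intro a b c
    have h1 : eta b * eta c * eta a = eta a * eta b * eta c := by ring
    rw [e₂_swap c a, h1, neg_mul, mul_neg, smul_neg]
  simp only [h, Finset.sum_neg_distrib]
  refine (congrArg Neg.neg (Finset.sum_comm_cycle (f := fun b c a => (eta b * eta c * eta a) •
    (quadForm M (M.Γ b * M.Γ c) * (e₂ ![c, a] * e₂ ![a, b])))).symm).trans ?_
  rw [bilin_two_two_eq]
  module

theorem d_vecTerm : d M s (vecTerm M) =
    (-9 : ℝ) • bilin M 1 1 + bilin M 1 2 - (1 / 4 : ℝ) • bilin M 2 2 := by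
  have h : ∀ a b, d M s (pair M psi (etas ![a, b] • M.gam ![a, b]) (vec a) * e₁low b
      - pair M psi (M.Γ b) (vec a) * e₂up ![a, b]) =
      ∑ c, (eta a * eta c) • (quadForm M (M.gam ![a, b] * M.Γ c) * (e₂ ![a, c] * e₁ b)) -
      ∑ c, eta a • (quadForm M (M.gam ![a, b] * M.gam ![a, c]) * (e₁ c * e₁ b)) +
      ∑ c, (eta a * eta b) • (quadForm M (M.Γ b * M.gam ![a, c]) * (e₁ c * e₂ ![a, b])) -
      ∑ c, (eta a * eta b * eta c) •
        (quadForm M (M.Γ b * M.Γ c) * (e₂ ![a, c] * e₂ ![a, b])) +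
      eta a • (eta b • (quadForm M (M.Γ b) * pairing M (vec a) (M.gam ![a, b]) +
        quadForm M (M.gam ![a, b]) * pairing M (vec a) (M.Γ b))) := by
    intro a b
    have hv : ∀ α, gradeInv (vec a α) = -vec a α := fun α => gradeInv_gen (.vec a α)
    have h1 : pair M psi (etas ![a, b] • M.gam ![a, b]) (vec a) * e₁low b =
        eta a • (pairing M (vec a) (M.gam ![a, b]) * e₁ b) := by
      rw [← pairing_apply, map_smul, e₁low, smul_mul_smul_comm, etas_pair, mul_assoc,
        eta_mul_self, mul_one]
    have h2 : pair M psi (M.Γ b) (vec a) * e₂up ![a, b] =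
        (eta a * eta b) • (pairing M (vec a) (M.Γ b) * e₂ ![a, b]) := by
      rw [← pairing_apply, e₂up, mul_smul_comm, etas_pair]
    rw [h1, h2, map_sub, map_smul, map_smul, d_mul, d_mul, gradeInv_pairing M hv,
      gradeInv_pairing M hv, d_vec, d_vec, d_e₁, d_e₂]
    simp only [sub_mul, Finset.sum_mul, smul_mul_assoc, mul_smul_comm, mul_neg, mul_quadForm,
      smul_add, smul_sub, Finset.smul_sum, smul_smul, smul_neg, mul_assoc]
    abel
  -- All terms that still contain ψ_a cancel, for each a separately, by the membrane identity with χ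
  -- = ψ_a.
  have h0 : ∀ a, ∑ b, eta a • (eta b • (quadForm M (M.Γ b) * pairing M (vec a) (M.gam ![a, b]) +
      quadForm M (M.gam ![a, b]) * pairing M (vec a) (M.Γ b))) = 0 := fun a => by
    rw [← Finset.smul_sum, membrane_fierz, smul_zero]
  rw [vecTerm, map_sum, Finset.sum_congr rfl fun a _ => (map_sum (d M s) _ _).trans
    (Finset.sum_congr rfl fun b _ => h a b)]
  simp only [Finset.sum_add_distrib (f := fun b => _ - _),
    Finset.sum_sub_distrib, h0]
  rw [sum_contract_one_two, sum_contract_one_one, sum_contract_two_one, sum_contract_two_two]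
  simp only [Finset.sum_const_zero]
  module

end

/-! ### The linear system for the coefficients. -/

/-- The coefficients of `d P₃ - G₄` in the invariants of its eight sectors without `φ`, and of its
sector with `φ`. -/
def residual (s : ℝ) (k : Fin 9 → ℝ) : Fin 9 → ℝ :=
  ![-(k 0 / 64) + delta s * k 5 / 64 - 9 * k 8 / 64 - 1 / 128,
    -(k 0 / 32) + (gamma₁ s * k 5 + delta s * k 6) / 32 + k 8 / 32,
    3 * k 1 / 256 + gamma₁ s * k 6 / 64 - k 8 / 256,
    k 3 / 16 + (gamma₂ s * k 5 + delta s * k 7) / 3840,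
    k 2 / 19200 + (gamma₂ s * k 6 + gamma₁ s * k 7) / 3840,
    k 3 / 32 + gamma₂ s * k 7 / 32,
    k 2 / 38400 + gamma₂ s * k 7 / 64,
    -(3 * k 4 / 6400) + gamma₂ s * k 7 / 3840,
    k 5 + 10 * k 6 - 720 * k 7]

theorem d_P₃_sub_G₄ (M : MajoranaRep) (s : ℝ) (k : Fin 9 → ℝ) :
    d M s (P₃ M k) - G₄ M =
      residual s k 0 • trilin M 2 1 1 + residual s k 1 • trilin M 1 1 2 +
      residual s k 2 • trilin M 2 2 2 + residual s k 3 • trilin M 5 1 5 +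
      residual s k 4 • trilin M 5 2 5 + residual s k 5 • trilin M 1 5 5 +
      residual s k 6 • trilin M 2 5 5 + residual s k 7 • trilin M 5 5 5 +
      residual s k 8 • fierzTerm M phi 1 := by
  rw [P₃_eq, G₄_eq]
  simp only [map_add, map_smul, d_cubic, d_phiTerm, d_vecTerm, fierzTerm_two, fierzTerm_five]
  rw [trilin_symm M 1 2 1, trilin_symm M 5 5 2, trilin_symm M 5 5 1, bilin_symm M 2 1,
    bilin_symm M 5 1, bilin_symm M 5 2, bilin_one_one, bilin_one_two, bilin_two_two,
    bilin_one_five, bilin_two_five, bilin_five_five]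
  have h0 : residual s k 0 = -(k 0 / 64) + delta s * k 5 / 64 - 9 * k 8 / 64 - 1 / 128 := rfl
  have h1 : residual s k 1 =
    -(k 0 / 32) + (gamma₁ s * k 5 + delta s * k 6) / 32 + k 8 / 32 := rfl
  have h2 : residual s k 2 = 3 * k 1 / 256 + gamma₁ s * k 6 / 64 - k 8 / 256 := rfl
  have h3 : residual s k 3 = k 3 / 16 + (gamma₂ s * k 5 + delta s * k 7) / 3840 := rfl
  have h4 : residual s k 4 = k 2 / 19200 + (gamma₂ s * k 6 + gamma₁ s * k 7) / 3840 := rfl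
  have h5 : residual s k 5 = k 3 / 32 + gamma₂ s * k 7 / 32 := rfl
  have h6 : residual s k 6 = k 2 / 38400 + gamma₂ s * k 7 / 64 := rfl
  have h7 : residual s k 7 = -(3 * k 4 / 6400) + gamma₂ s * k 7 / 3840 := rfl
  have h8 : residual s k 8 = k 5 + 10 * k 6 - 720 * k 7 := rfl
  rw [h0, h1, h2, h3, h4, h5, h6, h7, h8]
  generalize gamma₁ s = g₁, gamma₂ s = g₂, delta s = g₀
  module

theorem residual_newSolution (s : ℝ) : residual s newSolution = 0 := by
  funext i
  fin_cases i <;> simp [residual, newSolution] <;> norm_num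

theorem residual_oldSolution {s : ℝ} (hs : s ≠ 0) : residual s (oldSolution s) = 0 := by
  funext i
  fin_cases i <;>
    simp [residual, oldSolution, delta, gamma₁, gamma₂, Nat.factorial] <;> field_simp <;> ring

theorem residual_sub (s : ℝ) (k k' : Fin 9 → ℝ) (t : ℝ) :
    residual s ((1 - t) • k + t • k') = (1 - t) • residual s k + t • residual s k' := by
  funext i
  fin_cases i <;> simp [residual] <;> ring

/-- Eight of the nine equations already fix the other coefficients in terms of `k 8`, so the
invariant `trilin M 5 1 5` never has to be evaluated. -/
theorem eq_of_residual_eq_zero {s : ℝ} (hs : s ≠ 0) {k : Fin 9 → ℝ}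
    (h : ∀ i, i ≠ 3 → residual s k i = 0) :
    k = (1 - -20 * k 8) • oldSolution s + (-20 * k 8) • newSolution := by
  -- The entry 8 of `newSolution` is −1/20 and that of `oldSolution` is 0, so t = −20 · `k 8` makes
  -- `K 8 = k 8`. The difference of k and K then solves the homogeneous system without vector-spinor
  -- term.
  obtain ⟨K, hK⟩ : ∃ K, K = (1 - -20 * k 8) • oldSolution s + (-20 * k 8) • newSolution := ⟨_, rfl⟩
  have hr : residual s K = 0 := by
    rw [hK, residual_sub, residual_oldSolution hs, residual_newSolution, smul_zero, smul_zero,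
      add_zero]
  have h8 : K 8 = k 8 := by
    rw [hK]
    simp [oldSolution, newSolution]
    ring
  have hr0 : ∀ i, residual s K i = 0 := fun i => congrFun hr i
  have e0 := h 0 (by decide)
  have e1 := h 1 (by decide)
  have e2 := h 2 (by decide)
  have e4 := h 4 (by decide)
  have e5 := h 5 (by decide)
  have e6 := h 6 (by decide)
  have e7 := h 7 (by decide)
  have e8 := h 8 (by decide)
  have f0 := hr0 0
  have f1 := hr0 1
  have f2 := hr0 2
  have f4 := hr0 4
  have f5 := hr0 5
  have f6 := hr0 6
  have f7 := hr0 7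
  have f8 := hr0 8
  rw [← hK]
  simp only [residual, Matrix.cons_val, gamma₁, gamma₂, delta, Nat.factorial]
    at e0 e1 e2 e4 e5 e6 e7 e8 f0 f1 f2 f4 f5 f6 f7 f8
  push_cast at e0 e1 e2 e4 e5 e6 e7 e8 f0 f1 f2 f4 f5 f6 f7 f8
  have a1 : (6 + s) * (k 6 - K 6) = 120 * (3 + s) * (k 7 - K 7) := by
    linear_combination 1382400 * ((e4 - f4) - 2 * (e6 - f6))
  have a2 : (1 + 2 * s) * (k 5 - K 5) = 2 * (1 + s) * (k 6 - K 6) := by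
    linear_combination 64 * (e0 - f0) - 32 * (e1 - f1) - 10 * h8
  have a3 : 720 * (1 + 2 * s) * (k 7 - K 7) = (12 + 22 * s) * (k 6 - K 6) := by
    linear_combination a2 - (1 + 2 * s) * (e8 - f8)
  -- The equations a1 and a3 form a 2 × 2 system for the differences 6 and 7, with determinant a
  -- constant multiple of s²; here s ≠ 0 yields uniqueness.
  have a4 : s ^ 2 * (k 7 - K 7) = 0 := by
    linear_combination (-1 / 1200) * ((6 + s) * a3 + (12 + 22 * s) * a1)
  have y7 : k 7 - K 7 = 0 := (mul_eq_zero.1 a4).resolve_left (pow_ne_zero 2 hs)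
  have y6 : k 6 - K 6 = 0 := by
    rw [y7] at a1 a3
    -- The factors 6 + s and 12 + 22 s have no common zero: 22 (6 + s) − (12 + 22 s) = 120.
    linear_combination (22 / 120) * a1 + (1 / 120) * a3
  have y5 : k 5 - K 5 = 0 := by linear_combination e8 - f8 - 10 * y6 + 720 * y7
  funext i
  rw [← sub_eq_zero]
  fin_cases i
  · change k 0 - K 0 = 0
    linear_combination -64 * (e0 - f0) + 2 * (1 + s) * y5 + 9 * h8
  · change k 1 - K 1 = 0
    linear_combination 256 / 3 * (e2 - f2) - 4 / 3 * y6 - 1 / 3 * h8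
  · change k 2 - K 2 = 0
    linear_combination 38400 * (e6 - f6) - 600 * (6 + s) / 360 * y7
  · change k 3 - K 3 = 0
    linear_combination 32 * (e5 - f5) - (6 + s) / 360 * y7
  · change k 4 - K 4 = 0
    linear_combination -6400 / 3 * (e7 - f7) + 6400 / 3 * (6 + s) / 360 / 3840 * y7
  · exact y5
  · exact y6
  · exact y7
  · change k 8 - K 8 = 0
    rw [h8, sub_self]

/-! ### Evaluation of the invariants -/

/-- The operator `(-1)^n` on the exterior algebra of `ℝ²`. -/
def parityOp : Matrix (Fin 4) (Fin 4) ℝ := !![1, 0, 0, 0; 0, -1, 0, 0; 0, 0, -1, 0; 0, 0, 0, 1]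

/-- Multiplication by the first generator of the exterior algebra of `ℝ²`. -/
def wedge₁ : Matrix (Fin 4) (Fin 4) ℝ := !![0, 0, 0, 0; 1, 0, 0, 0; 0, 0, 0, 0; 0, 0, 1, 0]

/-- Multiplication by the second generator of the exterior algebra of `ℝ²`. -/
def wedge₂ : Matrix (Fin 4) (Fin 4) ℝ := !![0, 0, 0, 0; 0, 0, 0, 0; 1, 0, 0, 0; 0, -1, 0, 0]

/-- The product of the two generators of the exterior algebra of `ℝ²`. -/
def wedge₁₂ : Matrix (Fin 4) (Fin 4) ℝ := !![0, 0, 0, 0; 0, 0, 0, 0; 0, 0, 0, 0; 1, 0, 0, 0]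

theorem parityOp_mul_parityOp : parityOp * parityOp = 1 := by
  ext i j
  fin_cases i <;> fin_cases j <;> simp [parityOp, Matrix.mul_apply, Fin.sum_univ_four]

theorem parityOp_mul_wedge₁ : parityOp * wedge₁ = -(wedge₁ * parityOp) := by
  ext i j
  fin_cases i <;> fin_cases j <;> simp [parityOp, wedge₁, Matrix.mul_apply, Fin.sum_univ_four]

theorem parityOp_mul_wedge₂ : parityOp * wedge₂ = -(wedge₂ * parityOp) := by
  ext i j
  fin_cases i <;> fin_cases j <;> simp [parityOp, wedge₂, Matrix.mul_apply, Fin.sum_univ_four]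

theorem wedge₁_mul_wedge₁ : wedge₁ * wedge₁ = 0 := by
  ext i j
  fin_cases i <;> fin_cases j <;> simp [wedge₁, Matrix.mul_apply, Fin.sum_univ_four]

theorem wedge₂_mul_wedge₂ : wedge₂ * wedge₂ = 0 := by
  ext i j
  fin_cases i <;> fin_cases j <;> simp [wedge₂, Matrix.mul_apply, Fin.sum_univ_four]

theorem wedge₁_mul_wedge₂ : wedge₁ * wedge₂ = wedge₁₂ := by
  ext i j
  fin_cases i <;> fin_cases j <;> simp [wedge₁, wedge₂, wedge₁₂, Matrix.mul_apply,
    Fin.sum_univ_four]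

theorem wedge₂_mul_wedge₁ : wedge₂ * wedge₁ = -wedge₁₂ := by
  ext i j
  fin_cases i <;> fin_cases j <;> simp [wedge₁, wedge₂, wedge₁₂, Matrix.mul_apply,
    Fin.sum_univ_four]

theorem smul_wedge₁₂_eq_zero {r : ℝ} (h : r • wedge₁₂ = 0) : r = 0 := by
  have := congrFun (congrFun h 3) 0
  simpa [wedge₁₂] using this

/-- The values of the generators under `evalHom`. -/
def evalGen (M : MajoranaRep) (u v : Fin 32 → ℝ) (A B : Matrix (Fin 32) (Fin 32) ℝ) :
    Gen → Matrix (Fin 4) (Fin 4) ℝ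
  | .psi α => u α • parityOp
  | .phi α => v α • parityOp
  | .vec _ _ => 0
  | .e₁ a => eta a • ((A * M.Γ a).trace • wedge₁ + (B * M.Γ a).trace • wedge₂)
  | .e₂ a => (A * M.gam a).trace • wedge₁ + (B * M.gam a).trace • wedge₂
  | .e₅ a => (A * M.gam a).trace • wedge₁ + (B * M.gam a).trace • wedge₂

theorem evalGen_odd (M : MajoranaRep) (u v : Fin 32 → ℝ) (A B : Matrix (Fin 32) (Fin 32) ℝ)
    {x : Gen} (hx : x.odd = true) : ∃ r : ℝ, evalGen M u v A B x = r • parityOp := by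
  cases x with
  | psi α => exact ⟨_, rfl⟩
  | phi α => exact ⟨_, rfl⟩
  | vec a α => exact ⟨0, (zero_smul _ _).symm⟩
  | e₁ a => exact absurd hx Bool.false_ne_true
  | e₂ a => exact absurd hx Bool.false_ne_true
  | e₅ a => exact absurd hx Bool.false_ne_true

theorem evalGen_even (M : MajoranaRep) (u v : Fin 32 → ℝ) (A B : Matrix (Fin 32) (Fin 32) ℝ)
    {x : Gen} (hx : x.odd = false) :
    ∃ r t : ℝ, evalGen M u v A B x = r • wedge₁ + t • wedge₂ := by
  cases x with
  | psi α => exact absurd hx.symm Bool.false_ne_true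
  | phi α => exact absurd hx.symm Bool.false_ne_true
  | vec a α => exact absurd hx.symm Bool.false_ne_true
  | e₁ a => exact ⟨_, _, by rw [evalGen, smul_add, smul_smul, smul_smul]⟩
  | e₂ a => exact ⟨_, _, rfl⟩
  | e₅ a => exact ⟨_, _, rfl⟩

/-- The sign rule holds because multiples of the parity operator commute with each other and
anticommute with the wedge operators, which anticommute among themselves. -/
theorem evalGen_swap (M : MajoranaRep) (u v : Fin 32 → ℝ) (A B : Matrix (Fin 32) (Fin 32) ℝ)
    (x y : Gen) : evalGen M u v A B x * evalGen M u v A B y =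
      swapSign x y • (evalGen M u v A B y * evalGen M u v A B x) := by
  have h1 : ∀ r t r' t' : ℝ, (r • wedge₁ + t • wedge₂) * (r' • wedge₁ + t' • wedge₂) =
      (r * t' - t * r') • wedge₁₂ := by
    intro r t r' t'
    simp only [add_mul, mul_add, smul_mul_smul_comm, wedge₁_mul_wedge₁, wedge₂_mul_wedge₂,
      wedge₁_mul_wedge₂, wedge₂_mul_wedge₁]
    module
  have h2 : ∀ r t t' : ℝ, (r • parityOp) * (t • wedge₁ + t' • wedge₂) =
      -((t • wedge₁ + t' • wedge₂) * (r • parityOp)) := by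
    intro r t t'
    simp only [add_mul, mul_add, smul_mul_smul_comm, parityOp_mul_wedge₁, parityOp_mul_wedge₂]
    module
  cases hx : x.odd <;> cases hy : y.odd
  · obtain ⟨r, t, h⟩ := evalGen_even M u v A B hx
    obtain ⟨r', t', h'⟩ := evalGen_even M u v A B hy
    rw [h, h', h1, h1, swapSign, hx, hy, smul_smul]
    congr 1
    simp
    ring
  · obtain ⟨r, t, h⟩ := evalGen_even M u v A B hx
    obtain ⟨r', h'⟩ := evalGen_odd M u v A B hy
    rw [h, h', h2, swapSign, hx, hy]
    simp
  · obtain ⟨r, h⟩ := evalGen_odd M u v A B hx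
    obtain ⟨r', t', h'⟩ := evalGen_even M u v A B hy
    rw [h, h', h2, swapSign, hx, hy]
    simp
  · obtain ⟨r, h⟩ := evalGen_odd M u v A B hx
    obtain ⟨r', h'⟩ := evalGen_odd M u v A B hy
    rw [h, h', swapSign, hx, hy, smul_mul_smul_comm, smul_mul_smul_comm, mul_comm r']
    simp

/-- An algebra homomorphism into the operators on the exterior algebra of `ℝ²`, which sends `ψ` and
`φ` to multiples of the parity operator, and the even generators to multiplication operators. -/
def evalHom (M : MajoranaRep) (u v : Fin 32 → ℝ) (A B : Matrix (Fin 32) (Fin 32) ℝ) :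
    CE →ₐ[ℝ] Matrix (Fin 4) (Fin 4) ℝ :=
  CE.lift (FreeAlgebra.lift ℝ (evalGen M u v A B)) (by
    intro x y h
    cases h with
    | swap x y => simpa using evalGen_swap M u v A B x y
    | skew₂ a σ =>
      simp only [map_smul, FreeAlgebra.lift_ι_apply, evalGen, M.gam_comp_perm, mul_smul_comm,
        Matrix.trace_smul, smul_eq_mul, mul_smul, smul_add]
    | skew₅ a σ =>
      simp only [map_smul, FreeAlgebra.lift_ι_apply, evalGen, M.gam_comp_perm, mul_smul_comm,
        Matrix.trace_smul, smul_eq_mul, mul_smul, smul_add])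

/-- The bilinear form `u^α η_{αβ} A^β_γ v^γ`, linear in `A`. -/
def spinorForm (M : MajoranaRep) (u v : Fin 32 → ℝ) : Matrix (Fin 32) (Fin 32) ℝ →ₗ[ℝ] ℝ where
  toFun A := ∑ α, ∑ γ, (M.C * A) α γ * (u α * v γ)
  map_add' A B := by
    simp only [Matrix.mul_add, Matrix.add_apply, add_mul, Finset.sum_add_distrib]
  map_smul' r A := by
    simp only [Matrix.mul_smul, Matrix.smul_apply, smul_eq_mul, Finset.mul_sum, mul_assoc,
      RingHom.id_apply]

/-- The component of grade `p` of a matrix, up to a factor. -/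
def gradeProj (M : MajoranaRep) (p : ℕ) (A : Matrix (Fin 32) (Fin 32) ℝ) :
    Matrix (Fin 32) (Fin 32) ℝ :=
  ∑ a : Fin p → Fin 11, ((A * M.gam a).trace * etas a) • M.gam a

section

variable (M : MajoranaRep) (u v : Fin 32 → ℝ) (A B : Matrix (Fin 32) (Fin 32) ℝ)

theorem evalHom_gen (x : Gen) : evalHom M u v A B (gen x) = evalGen M u v A B x := by
  simp [evalHom, gen, CE.lift_mk]

theorem evalHom_quadForm (N : Matrix (Fin 32) (Fin 32) ℝ) :
    evalHom M u v A B (quadForm M N) = spinorForm M u u N • 1 := by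
  have h : ∀ α, evalHom M u v A B (psi α) = u α • parityOp := fun α =>
    evalHom_gen M u v A B (.psi α)
  simp only [quadForm_apply, pair, map_sum, map_smul, map_mul, h, smul_mul_smul_comm,
    parityOp_mul_parityOp, spinorForm, LinearMap.coe_mk, AddHom.coe_mk, Finset.sum_smul, smul_smul]

theorem evalHom_pairing_phi (N : Matrix (Fin 32) (Fin 32) ℝ) :
    evalHom M u v A B (pairing M phi N) = spinorForm M u v N • 1 := by
  have h : ∀ α, evalHom M u v A B (psi α) = u α • parityOp := fun α =>
    evalHom_gen M u v A B (.psi α)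
  have h' : ∀ α, evalHom M u v A B (phi α) = v α • parityOp := fun α =>
    evalHom_gen M u v A B (.phi α)
  simp only [pairing_apply, pair, map_sum, map_smul, map_mul, h, h', smul_mul_smul_comm,
    parityOp_mul_parityOp, spinorForm, LinearMap.coe_mk, AddHom.coe_mk, Finset.sum_smul, smul_smul]

theorem evalHom_form {p : ℕ} (hp : kappa p ≠ 0) (a : Fin p → Fin 11) :
    evalHom M u v A B (form p a) =
      ((A * M.gam a).trace * etas a) • wedge₁ + ((B * M.gam a).trace * etas a) • wedge₂ := by
  match p with
  | 0 => exact absurd rfl hp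
  | 1 =>
    refine (evalHom_gen M u v A B (.e₁ (a 0))).trans ?_
    rw [evalGen, M.gam_one, etas_one]
    module
  | 2 =>
    change evalHom M u v A B (etas a • gen (.e₂ a)) = _
    rw [map_smul, evalHom_gen, evalGen]
    module
  | 3 => exact absurd rfl hp
  | 4 => exact absurd rfl hp
  | 5 =>
    change evalHom M u v A B (etas a • gen (.e₅ a)) = _
    rw [map_smul, evalHom_gen, evalGen]
    module
  | n + 6 => exact absurd rfl hp

theorem evalHom_form_mul_form {p q : ℕ} (hp : kappa p ≠ 0) (hq : kappa q ≠ 0)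
    (a : Fin p → Fin 11) (b : Fin q → Fin 11) :
    evalHom M u v A B (form p a * form q b) =
      (((A * M.gam a).trace * etas a) * ((B * M.gam b).trace * etas b) -
        ((B * M.gam a).trace * etas a) * ((A * M.gam b).trace * etas b)) • wedge₁₂ := by
  rw [map_mul, evalHom_form M u v A B hp, evalHom_form M u v A B hq]
  simp only [add_mul, mul_add, smul_mul_smul_comm, wedge₁_mul_wedge₁, wedge₂_mul_wedge₂,
      wedge₁_mul_wedge₂, wedge₂_mul_wedge₁]
  module

theorem trace_gradeProj_mul {p q : ℕ} (N : Matrix (Fin 32) (Fin 32) ℝ) :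
    (gradeProj M p A * gradeProj M q B * N).trace =
      ∑ a : Fin p → Fin 11, ∑ b : Fin q → Fin 11,
        ((A * M.gam a).trace * etas a) * ((B * M.gam b).trace * etas b) *
          (M.gam a * M.gam b * N).trace := by
  rw [gradeProj, gradeProj, Finset.sum_mul_sum]
  rw [Finset.sum_mul, Matrix.trace_sum]
  refine Finset.sum_congr rfl fun a _ => ?_
  rw [Finset.sum_mul, Matrix.trace_sum]
  refine Finset.sum_congr rfl fun b _ => ?_
  rw [smul_mul_smul_comm, smul_mul_assoc, Matrix.trace_smul, smul_eq_mul]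

/-- Summation over a and b assembles the traces with A and B into grade projections. The
antisymmetry in A and B is that of the product of the two wedge operators. -/
theorem evalHom_trilin {p q : ℕ} (hp : kappa p ≠ 0) (hq : kappa q ≠ 0) (r : ℕ) :
    evalHom M u v A B (trilin M r p q) = (kappa r * spinorForm M u u (gradeProj M r
      (gradeProj M p A * gradeProj M q B - gradeProj M p B * gradeProj M q A))) • wedge₁₂ := by
  have h : ∀ (a : Fin p → Fin 11) (b : Fin q → Fin 11) (c : Fin r → Fin 11),
      evalHom M u v A B (((M.gam a * M.gam b * M.gam c).trace * etas c) •
        (quadForm M (M.gam c) * (form p a * form q b))) =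
      (spinorForm M u u (M.gam c) * etas c *
        (((A * M.gam a).trace * etas a) * ((B * M.gam b).trace * etas b) *
          (M.gam a * M.gam b * M.gam c).trace -
        ((B * M.gam a).trace * etas a) * ((A * M.gam b).trace * etas b) *
          (M.gam a * M.gam b * M.gam c).trace)) • wedge₁₂ := by
    intro a b c
    rw [map_smul, map_mul, evalHom_quadForm, evalHom_form_mul_form M u v A B hp hq,
      smul_mul_assoc, one_mul, smul_smul, smul_smul]
    congr 1
    ring
  have h2 : spinorForm M u u (gradeProj M r
      (gradeProj M p A * gradeProj M q B - gradeProj M p B * gradeProj M q A)) =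
      ∑ a : Fin p → Fin 11, ∑ b : Fin q → Fin 11, ∑ c : Fin r → Fin 11,
      (spinorForm M u u (M.gam c) * etas c *
        (((A * M.gam a).trace * etas a) * ((B * M.gam b).trace * etas b) *
          (M.gam a * M.gam b * M.gam c).trace -
        ((B * M.gam a).trace * etas a) * ((A * M.gam b).trace * etas b) *
          (M.gam a * M.gam b * M.gam c).trace)) := by
    rw [Finset.sum_comm_cycle]
    conv_lhs => rw [gradeProj]
    rw [map_sum]
    refine Finset.sum_congr rfl fun c _ => ?_
    rw [map_smul, sub_mul, Matrix.trace_sub, trace_gradeProj_mul, trace_gradeProj_mul,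
      smul_eq_mul]
    simp only [← Finset.mul_sum, Finset.sum_sub_distrib]
    ring
  rw [trilin, map_smul, h2, mul_smul]
  simp only [map_sum, h, Finset.sum_smul]

theorem gradeProj_gam {p : ℕ} (hp : p ≤ 5) (w : Fin p → Fin 11) :
    gradeProj M p (M.gam w) = (32 * (-1 : ℝ) ^ (p * (p - 1) / 2) * p.factorial) • M.gam w :=
  M.sum_trace_gam_smul LinearMap.id hp w

theorem gradeProj_gam_of_ne {p q : ℕ} (h : q ≠ p) (hpq : q + p ≤ 10) (w : Fin q → Fin 11) :
    gradeProj M p (M.gam w) = 0 := by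
  simp only [gradeProj, M.trace_gam_gam_of_ne h hpq, zero_mul, zero_smul, Finset.sum_const_zero]

theorem gradeProj_zero (p : ℕ) : gradeProj M p 0 = 0 := by
  simp [gradeProj]

theorem gradeProj_smul (p : ℕ) (r : ℝ) : gradeProj M p (r • A) = r • gradeProj M p A := by
  simp only [gradeProj, smul_mul_assoc, Matrix.trace_smul, smul_eq_mul, Finset.smul_sum, smul_smul,
    mul_assoc]

end

/-! ### Independence of the invariants -/

section

variable (M : MajoranaRep)

theorem spinorForm_apply (u v : Fin 32 → ℝ) (A : Matrix (Fin 32) (Fin 32) ℝ) :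
    spinorForm M u v A = u ⬝ᵥ (M.C * A).mulVec v := by
  simp only [spinorForm, LinearMap.coe_mk, AddHom.coe_mk, dotProduct, Matrix.mulVec,
    Finset.mul_sum]
  refine Finset.sum_congr rfl fun α _ => Finset.sum_congr rfl fun γ _ => ?_
  ring

theorem spinorForm_single (α γ : Fin 32) (A : Matrix (Fin 32) (Fin 32) ℝ) :
    spinorForm M (Pi.single α 1) (Pi.single γ 1) A = (M.C * A) α γ := by
  rw [spinorForm_apply, Matrix.mulVec_single_one, single_dotProduct, one_mul, Matrix.col_apply]

theorem MajoranaRep.isUnit_det_C : IsUnit M.C.det := M.nondegenerate.isUnit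

theorem MajoranaRep.IsSkewAdjoint.transpose_eq {M : MajoranaRep} {A : Matrix (Fin 32) (Fin 32) ℝ}
    (hA : M.IsSkewAdjoint A) : (M.C * A).transpose = M.C * A := by
  rw [Matrix.transpose_mul, M.skew, mul_neg, hA, neg_neg]

theorem spinorForm_symm {A : Matrix (Fin 32) (Fin 32) ℝ} (hA : M.IsSkewAdjoint A)
    (u v : Fin 32 → ℝ) : spinorForm M u v A = spinorForm M v u A := by
  rw [spinorForm_apply, spinorForm_apply, Matrix.dotProduct_mulVec, dotProduct_comm,
    ← Matrix.mulVec_transpose, hA.transpose_eq]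

theorem spinorForm_add_left (u u' v : Fin 32 → ℝ) (A : Matrix (Fin 32) (Fin 32) ℝ) :
    spinorForm M (u + u') v A = spinorForm M u v A + spinorForm M u' v A := by
  simp only [spinorForm_apply, add_dotProduct]

theorem spinorForm_add_right (u v v' : Fin 32 → ℝ) (A : Matrix (Fin 32) (Fin 32) ℝ) :
    spinorForm M u (v + v') A = spinorForm M u v A + spinorForm M u v' A := by
  simp only [spinorForm_apply, Matrix.mulVec_add, dotProduct_add]

theorem spinorForm_sub_left (u u' v : Fin 32 → ℝ) (A : Matrix (Fin 32) (Fin 32) ℝ) :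
    spinorForm M (u - u') v A = spinorForm M u v A - spinorForm M u' v A := by
  simp only [spinorForm_apply, sub_dotProduct]

theorem spinorForm_sub_right (u v v' : Fin 32 → ℝ) (A : Matrix (Fin 32) (Fin 32) ℝ) :
    spinorForm M u (v - v') A = spinorForm M u v A - spinorForm M u v' A := by
  simp only [spinorForm_apply, Matrix.mulVec_sub, dotProduct_sub]

/-- `M.C * A` is symmetric, so by polarization its quadratic form determines it. -/
theorem exists_spinorForm_ne_zero {A : Matrix (Fin 32) (Fin 32) ℝ} (hA : M.IsSkewAdjoint A)
    (h0 : A ≠ 0) : ∃ u, spinorForm M u u A ≠ 0 := by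
  by_contra! h
  refine h0 ?_
  have h1 : M.C * A = 0 := by
    ext α γ
    have h2 := h (Pi.single α 1 + Pi.single γ 1)
    rw [spinorForm_add_left, spinorForm_add_right, spinorForm_add_right, h, h,
      spinorForm_symm M hA (Pi.single γ 1), spinorForm_single] at h2
    rw [Matrix.zero_apply]
    linarith
  rw [← one_mul A, ← Matrix.nonsing_inv_mul M.C M.isUnit_det_C, mul_assoc, h1, mul_zero]

theorem spinorForm_self_eq_zero {A : Matrix (Fin 32) (Fin 32) ℝ}
    (hA : A.transpose * M.C = M.C * A) (u : Fin 32 → ℝ) : spinorForm M u u A = 0 := by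
  have h : spinorForm M u u A = -spinorForm M u u A := by
    conv_lhs => rw [spinorForm_apply, Matrix.dotProduct_mulVec, dotProduct_comm,
      ← Matrix.mulVec_transpose, Matrix.transpose_mul, M.skew, mul_neg, hA, Matrix.neg_mulVec,
      dotProduct_neg, ← spinorForm_apply]
  linarith

theorem spinorForm_gam_eq_zero {p : ℕ} (hp : Even (p * (p + 1) / 2)) (a : Fin p → Fin 11)
    (u : Fin 32 → ℝ) : spinorForm M u u (M.gam a) = 0 :=
  spinorForm_self_eq_zero M (by rw [M.gam_transpose_mul, hp.neg_one_pow, one_smul]) u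

theorem spinorForm_eq_sum_gradeProj (u : Fin 32 → ℝ) (A : Matrix (Fin 32) (Fin 32) ℝ) :
    32 * spinorForm M u u A = ∑ p ∈ ({1, 2, 5} : Finset ℕ),
      kappa p / p.factorial * spinorForm M u u (gradeProj M p A) := by
  have h := M.completeness (spinorForm M u u)
    (fun a => spinorForm_gam_eq_zero M (by decide) a u)
    (fun a => spinorForm_gam_eq_zero M (by decide) a u)
    (fun a => spinorForm_gam_eq_zero M (by decide) a u) A
  simpa only [gradeProj, map_sum, map_smul, smul_eq_mul] using h

theorem isUnit_gam {p : ℕ} {a : Fin p → Fin 11} (ha : Function.Injective a) :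
    IsUnit (M.gam a) := by
  have h : M.gam a * (((-1 : ℝ) ^ (p * (p - 1) / 2) * etas a) • M.gam a) = 1 := by
    rw [mul_smul_comm, M.gam_mul_self ha, smul_smul, mul_mul_mul_comm, etas_mul_self, ← pow_add,
      Even.neg_one_pow ⟨_, rfl⟩, one_mul, one_smul]
  exact IsUnit.of_mul_eq_one _ h

theorem gam_mul_gam {p q : ℕ} {w : Fin p → Fin 11} {z : Fin q → Fin 11}
    (hw : Function.Injective w) (hz : Function.Injective z)
    (h : Odd (p * q + ∑ i, mult z (w i))) : M.gam z * M.gam w = -(M.gam w * M.gam z) := by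
  rw [M.gam_of_injective hw, M.gam_of_injective hz, M.word_mul_word w z, h.neg_one_pow,
    neg_one_smul, neg_neg]

/-- The number of common indices of w and z determines which grades the product can have, directly
or through the volume element. -/
theorem gradeProj_gam_mul_gam {p q : ℕ} (r : ℕ) {w : Fin p → Fin 11} {z : Fin q → Fin 11}
    (h : if Even (p + q + r) then 2 * ∑ i, mult z (w i) + r ≠ p + q
      else 2 * ∑ i, mult z (w i) + 11 ≠ p + q + r) : gradeProj M r (M.gam w * M.gam z) = 0 := by
  have hs : ∑ i, mult z (w i) = ∑ b, mult w b * mult z b := by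
    rw [sum_mult_mul_mult]
    simp only [mult, eq_comm]
  refine Finset.sum_eq_zero fun c _ => ?_
  by_cases h0 : (M.gam w * M.gam z * M.gam c).trace = 0
  · rw [h0, zero_mul, zero_smul]
  · rw [hs] at h
    split_ifs at h with he
    · exact absurd (sum_mult_of_trace_ne_zero_of_even M he h0) h
    · exact absurd (sum_mult_of_trace_ne_zero_of_odd M (Nat.not_even_iff_odd.1 he) h0) h

/-- The product of two anticommuting skew self-adjoint matrices is skew self-adjoint, and here also
invertible. Its form is therefore nonzero for some u, and grade r alone can account for it. -/
theorem exists_spinorForm_gradeProj_ne_zero {p q : ℕ} (r : ℕ) {w : Fin p → Fin 11}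
    {z : Fin q → Fin 11} (hp : kappa p ≠ 0) (hq : kappa q ≠ 0) (hw : Function.Injective w)
    (hz : Function.Injective z) (h : M.gam z * M.gam w = -(M.gam w * M.gam z))
    (hr : ∀ r' ∈ ({1, 2, 5} : Finset ℕ), r' ≠ r → gradeProj M r' (M.gam w * M.gam z) = 0) :
    ∃ u, spinorForm M u u (gradeProj M r (M.gam w * M.gam z)) ≠ 0 := by
  have hs : M.IsSkewAdjoint (M.gam w * M.gam z) := by
    rw [MajoranaRep.IsSkewAdjoint, Matrix.transpose_mul, mul_assoc, M.isSkewAdjoint_gam hp, mul_neg,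
      ← mul_assoc, M.isSkewAdjoint_gam hq, neg_mul, neg_neg, mul_assoc, h, mul_neg]
  obtain ⟨u, hu⟩ := exists_spinorForm_ne_zero M hs
    ((isUnit_gam M hw).mul (isUnit_gam M hz)).ne_zero
  refine ⟨u, fun h0 => hu ?_⟩
  have h1 := spinorForm_eq_sum_gradeProj M u (M.gam w * M.gam z)
  rw [Finset.sum_eq_zero] at h1
  · linarith
  · intro r' hr'
    by_cases hrr : r' = r
    · rw [hrr, h0, mul_zero]
    · rw [hr r' hr' hrr, map_zero, mul_zero]

/-- For equal lengths the two orderings contribute equally because the matrices anticommute; for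
different lengths only one ordering survives the grade projections. -/
theorem evalHom_trilin_gam {m n : ℕ} {r : ℕ} {w : Fin m → Fin 11} {z : Fin n → Fin 11}
    (hm : m ≤ 5) (hn : n ≤ 5) (hκ : kappa m ≠ 0) (hκ' : kappa n ≠ 0) (hr : kappa r ≠ 0)
    (h : M.gam z * M.gam w = -(M.gam w * M.gam z)) : ∃ c : ℝ, c ≠ 0 ∧ ∀ u v,
      evalHom M u v (M.gam w) (M.gam z) (trilin M r m n) =
        (c * spinorForm M u u (gradeProj M r (M.gam w * M.gam z))) • wedge₁₂ := by
  have hc : ∀ p : ℕ, (32 * (-1 : ℝ) ^ (p * (p - 1) / 2) * p.factorial) ≠ 0 := fun p => by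
    positivity
  by_cases hmn : m = n
  · subst hmn
    refine ⟨kappa r * (2 * ((32 * (-1 : ℝ) ^ (m * (m - 1) / 2) * m.factorial) *
      (32 * (-1 : ℝ) ^ (m * (m - 1) / 2) * m.factorial))), mul_ne_zero hr
        (mul_ne_zero two_ne_zero (mul_ne_zero (hc m) (hc m))), fun u v => ?_⟩
    rw [evalHom_trilin M u v _ _ hκ hκ, gradeProj_gam M hm, gradeProj_gam M hm, smul_mul_smul_comm,
      smul_mul_smul_comm, h, smul_neg, sub_neg_eq_add, ← two_smul ℝ, smul_smul, gradeProj_smul,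
      map_smul, smul_eq_mul, mul_assoc (kappa r), mul_assoc (2 : ℝ)]
  · refine ⟨kappa r * ((32 * (-1 : ℝ) ^ (m * (m - 1) / 2) * m.factorial) *
      (32 * (-1 : ℝ) ^ (n * (n - 1) / 2) * n.factorial)), mul_ne_zero hr
        (mul_ne_zero (hc m) (hc n)), fun u v => ?_⟩
    rw [evalHom_trilin M u v _ _ hκ hκ', gradeProj_gam M hm, gradeProj_gam M hn,
      gradeProj_gam_of_ne M (Ne.symm hmn) (by omega), zero_mul, sub_zero, smul_mul_smul_comm,
      gradeProj_smul, map_smul, smul_eq_mul, mul_assoc (kappa r)]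

theorem evalHom_trilin_gam_of_ne {m n p q : ℕ} (r : ℕ) (w : Fin m → Fin 11) (z : Fin n → Fin 11)
    (hm : m ≤ 5) (hn : n ≤ 5) (hp : p ≤ 5) (hq : q ≤ 5) (hκ : kappa p ≠ 0) (hκ' : kappa q ≠ 0)
    (h : m ≠ p ∨ n ≠ q) (h' : n ≠ p ∨ m ≠ q) (u v : Fin 32 → ℝ) :
    evalHom M u v (M.gam w) (M.gam z) (trilin M r p q) = 0 := by
  have key : ∀ {m n : ℕ} (w : Fin m → Fin 11) (z : Fin n → Fin 11), m ≤ 5 → n ≤ 5 →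
      (m ≠ p ∨ n ≠ q) → gradeProj M p (M.gam w) * gradeProj M q (M.gam z) = 0 := by
    intro m n w z hm hn h
    rcases h with h | h
    · rw [gradeProj_gam_of_ne M h (by omega), zero_mul]
    · rw [gradeProj_gam_of_ne M h (by omega), mul_zero]
  rw [evalHom_trilin M u v _ _ hκ hκ', key w z hm hn h, key z w hn hm h', sub_zero, gradeProj_zero,
    map_zero, mul_zero, zero_smul]

theorem evalHom_fierzTerm_phi (u v : Fin 32 → ℝ) (A B : Matrix (Fin 32) (Fin 32) ℝ) :
    evalHom M u v A B (fierzTerm M phi 1) =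
      (∑ a, eta a * (spinorForm M u u (M.Γ a) * spinorForm M u v (M.Γ a))) • 1 := by
  simp only [fierzTerm_one, map_sum, map_smul, map_mul, evalHom_quadForm, evalHom_pairing_phi,
    smul_mul_smul_comm, one_mul, smul_smul, Finset.sum_smul]

theorem spinorForm_zero_right (u : Fin 32 → ℝ) (A : Matrix (Fin 32) (Fin 32) ℝ) :
    spinorForm M u 0 A = 0 := by
  rw [spinorForm_apply, Matrix.mulVec_zero, dotProduct_zero]

/-- The invariant `(ψ̄ Γ_a ψ)(ψ̄ Γ^a φ)` does not vanish. -/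
theorem exists_sum_spinorForm_ne_zero : ∃ u v : Fin 32 → ℝ,
    ∑ a, eta a * (spinorForm M u u (M.Γ a) * spinorForm M u v (M.Γ a)) ≠ 0 := by
  by_contra! h
  have hs : ∀ a, M.IsSkewAdjoint (M.Γ a) := M.skewAdjoint
  -- Polarization: the difference of the values at u + w and u − w, less the part cubic in w,
  -- isolates the part linear in w.
  have h1 : ∀ u w v, ∑ a, eta a * (spinorForm M u u (M.Γ a) * spinorForm M w v (M.Γ a) +
      2 * (spinorForm M w u (M.Γ a) * spinorForm M v u (M.Γ a))) = 0 := by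
    intro u w v
    have e1 := h (u + w) v
    have e2 := h (u - w) v
    have e3 := h w v
    have e4 : 2 * ∑ a, eta a * (spinorForm M u u (M.Γ a) * spinorForm M w v (M.Γ a) +
        2 * (spinorForm M w u (M.Γ a) * spinorForm M v u (M.Γ a))) =
        ∑ a, eta a * (spinorForm M (u + w) (u + w) (M.Γ a) * spinorForm M (u + w) v (M.Γ a)) -
        ∑ a, eta a * (spinorForm M (u - w) (u - w) (M.Γ a) * spinorForm M (u - w) v (M.Γ a)) -
        2 * ∑ a, eta a * (spinorForm M w w (M.Γ a) * spinorForm M w v (M.Γ a)) := by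
      rw [Finset.mul_sum, Finset.mul_sum, ← Finset.sum_sub_distrib, ← Finset.sum_sub_distrib]
      refine Finset.sum_congr rfl fun a _ => ?_
      simp only [spinorForm_add_left, spinorForm_add_right, spinorForm_sub_left,
        spinorForm_sub_right]
      rw [spinorForm_symm M (hs a) v u, spinorForm_symm M (hs a) u w]
      ring
    rw [e1, e2, e3] at e4
    linarith
  -- As w and v are arbitrary, the polarized relation is an identity of matrices.
  have h2 : ∀ u, ∑ a, eta a • (spinorForm M u u (M.Γ a) • (M.C * M.Γ a) +
      (2 : ℝ) • Matrix.vecMulVec ((M.C * M.Γ a).mulVec u) ((M.C * M.Γ a).mulVec u)) = 0 := by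
    intro u
    ext i j
    have e := h1 u (Pi.single i 1) (Pi.single j 1)
    simp only [spinorForm_single] at e
    rw [Matrix.sum_apply, Matrix.zero_apply, ← e]
    refine Finset.sum_congr rfl fun a _ => ?_
    simp only [Matrix.smul_apply, Matrix.add_apply, smul_eq_mul, Matrix.vecMulVec_apply]
    have e5 : ∀ l, spinorForm M (Pi.single l 1) u (M.Γ a) = (M.C * M.Γ a).mulVec u l := fun l => by
      rw [spinorForm_apply, single_dotProduct, one_mul]
    rw [e5, e5]
  have hC : M.C⁻¹ * M.C = 1 := Matrix.nonsing_inv_mul _ M.isUnit_det_C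
  -- The trace against Γ_b C⁻¹ gives 32 (ū Γ_b u) from the first term and 2 · (−9) (ū Γ_b u) from
  -- the second, by `sum_Γ_mul_gam_mul_Γ`; the total factor 14 is nonzero.
  have h3 : ∀ u b, spinorForm M u u (M.Γ b) = 0 := by
    intro u b
    have e := congrArg (fun X => (X * (M.Γ b * M.C⁻¹)).trace) (h2 u)
    have e1 : ∀ a, (M.C * M.Γ a * (M.Γ b * M.C⁻¹)).trace = 32 * if a = b then eta a else 0 := by
      intro a
      have t1 : (M.C * M.Γ a * (M.Γ b * M.C⁻¹)).trace = (M.Γ a * M.Γ b).trace := by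
        rw [← mul_assoc, Matrix.trace_mul_comm, mul_assoc M.C, ← mul_assoc, hC, one_mul]
      have t2 := congrArg Matrix.trace (M.clifford a b)
      rw [Matrix.trace_add, Matrix.trace_mul_comm (M.Γ b), Matrix.trace_smul, Matrix.trace_one,
        smul_eq_mul, Fintype.card_fin] at t2
      rw [t1]
      push_cast at t2
      linarith
    have e2 : ∀ a, (Matrix.vecMulVec ((M.C * M.Γ a).mulVec u) ((M.C * M.Γ a).mulVec u) *
        (M.Γ b * M.C⁻¹)).trace = spinorForm M u u (M.Γ a * M.Γ b * M.Γ a) := by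
      intro a
      rw [Matrix.vecMulVec_mul, Matrix.trace_vecMulVec, dotProduct_comm]
      conv_lhs => enter [1, 1]; rw [← (hs a).transpose_eq, Matrix.mulVec_transpose]
      rw [Matrix.vecMul_vecMul, ← Matrix.dotProduct_mulVec, Matrix.mulVec_mulVec, spinorForm_apply]
      congr 2
      calc M.C * M.Γ a * (M.Γ b * M.C⁻¹) * (M.C * M.Γ a)
          = M.C * M.Γ a * M.Γ b * (M.C⁻¹ * M.C) * M.Γ a := by noncomm_ring
        _ = M.C * (M.Γ a * M.Γ b * M.Γ a) := by rw [hC]; noncomm_ring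
    have e3 := congrArg (spinorForm M u u) (M.sum_Γ_mul_gam_mul_Γ ![b])
    simp only [M.gam_one, Matrix.cons_val_zero, map_sum, map_smul, smul_eq_mul] at e3
    simp only [Finset.sum_mul, Matrix.trace_sum, smul_mul_assoc, add_mul, Matrix.trace_smul,
      Matrix.trace_add, e1, e2, smul_eq_mul, zero_mul, Matrix.trace_zero, mul_add,
      Finset.sum_add_distrib, mul_left_comm _ (2 : ℝ), ← Finset.mul_sum, e3] at e
    simp only [mul_ite, mul_zero, Finset.sum_ite_eq', Finset.mem_univ, if_true] at e
    have e4 : eta b * (spinorForm M u u (M.Γ b) * (32 * eta b)) =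
        32 * spinorForm M u u (M.Γ b) := by
      linear_combination 32 * spinorForm M u u (M.Γ b) * eta_mul_self b
    push_cast at e
    linarith
  obtain ⟨u, hu⟩ := exists_spinorForm_ne_zero M (hs 0) (by
    intro h0
    have := M.Γ_sq 0
    rw [h0, zero_mul] at this
    have := congrFun (congrFun this 0) 0
    simp [eta] at this)
  exact hu (h3 u 0)

end

/-! ### Separation of the invariants, and conclusion. -/

section

variable (M : MajoranaRep)

theorem eq_zero_of_evalHom_eq_smul_trilin {m n r : ℕ} (w : Fin m → Fin 11) (z : Fin n → Fin 11)
    (hm : kappa m ≠ 0) (hn : kappa n ≠ 0) (hr : kappa r ≠ 0) (hm5 : m ≤ 5) (hn5 : n ≤ 5)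
    (hw : Function.Injective w) (hz : Function.Injective z)
    (h : Odd (m * n + ∑ i, mult z (w i)))
    (hP : ∀ r' ∈ ({1, 2, 5} : Finset ℕ), r' ≠ r → gradeProj M r' (M.gam w * M.gam z) = 0)
    {x : ℝ} (hx : ∀ u, x • evalHom M u 0 (M.gam w) (M.gam z) (trilin M r m n) = 0) : x = 0 := by
  have hc := gam_mul_gam M hw hz h
  obtain ⟨u, hu⟩ := exists_spinorForm_gradeProj_ne_zero M r hm hn hw hz hc hP
  obtain ⟨c, hc0, hc⟩ := evalHom_trilin_gam M hm5 hn5 hm hn hr hc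
  have h1 := hx u
  rw [hc, smul_smul] at h1
  exact (mul_eq_zero.1 (smul_wedge₁₂_eq_zero h1)).resolve_right (mul_ne_zero hc0 hu)

theorem evalHom_trilin_eq_zero {m r : ℕ} {w z : Fin m → Fin 11}
    (hm : kappa m ≠ 0) (hr : kappa r ≠ 0) (hm5 : m ≤ 5)
    (hw : Function.Injective w) (hz : Function.Injective z)
    (h : Odd (m * m + ∑ i, mult z (w i)))
    (hP : gradeProj M r (M.gam w * M.gam z) = 0) (u v : Fin 32 → ℝ) :
    evalHom M u v (M.gam w) (M.gam z) (trilin M r m m) = 0 := by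
  obtain ⟨c, -, hc⟩ := evalHom_trilin_gam M hm5 hm5 hm hm hr (gam_mul_gam M hw hz h)
  rw [hc, hP, map_zero, mul_zero, zero_smul]

theorem evalHom_fierzTerm_phi_zero (u : Fin 32 → ℝ) (A B : Matrix (Fin 32) (Fin 32) ℝ) :
    evalHom M u 0 A B (fierzTerm M phi 1) = 0 := by
  simp only [evalHom_fierzTerm_phi, spinorForm_zero_right, mul_zero, Finset.sum_const_zero,
    zero_smul]

theorem evalHom_trilin_zero (r : ℕ) {p q : ℕ} (hp : kappa p ≠ 0) (hq : kappa q ≠ 0)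
    (u v : Fin 32 → ℝ) : evalHom M u v 0 0 (trilin M r p q) = 0 := by
  rw [evalHom_trilin M u v _ _ hp hq, gradeProj_zero, zero_mul, sub_zero, gradeProj_zero, map_zero,
    mul_zero, zero_smul]

theorem kappa_one_ne_zero : kappa 1 ≠ 0 := by norm_num [kappa]

theorem kappa_two_ne_zero : kappa 2 ≠ 0 := by norm_num [kappa]

theorem kappa_five_ne_zero : kappa 5 ≠ 0 := by norm_num [kappa]

/-- Evaluate at A = Γ_w, B = Γ_z. The lengths of w and z select the lengths of the two even forms,
and v = 0 removes the term with φ. The three invariants with lengths (5, 5) are told apart by the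
number of indices common to w and z. -/
theorem residual_eq_zero {s : ℝ} {k : Fin 9 → ℝ} (h : d M s (P₃ M k) = G₄ M) (i : Fin 9)
    (hi : i ≠ 3) : residual s k i = 0 := by
  have h0 := d_P₃_sub_G₄ M s k
  rw [h, sub_self] at h0
  generalize residual s k = x at h0
  have k1 := kappa_one_ne_zero
  have k2 := kappa_two_ne_zero
  have k5 := kappa_five_ne_zero
  have key : ∀ u v A B, x 0 • evalHom M u v A B (trilin M 2 1 1) +
      x 1 • evalHom M u v A B (trilin M 1 1 2) + x 2 • evalHom M u v A B (trilin M 2 2 2) +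
      x 3 • evalHom M u v A B (trilin M 5 1 5) + x 4 • evalHom M u v A B (trilin M 5 2 5) +
      x 5 • evalHom M u v A B (trilin M 1 5 5) + x 6 • evalHom M u v A B (trilin M 2 5 5) +
      x 7 • evalHom M u v A B (trilin M 5 5 5) +
      x 8 • evalHom M u v A B (fierzTerm M phi 1) = 0 := fun u v A B => by
    simpa only [map_add, map_smul, map_zero] using (congrArg (evalHom M u v A B) h0).symm
  have hE : ∀ {m n p q : ℕ} {r : ℕ} {w : Fin m → Fin 11} {z : Fin n → Fin 11}, m ≤ 5 → n ≤ 5 →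
      p ≤ 5 → q ≤ 5 → kappa p ≠ 0 → kappa q ≠ 0 → (m ≠ p ∨ n ≠ q) → (n ≠ p ∨ m ≠ q) → ∀ u,
      evalHom M u 0 (M.gam w) (M.gam z) (trilin M r p q) = 0 :=
    fun hm hn hp hq hκ hκ' h h' u =>
      evalHom_trilin_gam_of_ne M _ _ _ hm hn hp hq hκ hκ' h h' u 0
  have z0 : x 0 = 0 := by
    refine eq_zero_of_evalHom_eq_smul_trilin M (m := 1) (n := 1) (r := 2)
      ![1] ![2] k1 k1 k2 (by decide) (by decide)
      (by decide) (by decide) (by decide) (fun r' hr' hne => gradeProj_gam_mul_gam M r' ?_)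
      fun u => ?_
    · revert r'; decide
    · simpa [hE, k1, k2, k5, evalHom_fierzTerm_phi_zero] using
        key u 0 (M.gam ![1]) (M.gam ![2])
  have z1 : x 1 = 0 := by
    refine eq_zero_of_evalHom_eq_smul_trilin M (m := 1) (n := 2) (r := 1)
      ![1] ![1, 2] k1 k2 k1 (by decide) (by decide)
      (by decide) (by decide) (by decide) (fun r' hr' hne => gradeProj_gam_mul_gam M r' ?_)
      fun u => ?_
    · revert r'; decide
    · simpa [hE, k1, k2, k5, evalHom_fierzTerm_phi_zero] using
        key u 0 (M.gam ![1]) (M.gam ![1, 2])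
  have z2 : x 2 = 0 := by
    refine eq_zero_of_evalHom_eq_smul_trilin M (m := 2) (n := 2) (r := 2)
      ![1, 2] ![2, 3] k2 k2 k2 (by decide) (by decide)
      (by decide) (by decide) (by decide) (fun r' hr' hne => gradeProj_gam_mul_gam M r' ?_)
      fun u => ?_
    · revert r'; decide
    · simpa [hE, k1, k2, k5, evalHom_fierzTerm_phi_zero] using
        key u 0 (M.gam ![1, 2]) (M.gam ![2, 3])
  have z4 : x 4 = 0 := by
    refine eq_zero_of_evalHom_eq_smul_trilin M (m := 2) (n := 5) (r := 5)
      ![1, 2] ![2, 3, 4, 5, 6] k2 k5 k5 (by decide) (by decide)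
      (by decide) (by decide) (by decide) (fun r' hr' hne => gradeProj_gam_mul_gam M r' ?_)
      fun u => ?_
    · revert r'; decide
    · simpa [hE, k1, k2, k5, evalHom_fierzTerm_phi_zero] using
        key u 0 (M.gam ![1, 2]) (M.gam ![2, 3, 4, 5, 6])
  -- Disjoint tuples: the product of all ten spatial gamma matrices is proportional to Γ_0, of grade
  -- 1.
  have z5 : x 5 = 0 := by
    have hP : ∀ r' ∈ ({1, 2, 5} : Finset ℕ), r' ≠ 1 →
        gradeProj M r' (M.gam ![1, 2, 3, 4, 5] * M.gam ![6, 7, 8, 9, 10]) = 0 :=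
      fun r' hr' hne => gradeProj_gam_mul_gam M r' (by revert r'; decide)
    refine eq_zero_of_evalHom_eq_smul_trilin M (m := 5) (n := 5) (r := 1)
      ![1, 2, 3, 4, 5] ![6, 7, 8, 9, 10] k5 k5 k1 le_rfl le_rfl (by decide) (by decide)
      (by decide) hP fun u => ?_
    have t := fun r' (hr' : r' ∈ ({1, 2, 5} : Finset ℕ)) (hne : r' ≠ 1) (hκ : kappa r' ≠ 0) =>
      evalHom_trilin_eq_zero M k5 hκ le_rfl (by decide) (by decide) (by decide)
        (hP r' hr' hne) u 0
    simpa [hE, k1, k2, k5, evalHom_fierzTerm_phi_zero, t] using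
      key u 0 (M.gam ![1, 2, 3, 4, 5]) (M.gam ![6, 7, 8, 9, 10])
  -- Four common indices: the product has grade 2.
  have z6 : x 6 = 0 := by
    have hP : ∀ r' ∈ ({1, 2, 5} : Finset ℕ), r' ≠ 2 →
        gradeProj M r' (M.gam ![1, 2, 3, 4, 5] * M.gam ![1, 2, 3, 4, 6]) = 0 :=
      fun r' hr' hne => gradeProj_gam_mul_gam M r' (by revert r'; decide)
    refine eq_zero_of_evalHom_eq_smul_trilin M (m := 5) (n := 5) (r := 2)
      ![1, 2, 3, 4, 5] ![1, 2, 3, 4, 6] k5 k5 k2 le_rfl le_rfl (by decide) (by decide)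
      (by decide) hP fun u => ?_
    have t := fun r' (hr' : r' ∈ ({1, 2, 5} : Finset ℕ)) (hne : r' ≠ 2) (hκ : kappa r' ≠ 0) =>
      evalHom_trilin_eq_zero M k5 hκ le_rfl (by decide) (by decide) (by decide)
        (hP r' hr' hne) u 0
    simpa [hE, k1, k2, k5, evalHom_fierzTerm_phi_zero, t] using
      key u 0 (M.gam ![1, 2, 3, 4, 5]) (M.gam ![1, 2, 3, 4, 6])
  -- Two common indices: the product has six letters and is dual to grade 5.
  have z7 : x 7 = 0 := by
    have hP : ∀ r' ∈ ({1, 2, 5} : Finset ℕ), r' ≠ 5 →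
        gradeProj M r' (M.gam ![1, 2, 3, 4, 5] * M.gam ![1, 2, 6, 7, 8]) = 0 :=
      fun r' hr' hne => gradeProj_gam_mul_gam M r' (by revert r'; decide)
    refine eq_zero_of_evalHom_eq_smul_trilin M (m := 5) (n := 5) (r := 5)
      ![1, 2, 3, 4, 5] ![1, 2, 6, 7, 8] k5 k5 k5 le_rfl le_rfl (by decide) (by decide)
      (by decide) hP fun u => ?_
    have t := fun r' (hr' : r' ∈ ({1, 2, 5} : Finset ℕ)) (hne : r' ≠ 5) (hκ : kappa r' ≠ 0) =>
      evalHom_trilin_eq_zero M k5 hκ le_rfl (by decide) (by decide) (by decide)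
        (hP r' hr' hne) u 0
    simpa [hE, k1, k2, k5, evalHom_fierzTerm_phi_zero, t] using
      key u 0 (M.gam ![1, 2, 3, 4, 5]) (M.gam ![1, 2, 6, 7, 8])
  -- With A = B = 0 all even generators are sent to zero, and only the invariant with φ survives.
  have z8 : x 8 = 0 := by
    obtain ⟨u, v, huv⟩ := exists_sum_spinorForm_ne_zero M
    have e := key u v 0 0
    simp only [evalHom_trilin_zero, k1, k2, k5, ne_eq, not_false_eq_true, smul_zero, add_zero,
      zero_add, evalHom_fierzTerm_phi, smul_smul] at e
    have e1 := congrFun (congrFun e 0) 0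
    simp only [Matrix.smul_apply, Matrix.one_apply_eq, Matrix.zero_apply, smul_eq_mul,
      mul_one] at e1
    exact (mul_eq_zero.1 e1).resolve_right huv
  fin_cases i
  exacts [z0, z1, z2, absurd rfl hi, z4, z5, z6, z7, z8]

end

end MAlg

end

theorem mainTheorem9 (M : MAlg.MajoranaRep) :
    (∀ s : ℝ, MAlg.d M s (MAlg.P₃ M MAlg.newSolution) = MAlg.G₄ M) ∧
    (∀ s : ℝ, s ≠ 0 →
      MAlg.d M s (MAlg.P₃ M (MAlg.oldSolution s)) = MAlg.G₄ M ∧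
      ∀ k : Fin 9 → ℝ, MAlg.d M s (MAlg.P₃ M k) = MAlg.G₄ M ↔
        ∃ t : ℝ, k = (1 - t) • MAlg.oldSolution s + t • MAlg.newSolution) := by
  have key : ∀ s k, MAlg.residual s k = 0 → MAlg.d M s (MAlg.P₃ M k) = MAlg.G₄ M := by
    intro s k h
    have h0 := MAlg.d_P₃_sub_G₄ M s k
    simp only [h, Pi.zero_apply, zero_smul, add_zero] at h0
    exact sub_eq_zero.1 h0
  refine ⟨fun s => key s _ (MAlg.residual_newSolution s), fun s hs =>
    ⟨key s _ (MAlg.residual_oldSolution hs), fun k => ⟨fun h => ⟨_, MAlg.eq_of_residual_eq_zero hs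
      (MAlg.residual_eq_zero M h)⟩, ?_⟩⟩⟩
  rintro ⟨t, rfl⟩
  refine key s _ ?_
  rw [MAlg.residual_sub, MAlg.residual_newSolution, MAlg.residual_oldSolution hs, smul_zero,
    smul_zero, add_zero]
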